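/- Let $n\ge 1$. Let $\langle\cdot,\cdot\rangle=\mathrm{Re}\sum_j \bar u_jv_j$ be the Euclidean inner product of $\mathbb C^n=\mathbb R^{2n}$, $J$ multiplication by $i$, $\omega(u,v)=\langle Ju,v\rangle$ and $\Omega=dz_1\wedge\dots\wedge dz_n$. Let $\Sigma$ be a smooth oriented $n$-manifold without boundary (Hausdorff, second countable), let $T\in\mathbb R$, and let $F:\Sigma\times[0,T)\to\mathbb C^n$ be a smooth Lagrangian mean curvature flow with zero Maslov class. That is: $F$ is smooth, each $F_t=F(\cdot,t)$ is an immersion with $F_t^*\omega=0$, $\partial_tF=\mathbf H$ where $\mathbf H(\cdot,t)$ is the mean curvature vector of $F_t$ (the trace of its second fundamental form), and there is a single-valued continuous function $\theta:\Sigma\times[0,T)\to\mathbb R$ (the Lagrangian angle) with $F_t^*\Omega=e^{i\theta(\cdot,t)}\,d\mu_t$ for every $t$, where $d\mu_t$ is the area form of the metric induced by $F_t$ (and also denotes its area measure). Assume that either $\Sigma$ is compact, or the flow is controlled at infinity in the following sense: $F_0$ is proper, $\int_\Sigma e^{-c|F_0|^2}d\mu_0<\infty$ for every $c>0$ (for instance,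 $F_0$ has polynomial area growth), and $\theta$ and $|\mathbf H|$ are bounded on $\Sigma\times[0,b]$ for every $b\in[0,T)$. Let $f\in C^1(\mathbb R)$ be nonnegative with piecewise continuous second derivative: there is a set of break points, finitely many in each bounded interval, off which $f''$ exists and is continuous, and $f''$ has finite one-sided limits at each break point. Let $X_0\in\mathbb C^n$ and $t_0\in\mathbb R$ (for instance, $(X_0,t_0)=(X_0,T)$ may be a point where the flow develops a finite time singularity), and for $t<t_0$ put $$\rho(X,X_0,t,t_0)=\frac{1}{(4\pi(t_0-t))^{n/2}}\exp\left(-\frac{|X-X_0|^2}{4(t_0-t)}\right).$$ Then for every $t\in[0,T)$ with $t<t_0$, writing $X=F_t$ for the position vector and $\perp$ for the projection to the normal space of $F_t$, the three integrands below are integrable with respect to $\mu_t$, the function $t\mapsto\int_\Sigma f(\theta)\rho\,d\mu_t$ is differentiable at $t$ (from the right if $t=0$), and $$\frac{d}{dt}\int_{\Sigma} f(\theta)\rho(X,X_0,t,t_0)\,d\mu_t=-\int_{\Sigma} f(\theta)\rho(X,X_0,t,t_0)\left|\mathbf H+\frac{(X-X_0)^{\perp}}{2(t_0-t)}\right|^2d\mu_t-\int_{\Sigma}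 f''(\theta)|\mathbf H|^2\rho(X,X_0,t,t_0)\,d\mu_t .$$ Here $f''(\theta)$ is assigned the value $0$ at points where $f'$ is not differentiable at $\theta$. -/

import Mathlib

open MeasureTheory Set Filter Topology
open scoped Manifold ContDiff

noncomputable section

namespace LagrangianMCF

/-- Complex Euclidean space `ℂⁿ`. As a real inner product space it is `ℝ²ⁿ`, with
`inner ℝ u v = Re ∑ i, conj (u i) * v i`; the complex structure is `v ↦ Complex.I • v`. -/
abbrev Cn (n : ℕ) : Type := EuclideanSpace ℂ (Fin n)

/-- The standard Kähler form `ω(u, v) = ⟨J u, v⟩` of `ℂⁿ`. -/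
def kahlerForm {n : ℕ} (u v : Cn n) : ℝ := inner ℝ (Complex.I • u) v

/-- The standard holomorphic volume form `Ω = dz₁ ∧ ⋯ ∧ dzₙ` of `ℂⁿ`. -/
def holVolumeForm {n : ℕ} (v : Fin n → Cn n) : ℂ :=
  Matrix.det (Matrix.of fun i j => v j i)

section Submanifold

variable {n : ℕ} {S : Type*} [TopologicalSpace S] [ChartedSpace (EuclideanSpace ℝ (Fin n)) S]

/-- The differential of `F : S → ℂⁿ` at `x`. -/
def differential (F : S → Cn n) (x : S) : TangentSpace (𝓡 n) x →L[ℝ] Cn n :=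
  mfderiv (𝓡 n) 𝓘(ℝ, Cn n) F x

/-- The tangent plane of the immersed submanifold `F` at `x`, as a real subspace of `ℂⁿ`. -/
def tangentPlane (F : S → Cn n) (x : S) : Submodule ℝ (Cn n) :=
  LinearMap.range (differential F x).toLinearMap

/-- The normal component `V^⊥` at `x` of a vector `V` of `ℂⁿ`. -/
def normalPart (F : S → Cn n) (x : S) (V : Cn n) : Cn n :=
  (tangentPlane F x)ᗮ.starProjection V

/-- The `i`-th coordinate tangent vector `∂F/∂uᵢ` in the chart `e`, at the point of `S` with
coordinates `u`. -/
def coordTangent (F : S → Cn n) (e : OpenPartialHomeomorph S (EuclideanSpace ℝ (Fin n)))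
    (u : EuclideanSpace ℝ (Fin n)) (i : Fin n) : Cn n :=
  fderiv ℝ (F ∘ e.symm) u (EuclideanSpace.single i 1)

/-- The induced metric `g_ij = ⟨∂F/∂uᵢ, ∂F/∂uⱼ⟩` in the chart `e`. -/
def inducedMetric (F : S → Cn n) (e : OpenPartialHomeomorph S (EuclideanSpace ℝ (Fin n)))
    (u : EuclideanSpace ℝ (Fin n)) : Matrix (Fin n) (Fin n) ℝ :=
  Matrix.gram ℝ (coordTangent F e u)

/-- The second coordinate derivative `∂²F/∂uᵢ∂uⱼ` in the chart `e`. -/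
def coordHessian (F : S → Cn n) (e : OpenPartialHomeomorph S (EuclideanSpace ℝ (Fin n)))
    (u : EuclideanSpace ℝ (Fin n)) (i j : Fin n) : Cn n :=
  fderiv ℝ (fun v => coordTangent F e v j) u (EuclideanSpace.single i 1)

/-- The mean curvature vector of the immersed submanifold `F` at `x`: the trace
`g^{ij} (∂²F/∂uᵢ∂uⱼ)^⊥` of the second fundamental form, computed in the preferred chart at `x`
(it does not depend on the chart). -/
def meanCurvature (F : S → Cn n) (x : S) : Cn n :=
  ∑ i, ∑ j, (inducedMetric F (chartAt _ x) (chartAt _ x x))⁻¹ i j •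
    normalPart F x (coordHessian F (chartAt _ x) (chartAt _ x x) i j)

/-- The induced area measure `dμ` on `S`. Each chart `e` carries the measure `√(det g) du`;
its image is a measure on `S` that lives on the domain of `e`. By the change of variables formula
these local measures agree on overlaps, and `dμ` is the measure they glue to: their supremum in
the lattice of measures on `S`. -/
def areaMeasure [MeasurableSpace S] (F : S → Cn n) : Measure S :=
  ⨆ e ∈ atlas (EuclideanSpace ℝ (Fin n)) S,
    ((volume.restrict e.target).withDensity
      fun u => ENNReal.ofReal (Real.sqrt (inducedMetric F e u).det)).map e.symm

/-- `θ` is a (single-valued) Lagrangian angle of `F`, where `S` is oriented by `o`: the `n`-forms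
`Ω|_S` and `e^{iθ} dμ` agree, the area form `dμ` having the value `√(det ⟨dF bᵢ, dF bⱼ⟩)` on a
positively oriented basis `b`. For an immersion `F` and a continuous `θ` this
equation forces the orientation `o x` to vary continuously with `x`. -/
def IsLagrangianAngle (o : ∀ x : S, Orientation ℝ (TangentSpace (𝓡 n) x) (Fin n))
    (F : S → Cn n) (θ : S → ℝ) : Prop :=
  ∀ (x : S) (b : Module.Basis (Fin n) ℝ (TangentSpace (𝓡 n) x)), b.orientation = o x →
    holVolumeForm (fun i => differential F x (b i)) =
      Complex.exp (Complex.I * (θ x : ℂ)) *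
        (Real.sqrt (Matrix.gram ℝ (fun i => differential F x (b i))).det : ℂ)

/-- `F : [0, T) × S → ℂⁿ` is a smooth Lagrangian mean curvature flow with zero Maslov class, and
`θ : [0, T) × S → ℝ` is its Lagrangian angle. (Values at times outside `[0, T)` play no role.) -/
structure IsZeroMaslovLMCF (o : ∀ x : S, Orientation ℝ (TangentSpace (𝓡 n) x) (Fin n))
    (T : ℝ) (F : ℝ → S → Cn n) (θ : ℝ → S → ℝ) : Prop where
  smooth : ContMDiffOn (𝓘(ℝ, ℝ).prod (𝓡 n)) 𝓘(ℝ, Cn n) ∞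
    (fun p : ℝ × S => F p.1 p.2) (Ico 0 T ×ˢ univ)
  immersion : ∀ t ∈ Ico 0 T, ∀ x, Function.Injective (differential (F t) x)
  lagrangian : ∀ t ∈ Ico 0 T, ∀ x, ∀ v w : TangentSpace (𝓡 n) x,
    kahlerForm (differential (F t) x v) (differential (F t) x w) = 0
  angle : ∀ t ∈ Ico 0 T, IsLagrangianAngle o (F t) (θ t)
  angle_continuous : ContinuousOn (fun p : ℝ × S => θ p.1 p.2) (Ico 0 T ×ˢ univ)
  mean_curvature_flow : ∀ t ∈ Ico 0 T, ∀ x,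
    HasDerivWithinAt (fun s => F s x) (meanCurvature (F t) x) (Ico 0 T) t

/-- The usual control at infinity for a flow of noncompact submanifolds: the initial
immersion is proper with finite Gaussian area at every scale (for instance, with polynomial area
growth), and on every compact time interval in `[0, T)` the Lagrangian angle and the mean curvature
are bounded. For compact `S` all of this holds automatically. -/
structure IsControlledAtInfinity [MeasurableSpace S] (T : ℝ) (F : ℝ → S → Cn n)
    (θ : ℝ → S → ℝ) : Prop where
  proper : Tendsto (F 0) (cocompact S) (cocompact (Cn n))
  gaussian_area : ∀ c : ℝ, 0 < c →
    Integrable (fun x => Real.exp (-c * ‖F 0 x‖ ^ 2)) (areaMeasure (F 0))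
  bounded : ∀ b ∈ Ico 0 T, ∃ C : ℝ, ∀ t ∈ Icc 0 b, ∀ x,
    |θ t x| ≤ C ∧ ‖meanCurvature (F t) x‖ ≤ C

end Submanifold

/-- `ρ(X, X₀, t, t₀) = (4π(t₀ - t))^{-n/2} exp(-|X - X₀|² / (4(t₀ - t)))`, for `t < t₀`. -/
def rho {n : ℕ} (X X₀ : Cn n) (t t₀ : ℝ) : ℝ :=
  1 / (4 * Real.pi * (t₀ - t)) ^ ((n : ℝ) / 2) * Real.exp (-(‖X - X₀‖ ^ 2 / (4 * (t₀ - t))))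

/-- The second derivative of `f : ℝ → ℝ` is piecewise continuous: off a set `D` of break points,
finitely many in each bounded interval, `f''` exists and is continuous, and it has finite one-sided
limits at every break point. -/
def PiecewiseContinuousSecondDeriv (f : ℝ → ℝ) : Prop :=
  ∃ D : Set ℝ, (∀ a b : ℝ, (D ∩ Icc a b).Finite) ∧
    (∀ s ∉ D, DifferentiableAt ℝ (deriv f) s ∧ ContinuousAt (deriv (deriv f)) s) ∧
    ∀ s ∈ D, (∃ l : ℝ, Tendsto (deriv (deriv f)) (𝓝[<] s) (𝓝 l)) ∧
      ∃ r : ℝ, Tendsto (deriv (deriv f)) (𝓝[>] s) (𝓝 r)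

end LagrangianMCF

end

open LagrangianMCF

/-!
# A weighted monotonicity formula for Lagrangian mean curvature flow

The formula combines two evolution equations, `∂ₜ dμ = -|H|² dμ` and `∂ₜθ = Δθ`, with the completion
of the square in Huisken's monotonicity formula.

*Pointwise formula.* In a chart put `D = Ω(∂₁F, …, ∂ₙF)`. The Lagrangian condition gives
`|D| = √(det g)` and `D² = e^{2iθ} |D|²`, so that `log D` has the logarithm of the area density as
its real part and, up to a multiple of `π`, the Lagrangian angle as its imaginary part. The symmetry
`∂ⱼ∂ₖF = ∂ₖ∂ⱼF` yields a divergence identity for the complex coordinates of a vector field in the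
frame `∂ₖF` (`sum_frameCoord_fderiv`). Applied to the velocity `H` and to the position vector, it
gives both evolution equations (`IsLocalFlowAt.evolution`) and the divergence of the tangential
position vector. Hence the time derivative of `f(θ) ρ √(det g)` is a divergence plus the integrand
of the formula (`IsLocalFlowAt.deriv_density_eq_divergence_add`), at points where `f' ∘ θ` satisfies
the chain rule.

*The break points of `f'`.* The function `f'` is locally Lipschitz, so that the divergence may be
integrated by parts, and only an almost everywhere chain rule for `f' ∘ θ` is needed. The points
where `θ` meets a break point and `dθ ≠ 0` form a null set (`measure_regular_levelSet`); where
`dθ = 0` one has `H = 0`, because `dθ(v) = ⟨i dF(v), H⟩` (`fderiv_angle_eq_inner_meanCurvature`), so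
that the value given to `f''` does not matter. This leads to the formula in a chart
(`hasDerivAt_integral_local`).

*Globalization.* A partition of unity, together with a cutoff function of `ℂⁿ` evaluated along the
flow, gives the localized formula at positive times (`IsZeroMaslovLMCF.hasDerivAt_integral_cutoff`).
By the first evolution equation `μ_t = exp (-∫₀ᵗ |H|²) μ₀` (`IsZeroMaslovLMCF.areaMeasure_eq`), and
as `F` moves points by a bounded distance, all integrands on a time interval `[0, b]` are dominated
by one Gaussian `M exp (-c |F₀|²)`, which is integrable against `μ₀`
(`IsZeroMaslovLMCF.exists_domination`). Dominated convergence removes the cutoff from the formula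
integrated in time (`IsZeroMaslovLMCF.integral_monotonicity`). The right hand side is continuous in
time up to `t = 0`, since its integrand is so almost everywhere; hence the integrated formula can be
differentiated, from the right at `t = 0`. A flow of a compact manifold satisfies the conditions at
infinity (`IsZeroMaslovLMCF.isControlledAtInfinity_of_compactSpace`).
-/

noncomputable section

namespace LagrangianMCF

/-! ### Functions with piecewise continuous second derivative, and integration by parts -/

section PiecewiseC2

variable {f : ℝ → ℝ}

lemma countable_of_finite_inter_Icc {D : Set ℝ} (hD : ∀ a b : ℝ, (D ∩ Icc a b).Finite) :
    D.Countable := by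
  have : D ⊆ ⋃ n : ℕ, D ∩ Icc (-(n : ℝ)) n := by
    intro x hx
    obtain ⟨n, hn⟩ := exists_nat_ge |x|
    exact mem_iUnion.2 ⟨n, hx, abs_le.1 hn⟩
  exact (countable_iUnion fun n => (hD _ _).countable).mono this

lemma eventually_abs_secondDeriv_le (hf : PiecewiseContinuousSecondDeriv f) (s : ℝ) :
    ∃ C, ∀ᶠ y in 𝓝 s, |deriv (deriv f) y| ≤ C := by
  obtain ⟨D, -, hreg, hlim⟩ := hf
  have key : ∀ (l : Filter ℝ) (c : ℝ), Tendsto (deriv (deriv f)) l (𝓝 c) →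
      ∀ᶠ y in l, |deriv (deriv f) y| ≤ |c| + 1 := fun l c h =>
    (h.abs.eventually (gt_mem_nhds (lt_add_one |c|))).mono fun _ => le_of_lt
  by_cases hs : s ∈ D
  · obtain ⟨⟨l, hl⟩, r, hr⟩ := hlim s hs
    refine ⟨max (max (|l| + 1) (|r| + 1)) |deriv (deriv f) s|, ?_⟩
    have h1 : ∀ᶠ y in 𝓝[≠] s, |deriv (deriv f) y| ≤
        max (max (|l| + 1) (|r| + 1)) |deriv (deriv f) s| := by
      rw [← nhdsLT_sup_nhdsGT, eventually_sup]
      exact ⟨(key _ _ hl).mono fun y hy => hy.trans (by simp),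
        (key _ _ hr).mono fun y hy => hy.trans (by simp)⟩
    rw [eventually_nhdsWithin_iff] at h1
    filter_upwards [h1] with y hy
    by_cases hys : y = s
    · subst hys; exact le_max_right _ _
    · exact hy hys
  · exact ⟨_, key _ _ (hreg s hs).2⟩

lemma exists_abs_secondDeriv_le (hf : PiecewiseContinuousSecondDeriv f) (M : ℝ) :
    ∃ C, 0 ≤ C ∧ ∀ y ∈ Icc (-M) M, |deriv (deriv f) y| ≤ C := by
  have : ∃ C, ∀ y ∈ Icc (-M) M, |deriv (deriv f) y| ≤ C := by
    refine isCompact_Icc.induction_on (p := fun S => ∃ C, ∀ y ∈ S, |deriv (deriv f) y| ≤ C)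
      ⟨0, by simp⟩ ?_ ?_ ?_
    · rintro s t hst ⟨C, hC⟩
      exact ⟨C, fun y hy => hC y (hst hy)⟩
    · rintro s t ⟨C, hC⟩ ⟨C', hC'⟩
      refine ⟨max C C', ?_⟩
      rintro y (hy | hy)
      · exact (hC y hy).trans (le_max_left _ _)
      · exact (hC' y hy).trans (le_max_right _ _)
    · intro x _
      obtain ⟨C, hC⟩ := eventually_abs_secondDeriv_le hf x
      exact ⟨_, mem_nhdsWithin_of_mem_nhds hC, C, fun y hy => hy⟩
  obtain ⟨C, hC⟩ := this
  exact ⟨max C 0, le_max_right _ _, fun y hy => (hC y hy).trans (le_max_left _ _)⟩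

/-- A piecewise continuous `f''` is locally bounded, so the continuous function `f'` is Lipschitz
on bounded intervals. -/
lemma exists_lipschitzOnWith_deriv (hf : ContDiff ℝ 1 f) (hf'' : PiecewiseContinuousSecondDeriv f)
    (M : ℝ) : ∃ C, LipschitzOnWith C (deriv f) (Icc (-M) M) := by
  obtain ⟨C, hC0, hC⟩ := exists_abs_secondDeriv_le hf'' M
  obtain ⟨D, hfin, hreg, -⟩ := hf''
  refine ⟨C.toNNReal, LipschitzOnWith.of_dist_le_mul ?_⟩
  have key : ∀ x ∈ Icc (-M) M, ∀ y ∈ Icc (-M) M, x ≤ y →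
      |deriv f y - deriv f x| ≤ C * |y - x| := by
    intro x hx y hy hxy
    have hsub : Icc x y ⊆ Icc (-M) M := Icc_subset_Icc hx.1 hy.2
    have hint : IntervalIntegrable (deriv (deriv f)) volume x y := by
      rw [intervalIntegrable_iff_integrableOn_Icc_of_le hxy]
      refine Measure.integrableOn_of_bounded (M := C) measure_Icc_lt_top.ne
        (measurable_deriv _).aestronglyMeasurable ?_
      exact (ae_restrict_mem measurableSet_Icc).mono fun z hz => hC z (hsub hz)
    have := MeasureTheory.integral_eq_of_hasDerivAt_off_countable (deriv f) (deriv (deriv f))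
      (countable_of_finite_inter_Icc hfin) (hf.continuous_deriv le_rfl).continuousOn
      (fun z hz => (hreg z hz.2).1.hasDerivAt) hint
    rw [← this]
    refine intervalIntegral.norm_integral_le_of_norm_le_const fun z hz =>
      (Real.norm_eq_abs _).trans_le (hC z ?_)
    rw [uIoc_of_le hxy] at hz
    exact hsub ⟨hz.1.le, hz.2⟩
  intro x hx y hy
  rw [Real.dist_eq, Real.dist_eq, Real.coe_toNNReal C hC0]
  rcases le_total x y with h | h
  · rw [abs_sub_comm, abs_sub_comm x]; exact key x hx y hy h
  · exact key y hy x hx h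

lemma exists_lipschitzOnWith_deriv_nhds (hf : ContDiff ℝ 1 f)
    (hf'' : PiecewiseContinuousSecondDeriv f) (s : ℝ) :
    ∃ C, ∃ t ∈ 𝓝 s, LipschitzOnWith C (deriv f) t := by
  obtain ⟨C, hC⟩ := exists_lipschitzOnWith_deriv hf hf'' (|s| + 1)
  refine ⟨C, _, Icc_mem_nhds ?_ ?_, hC⟩
  · linarith [neg_abs_le s]
  · linarith [le_abs_self s]

end PiecewiseC2

section ChainRule

variable {E : Type*} [NormedAddCommGroup E] [NormedSpace ℝ E]

/-- Chain rule for `f' ∘ θ` at a point where either `f'` is differentiable at `θ u`, or `dθ = 0`: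
in the second case the local Lipschitz bound on `f'` makes the derivative of `f' ∘ θ` vanish. -/
lemma hasFDerivAt_deriv_comp {f : ℝ → ℝ} (hf : ContDiff ℝ 1 f)
    (hf'' : PiecewiseContinuousSecondDeriv f) {θ : E → ℝ} {θ' : E →L[ℝ] ℝ} {u : E}
    (hθ : HasFDerivAt θ θ' u) (h : DifferentiableAt ℝ (deriv f) (θ u) ∨ θ' = 0) :
    HasFDerivAt (fun v => deriv f (θ v)) (deriv (deriv f) (θ u) • θ') u := by
  rcases h with h | h
  · exact h.hasDerivAt.comp_hasFDerivAt u hθ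
  · subst h
    rw [smul_zero]
    obtain ⟨C, t, ht, hC⟩ := exists_lipschitzOnWith_deriv_nhds hf hf'' (θ u)
    refine .of_isLittleO ?_
    have h0 := hθ.isLittleO
    simp only [zero_apply, sub_zero] at h0 ⊢
    refine Asymptotics.IsBigO.trans_isLittleO (Asymptotics.IsBigO.of_bound C ?_) h0
    filter_upwards [hθ.continuousAt ht] with v hv
    simpa [dist_eq_norm] using hC.dist_le_mul _ hv _ (mem_of_mem_nhds ht)

variable [FiniteDimensional ℝ E]

lemma _root_.LocallyLipschitz.exists_lipschitzWith_of_hasCompactSupport {h : E → ℝ}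
    (hl : LocallyLipschitz h) (hc : HasCompactSupport h) : ∃ C, LipschitzWith C h := by
  obtain ⟨R, hR⟩ := hc.isCompact.isBounded.subset_closedBall 0
  obtain ⟨C, hC⟩ := (hl.locallyLipschitzOn (s := Metric.closedBall 0
    (R + 1))).exists_lipschitzOnWith_of_compact (isCompact_closedBall _ _)
  obtain ⟨M, hM⟩ := hl.continuous.bounded_above_of_compact_support hc
  have hM0 : 0 ≤ M := (norm_nonneg _).trans (hM 0)
  have hzero : ∀ x, x ∉ Metric.closedBall (0 : E) R → h x = 0 := fun x hx =>
    image_eq_zero_of_notMem_tsupport fun h' => hx (hR h')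
  have aux : ∀ x y, y ∉ Metric.closedBall (0 : E) (R + 1) →
      dist (h x) (h y) ≤ max (C : ℝ) M * dist x y := by
    intro x y hy
    have hy' : h y = 0 := hzero y fun h' => hy (Metric.closedBall_subset_closedBall (by linarith) h')
    by_cases hx : x ∈ Metric.closedBall (0 : E) R
    · have hd : 1 ≤ dist x y := by
        have := dist_triangle y x 0
        rw [Metric.mem_closedBall] at hx hy
        rw [dist_comm y x] at this
        linarith
      rw [hy', dist_zero_right]
      calc ‖h x‖ ≤ M * 1 := by simpa using hM x
        _ ≤ max (C : ℝ) M * dist x y := by gcongr; exact le_max_right _ _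
    · rw [hzero x hx, hy', dist_self]; positivity
  refine ⟨max C M.toNNReal, LipschitzWith.of_dist_le_mul fun x y => ?_⟩
  have hco : ((max C M.toNNReal : NNReal) : ℝ) = max (C : ℝ) M := by
    rw [NNReal.coe_max, Real.coe_toNNReal _ hM0]
  rw [hco]
  by_cases hy : y ∈ Metric.closedBall (0 : E) (R + 1)
  · by_cases hx : x ∈ Metric.closedBall (0 : E) (R + 1)
    · exact (hC.dist_le_mul x hx y hy).trans (by gcongr; exact le_max_left _ _)
    · rw [dist_comm, dist_comm x]; exact aux y x hx
  · exact aux x y hy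

variable [MeasurableSpace E] [BorelSpace E]

/-- The regular part of a level set of a `C¹` function is a null set. Indeed `|θ - s|` is not
differentiable there, so that Rademacher's theorem applies. -/
lemma measure_regular_levelSet (μ : Measure E) [μ.IsAddHaarMeasure] {U : Set E} (hU : IsOpen U)
    {θ : E → ℝ} (hθ : ContDiffOn ℝ 1 θ U) (s : ℝ) :
    μ {u | u ∈ U ∧ θ u = s ∧ fderiv ℝ θ u ≠ 0} = 0 := by
  refine measure_null_of_locally_null _ fun x hx => ?_
  have hcx : ContDiffAt ℝ 1 θ x := hθ.contDiffAt (hU.mem_nhds hx.1)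
  obtain ⟨K, t, ht, hK⟩ := hcx.exists_lipschitzOnWith
  have hK' : LipschitzOnWith K (fun u => |θ u - s|) (interior t ∩ U) := by
    refine LipschitzOnWith.of_dist_le_mul fun y hy z hz => ?_
    have := hK.dist_le_mul y (interior_subset hy.1) z (interior_subset hz.1)
    refine le_trans ?_ this
    rw [Real.dist_eq, Real.dist_eq]
    refine (abs_abs_sub_abs_le_abs_sub _ _).trans (by simp)
  refine ⟨_, inter_mem_nhdsWithin _ (inter_mem (interior_mem_nhds.2 ht) (hU.mem_nhds hx.1)), ?_⟩
  have hae := hK'.ae_differentiableWithinAt_of_mem (μ := μ)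
  refine measure_mono_null ?_ (ae_iff.1 hae)
  rintro y ⟨⟨hyU, hys, hyd⟩, hyt⟩ hd
  have hd := (hd hyt).differentiableAt ((isOpen_interior.inter hU).mem_nhds hyt)
  have hmin : IsLocalMin (fun u => |θ u - s|) y :=
    Eventually.of_forall fun z => by simp [hys]
  have h1 := hd.hasFDerivAt
  rw [hmin.fderiv_eq_zero] at h1
  have h2 := h1.isLittleO
  have h3 : HasFDerivAt θ (0 : E →L[ℝ] ℝ) y := by
    refine .of_isLittleO ?_
    simp only [zero_apply, sub_zero, hys, sub_self, abs_zero] at h2 ⊢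
    exact (Asymptotics.isLittleO_abs_left).1 h2
  exact hyd h3.fderiv

/-- The break points of `f'` matter only where `dθ = 0`, up to a null set: there are countably many
of them, and the regular part of each level set of `θ` is a null set. -/
lemma ae_differentiableAt_deriv_or_fderiv_eq_zero (μ : Measure E) [μ.IsAddHaarMeasure] {U : Set E}
    (hU : IsOpen U) {θ : E → ℝ} (hθ : ContDiffOn ℝ 1 θ U) {f : ℝ → ℝ}
    (hf'' : PiecewiseContinuousSecondDeriv f) :
    ∀ᵐ u ∂μ, u ∈ U → (DifferentiableAt ℝ (deriv f) (θ u) ∧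
      ContinuousAt (deriv (deriv f)) (θ u)) ∨ fderiv ℝ θ u = 0 := by
  obtain ⟨D, hfin, hreg, -⟩ := hf''
  have hnull : ∀ᵐ u ∂μ, ∀ s ∈ D, ¬ (u ∈ U ∧ θ u = s ∧ fderiv ℝ θ u ≠ 0) := by
    rw [ae_ball_iff (countable_of_finite_inter_Icc hfin)]
    intro s _
    rw [ae_iff]
    simpa only [not_not] using measure_regular_levelSet μ hU hθ s
  filter_upwards [hnull] with u hu huU
  by_cases hs : θ u ∈ D
  · right
    by_contra h
    exact hu _ hs ⟨huU, rfl, h⟩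
  · exact Or.inl (hreg _ hs)

/-- The integral of a directional derivative of a compactly supported Lipschitz function
vanishes. -/
lemma integral_lineDeriv_eq_zero (μ : Measure E) [μ.IsAddHaarMeasure] {h : E → ℝ}
    (hl : LocallyLipschitz h) (hc : HasCompactSupport h) (v : E) :
    Integrable (fun u => lineDeriv ℝ h u v) μ ∧ ∫ u, lineDeriv ℝ h u v ∂μ = 0 := by
  obtain ⟨C, hC⟩ := hl.exists_lipschitzWith_of_hasCompactSupport hc
  constructor
  · have hli := hC.locallyIntegrable_lineDeriv (μ := μ) v
    rw [← integrableOn_iff_integrable_of_support_subset (s := tsupport h)]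
    · exact hli.integrableOn_isCompact hc.isCompact
    · intro u hu
      by_contra hn
      apply hu
      have : h =ᶠ[𝓝 u] fun _ => 0 := notMem_tsupport_iff_eventuallyEq.1 hn
      change lineDeriv ℝ h u v = 0
      rw [this.lineDeriv_eq]
      simp [lineDeriv]
  · have := (LipschitzWith.const (1 : ℝ)).integral_lineDeriv_mul_eq (μ := μ) hC hc (-v)
      (f := fun _ : E => (1 : ℝ))
    simpa [lineDeriv] using this.symm

end ChainRule

/-! ### Lagrangian frames in complex Euclidean space -/

section Frames

variable {n : ℕ}

/-- The holomorphic volume form as a continuous complex multilinear map. -/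
def holVol (n : ℕ) : ContinuousMultilinearMap ℂ (fun _ : Fin n => Cn n) ℂ where
  toMultilinearMap := (EuclideanSpace.basisFun (Fin n) ℂ).toBasis.det.toMultilinearMap
  cont := by
    have : (fun v : Fin n → Cn n => (EuclideanSpace.basisFun (Fin n) ℂ).toBasis.det v) =
        fun v => Matrix.det (Matrix.of fun i j => v j i) := by
      funext v
      rw [Module.Basis.det_apply]
      congr 1
    change Continuous fun v : Fin n → Cn n => (EuclideanSpace.basisFun (Fin n) ℂ).toBasis.det v
    rw [this]
    refine Continuous.matrix_det ?_
    refine continuous_matrix fun i j => ?_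
    simp only [Matrix.of_apply]
    fun_prop

lemma holVol_apply (v : Fin n → Cn n) : holVol n v = holVolumeForm v := by
  change (EuclideanSpace.basisFun (Fin n) ℂ).toBasis.det v = _
  rw [Module.Basis.det_apply]
  rfl

lemma det_eq_holVolumeForm (v : Fin n → Cn n) :
    (EuclideanSpace.basisFun (Fin n) ℂ).toBasis.det v = holVolumeForm v := holVol_apply v

/-- The complex coordinates of `V` in a frame `v` of `ℂⁿ`, given by Cramer's rule. -/
def frameCoord (v : Fin n → Cn n) (V : Cn n) (k : Fin n) : ℂ :=
  holVolumeForm (Function.update v k V) / holVolumeForm v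

lemma holVolumeForm_update_sum (v : Fin n → Cn n) (c : Fin n → ℂ) (k : Fin n) :
    holVolumeForm (Function.update v k (∑ m, c m • v m)) = c k * holVolumeForm v := by
  rw [← det_eq_holVolumeForm, AlternatingMap.map_update_sum, Finset.sum_eq_single k]
  · rw [AlternatingMap.map_update_smul, Function.update_eq_self, det_eq_holVolumeForm, smul_eq_mul]
  · intro m _ hm
    rw [AlternatingMap.map_update_smul, AlternatingMap.map_update_self _ _ hm.symm, smul_zero]
  · simp

lemma frameCoord_sum {v : Fin n → Cn n} (hv : holVolumeForm v ≠ 0) (c : Fin n → ℂ) (k : Fin n) :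
    frameCoord v (∑ m, c m • v m) k = c k := by
  rw [frameCoord, holVolumeForm_update_sum, mul_div_cancel_right₀ _ hv]

lemma sum_frameCoord {v : Fin n → Cn n} (hv : holVolumeForm v ≠ 0) (V : Cn n) :
    ∑ m, frameCoord v V m • v m = V := by
  have h := ((EuclideanSpace.basisFun (Fin n) ℂ).toBasis.is_basis_iff_det (v := v)).2
    (by rw [det_eq_holVolumeForm]; exact hv.isUnit)
  have hV : V ∈ Submodule.span ℂ (range v) := h.2 ▸ Submodule.mem_top
  obtain ⟨c, rfl⟩ := (Submodule.mem_span_range_iff_exists_fun ℂ).1 hV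
  simp only [frameCoord_sum hv]

lemma real_inner_eq_re (u v : Cn n) : inner ℝ u v = (inner ℂ u v).re := by
  simp only [PiLp.inner_apply, Complex.inner, Complex.re_sum]
  simp

lemma real_inner_I_smul_left (u v : Cn n) : inner ℝ (Complex.I • u) v = (inner ℂ u v).im := by
  rw [real_inner_eq_re, inner_smul_left]
  simp

/-- A tuple of vectors spanning an isotropic subspace of `(ℂⁿ, ω)`. -/
def IsIsotropic (v : Fin n → Cn n) : Prop := ∀ i j, kahlerForm (v i) (v j) = 0

lemma IsIsotropic.inner_eq {v : Fin n → Cn n} (hv : IsIsotropic v) (i j : Fin n) :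
    inner ℂ (v i) (v j) = ((inner ℝ (v i) (v j) : ℝ) : ℂ) := by
  have h := hv i j
  rw [kahlerForm, real_inner_I_smul_left] at h
  rw [real_inner_eq_re]
  exact Complex.ext (by simp) (by simpa using h)

/-- On an isotropic frame the Hermitian Gram matrix is real, so that
`det g = |det_ℂ (v₁, …, vₙ)|²`. -/
lemma IsIsotropic.det_gram {v : Fin n → Cn n} (hv : IsIsotropic v) :
    (Matrix.gram ℝ v).det = ‖holVolumeForm v‖ ^ 2 := by
  set A : Matrix (Fin n) (Fin n) ℂ := Matrix.of fun i j => v j i with hA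
  have h1 : (Matrix.gram ℝ v).map Complex.ofRealHom = A.conjTranspose * A := by
    ext i j
    rw [Matrix.map_apply, Matrix.gram_apply, Matrix.mul_apply, Complex.ofRealHom_eq_coe,
      ← hv.inner_eq, PiLp.inner_apply]
    refine Finset.sum_congr rfl fun k _ => ?_
    simp [hA, Matrix.conjTranspose_apply, mul_comm]
  have h2 := congrArg Matrix.det h1
  rw [Matrix.det_mul, Matrix.det_conjTranspose, ← RingHom.mapMatrix_apply, ← RingHom.map_det] at h2
  have h3 : (((Matrix.gram ℝ v).det : ℝ) : ℂ) = star A.det * A.det := h2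
  have h4 : star A.det * A.det = ((‖A.det‖ ^ 2 : ℝ) : ℂ) := by
    rw [mul_comm]
    simpa using Complex.mul_conj' A.det
  rw [h4] at h3
  exact_mod_cast h3

lemma IsIsotropic.sqrt_det_gram {v : Fin n → Cn n} (hv : IsIsotropic v) :
    Real.sqrt (Matrix.gram ℝ v).det = ‖holVolumeForm v‖ := by
  rw [hv.det_gram, Real.sqrt_sq (norm_nonneg _)]

lemma IsIsotropic.inner_sum_smul {v : Fin n → Cn n} (hv : IsIsotropic v) (c : Fin n → ℂ)
    (j : Fin n) :
    inner ℝ (v j) (∑ m, c m • v m) = ∑ m, (c m).re * inner ℝ (v j) (v m) := by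
  rw [inner_sum]
  refine Finset.sum_congr rfl fun m _ => ?_
  rw [real_inner_eq_re (v j) (c m • v m), inner_smul_right, hv.inner_eq]
  simp

lemma IsIsotropic.inner_I_sum_smul {v : Fin n → Cn n} (hv : IsIsotropic v) (c : Fin n → ℂ)
    (j : Fin n) :
    inner ℝ (Complex.I • v j) (∑ m, c m • v m) = ∑ m, (c m).im * inner ℝ (v j) (v m) := by
  rw [inner_sum]
  refine Finset.sum_congr rfl fun m _ => ?_
  rw [real_inner_I_smul_left, inner_smul_right, hv.inner_eq]
  simp

/-- Coefficients in a Lagrangian frame are determined by the inner products with the frame. -/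
lemma IsIsotropic.eq_of_sum_mul_inner_eq {v : Fin n → Cn n} (hv : IsIsotropic v)
    (hD : holVolumeForm v ≠ 0) {x y : Fin n → ℝ}
    (h : ∀ j, ∑ m, x m * inner ℝ (v j) (v m) = ∑ m, y m * inner ℝ (v j) (v m)) : x = y := by
  have hdet : IsUnit (Matrix.gram ℝ v).det := by
    rw [hv.det_gram]; exact (pow_ne_zero 2 (norm_ne_zero_iff.2 hD)).isUnit
  have hinj := Matrix.mulVec_injective_iff_isUnit.2 ((Matrix.isUnit_iff_isUnit_det _).2 hdet)
  apply hinj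
  funext j
  simpa [Matrix.mulVec, dotProduct, Matrix.gram_apply, mul_comm] using h j

lemma IsIsotropic.im_frameCoord {v : Fin n → Cn n} (hv : IsIsotropic v)
    (hD : holVolumeForm v ≠ 0) (V : Cn n) (k : Fin n) :
    (frameCoord v V k).im = ∑ j, (Matrix.gram ℝ v)⁻¹ k j * inner ℝ (Complex.I • v j) V := by
  have hdet : IsUnit (Matrix.gram ℝ v).det := by
    rw [hv.det_gram]; exact (pow_ne_zero 2 (norm_ne_zero_iff.2 hD)).isUnit
  have h1 : (fun j => inner ℝ (Complex.I • v j) V) =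
      (Matrix.gram ℝ v).mulVec fun m => (frameCoord v V m).im := by
    funext j
    conv_lhs => rw [← sum_frameCoord hD V, hv.inner_I_sum_smul]
    simp [Matrix.mulVec, dotProduct, Matrix.gram_apply, mul_comm]
  have h2 : (fun m => (frameCoord v V m).im) =
      (Matrix.gram ℝ v)⁻¹.mulVec fun j => inner ℝ (Complex.I • v j) V := by
    rw [h1, Matrix.mulVec_mulVec, Matrix.nonsing_inv_mul _ hdet, Matrix.one_mulVec]
  exact congrFun h2 k

/-- In a Lagrangian frame, the normal component of a vector is its imaginary part. -/
lemma IsIsotropic.starProjection_orthogonal {v : Fin n → Cn n} (hv : IsIsotropic v)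
    (hD : holVolumeForm v ≠ 0) (V : Cn n) :
    (Submodule.span ℝ (range v))ᗮ.starProjection V =
      ∑ m, (Complex.I * ((frameCoord v V m).im : ℂ)) • v m := by
  refine Submodule.eq_starProjection_of_mem_orthogonal ?_ ?_
  · rw [Submodule.mem_orthogonal]
    intro u hu
    induction hu using Submodule.span_induction with
    | mem x hx =>
      obtain ⟨j, rfl⟩ := hx
      rw [hv.inner_sum_smul]
      simp
    | zero => simp
    | add x y _ _ hx hy => rw [inner_add_left, hx, hy, add_zero]
    | smul a x _ hx => rw [inner_smul_left, hx, mul_zero]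
  · rw [Submodule.orthogonal_orthogonal]
    have : V - ∑ m, (Complex.I * ((frameCoord v V m).im : ℂ)) • v m =
        ∑ m, (frameCoord v V m).re • v m := by
      conv_lhs => rw [← sum_frameCoord hD V, sum_frameCoord hD V]
      rw [sub_eq_iff_eq_add, ← Finset.sum_add_distrib]
      conv_lhs => rw [← sum_frameCoord hD V]
      refine Finset.sum_congr rfl fun m _ => ?_
      rw [← Complex.coe_smul, ← add_smul]
      congr 1
      rw [mul_comm Complex.I]
      exact (Complex.re_add_im _).symm
    rw [this]
    exact Submodule.sum_mem _ fun m _ => Submodule.smul_mem _ _ (Submodule.subset_span ⟨m, rfl⟩)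

/-- A vector normal to a Lagrangian plane is `i` times a vector of that plane. -/
lemma IsIsotropic.re_frameCoord_eq_zero {v : Fin n → Cn n} (hv : IsIsotropic v)
    (hD : holVolumeForm v ≠ 0) {H : Cn n} (hH : ∀ j, inner ℝ (v j) H = 0) (k : Fin n) :
    (frameCoord v H k).re = 0 := by
  have : (fun m => (frameCoord v H m).re) = 0 := by
    refine hv.eq_of_sum_mul_inner_eq hD fun j => ?_
    rw [← hv.inner_sum_smul, sum_frameCoord hD, hH]
    simp
  exact congrFun this k

end Frames

/-! ### Derivatives of frames, complex volumes and angles -/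

section FrameCalculus

variable {n : ℕ} {G : Type*} [NormedAddCommGroup G] [NormedSpace ℝ G]

lemma hasFDerivAt_holVolumeForm {X : Fin n → G → Cn n} {X' : Fin n → G →L[ℝ] Cn n} {p : G}
    (hX : ∀ k, HasFDerivAt (X k) (X' k) p) :
    ∃ L : G →L[ℝ] ℂ, HasFDerivAt (fun q => holVolumeForm fun k => X k q) L p ∧
      ∀ v, L v = ∑ k, holVolumeForm (Function.update (fun k => X k p) k (X' k v)) := by
  have h := HasFDerivAt.multilinear_comp ((holVol n).restrictScalars ℝ) hX
  refine ⟨_, h.congr_of_eventuallyEq (Eventually.of_forall fun q => (holVol_apply _).symm),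
    fun v => ?_⟩
  rw [sum_apply]
  refine Finset.sum_congr rfl fun k _ => ?_
  rw [← holVol_apply]
  rfl

lemma contDiffAt_holVolumeForm {m : ℕ∞ω} {X : Fin n → G → Cn n} {p : G}
    (hX : ∀ k, ContDiffAt ℝ m (X k) p) :
    ContDiffAt ℝ m (fun q => holVolumeForm fun k => X k q) p := by
  have h := (((holVol n).restrictScalars ℝ).contDiff (n := m)).contDiffAt.comp p
    (contDiffAt_pi.2 hX)
  refine h.congr_of_eventuallyEq (Eventually.of_forall fun q => (holVol_apply _).symm)

lemma continuous_holVolumeForm : Continuous (holVolumeForm (n := n)) := by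
  have : (holVolumeForm (n := n)) = holVol n := funext fun v => (holVol_apply v).symm
  rw [this]
  exact (holVol n).cont

/-- The frame of derivatives of `F` in the directions `e k`. -/
def derivFrame (F : G → Cn n) (e : Fin n → G) (p : G) : Fin n → Cn n := fun k => fderiv ℝ F p (e k)

/-- The value of the holomorphic volume form on the frame of derivatives of `F`. -/
def derivVol (F : G → Cn n) (e : Fin n → G) (p : G) : ℂ := holVolumeForm (derivFrame F e p)

variable {F : G → Cn n} {e : Fin n → G} {p : G}

lemma hasFDerivAt_derivFrame (hF : ContDiffAt ℝ 2 F p) (v : G) :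
    HasFDerivAt (fun q => fderiv ℝ F q v) ((fderiv ℝ (fderiv ℝ F) p).flip v) p := by
  have h1 : DifferentiableAt ℝ (fderiv ℝ F) p :=
    (hF.fderiv_right (m := 1) (by norm_num)).differentiableAt (by norm_num)
  exact (ContinuousLinearMap.apply ℝ (Cn n) v).hasFDerivAt.comp p h1.hasFDerivAt

lemma fderiv_fderiv_comm (hF : ContDiffAt ℝ 2 F p) (v w : G) :
    fderiv ℝ (fderiv ℝ F) p v w = fderiv ℝ (fderiv ℝ F) p w v :=
  (hF.isSymmSndFDerivAt (by simp)).eq v w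

lemma contDiffAt_fderiv_apply {m m' : ℕ∞ω} (hF : ContDiffAt ℝ m' F p) (h : m + 1 ≤ m') (v : G) :
    ContDiffAt ℝ m (fun q => fderiv ℝ F q v) p :=
  (hF.fderiv_right h).clm_apply contDiffAt_const

lemma contDiffAt_derivVol {m m' : ℕ∞ω} (hF : ContDiffAt ℝ m' F p) (h : m + 1 ≤ m') :
    ContDiffAt ℝ m (derivVol F e) p :=
  contDiffAt_holVolumeForm fun k => contDiffAt_fderiv_apply hF h (e k)

lemma contDiffAt_frameCoord {m m' : ℕ∞ω} (hF : ContDiffAt ℝ m' F p) (h : m + 1 ≤ m')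
    (hD : derivVol F e p ≠ 0) {V : G → Cn n} (hV : ContDiffAt ℝ m V p) (k : Fin n) :
    ContDiffAt ℝ m (fun q => frameCoord (derivFrame F e q) (V q) k) p := by
  have h1 : ContDiffAt ℝ m
      (fun q => holVolumeForm (Function.update (derivFrame F e q) k (V q))) p := by
    refine contDiffAt_holVolumeForm (X := fun j q => Function.update (derivFrame F e q) k (V q) j)
      fun j => ?_
    by_cases hj : j = k
    · subst hj; simpa using hV
    · simpa [hj, derivFrame] using contDiffAt_fderiv_apply hF h (e j)
  simp only [frameCoord, div_eq_mul_inv]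
  exact h1.mul ((contDiffAt_derivVol hF h).inv hD)

/-- Derivative of the complex volume `D = Ω(∂₁F, …, ∂ₙF)`, by multilinearity. -/
lemma hasFDerivAt_derivVol (hF : ContDiffAt ℝ 2 F p) (e : Fin n → G) (v : G) :
    fderiv ℝ (derivVol F e) p v = ∑ k, holVolumeForm
      (Function.update (derivFrame F e p) k (fderiv ℝ (fderiv ℝ F) p v (e k))) := by
  obtain ⟨L, hL, hLv⟩ := hasFDerivAt_holVolumeForm fun k => hasFDerivAt_derivFrame hF (e k)
  have : HasFDerivAt (derivVol F e) L p := hL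
  rw [this.fderiv, hLv]
  rfl

/-- The divergence identity: if `V = ∑ ζₖ ∂ₖF` with complex coefficients `ζₖ`, then
`tr (v ↦ ∂ᵥV) = ∑ (∂ₖ ζₖ + ζₖ ∂ₖ D / D)`, where `D` is the complex volume of the frame `∂ₖF` and
the trace is the complex trace with respect to that frame. It rests on `∂ⱼ∂ₖF = ∂ₖ∂ⱼF`. -/
lemma sum_frameCoord_fderiv (hF : ContDiffAt ℝ 2 F p) (hD : derivVol F e p ≠ 0)
    {V : G → Cn n} (hV : ContDiffAt ℝ 1 V p) :
    ∑ k, frameCoord (derivFrame F e p) (fderiv ℝ V p (e k)) k =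
      ∑ k, (fderiv ℝ (fun q => frameCoord (derivFrame F e q) (V q) k) p (e k) +
        frameCoord (derivFrame F e p) (V p) k *
          (fderiv ℝ (derivVol F e) p (e k) / derivVol F e p)) := by
  have hDc : ContinuousAt (derivVol F e) p :=
    (contDiffAt_derivVol (m := 1) hF (by norm_num)).continuousAt
  have hVeq : V =ᶠ[𝓝 p]
      fun q => ∑ m, frameCoord (derivFrame F e q) (V q) m • fderiv ℝ F q (e m) := by
    filter_upwards [hDc.eventually_ne hD] with q hq
    exact (sum_frameCoord hq (V q)).symm
  have hζ : ∀ m, HasFDerivAt (fun q => frameCoord (derivFrame F e q) (V q) m)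
      (fderiv ℝ (fun q => frameCoord (derivFrame F e q) (V q) m) p) p := fun m =>
    ((contDiffAt_frameCoord hF (by norm_num) hD hV m).differentiableAt (by norm_num)).hasFDerivAt
  have hsum := HasFDerivAt.fun_sum (u := Finset.univ)
    fun m _ => (hζ m).smul (hasFDerivAt_derivFrame hF (e m))
  have hV' : ∀ v, fderiv ℝ V p v = ∑ m, (fderiv ℝ
      (fun q => frameCoord (derivFrame F e q) (V q) m) p v • derivFrame F e p m +
      frameCoord (derivFrame F e p) (V p) m • fderiv ℝ (fderiv ℝ F) p v (e m)) := by
    intro v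
    rw [(hsum.congr_of_eventuallyEq hVeq).fderiv]
    simp only [sum_apply]
    refine Finset.sum_congr rfl fun m _ => ?_
    rw [add_comm]
    rfl
  have hlin : ∀ (k : Fin n) (W : Fin n → Cn n), frameCoord (derivFrame F e p) (∑ m, W m) k =
      ∑ m, frameCoord (derivFrame F e p) (W m) k := by
    intro k W
    simp only [frameCoord, ← det_eq_holVolumeForm]
    rw [AlternatingMap.map_update_sum, Finset.sum_div]
  have hsmul : ∀ (k : Fin n) (c : ℂ) (W : Cn n), frameCoord (derivFrame F e p) (c • W) k =
      c * frameCoord (derivFrame F e p) W k := by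
    intro k c W
    simp only [frameCoord, ← det_eq_holVolumeForm]
    rw [AlternatingMap.map_update_smul, smul_eq_mul, mul_div_assoc]
  have hadd : ∀ (k : Fin n) (W W' : Cn n), frameCoord (derivFrame F e p) (W + W') k =
      frameCoord (derivFrame F e p) W k + frameCoord (derivFrame F e p) W' k := by
    intro k W W'
    simp only [frameCoord, ← det_eq_holVolumeForm]
    rw [AlternatingMap.map_update_add, add_div]
  have hdiag : ∀ (k : Fin n) (c : Fin n → ℂ),
      ∑ m, c m * frameCoord (derivFrame F e p) (derivFrame F e p m) k = c k := by
    intro k c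
    simp only [← hsmul]
    rw [← hlin, frameCoord_sum hD]
  calc ∑ k, frameCoord (derivFrame F e p) (fderiv ℝ V p (e k)) k
      = ∑ k, (fderiv ℝ (fun q => frameCoord (derivFrame F e q) (V q) k) p (e k) +
          ∑ m, frameCoord (derivFrame F e p) (V p) m *
            frameCoord (derivFrame F e p) (fderiv ℝ (fderiv ℝ F) p (e k) (e m)) k) := by
        refine Finset.sum_congr rfl fun k _ => ?_
        rw [hV', hlin]
        simp only [hadd, hsmul, Finset.sum_add_distrib]
        rw [hdiag k]
    _ = _ := by
        rw [Finset.sum_add_distrib, Finset.sum_add_distrib, Finset.sum_comm]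
        congr 1
        refine Finset.sum_congr rfl fun m _ => ?_
        rw [← Finset.mul_sum, hasFDerivAt_derivVol hF, Finset.sum_div]
        congr 1
        refine Finset.sum_congr rfl fun k _ => ?_
        rw [fderiv_fderiv_comm hF]
        rfl

end FrameCalculus

section Angle

variable {G : Type*} [NormedAddCommGroup G]

/-- A continuous branch `θ` of half the argument of `D²` differs from its value at `p` by the
principal argument of `D / D p`. -/
lemma eventually_angle_eq {D : G → ℂ} {θ : G → ℝ} {p : G} (hD : ContinuousAt D p) (hDp : D p ≠ 0)
    (hθ : ContinuousAt θ p)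
    (h : ∀ᶠ q in 𝓝 p, D q ^ 2 = Complex.exp (Complex.I * θ q) ^ 2 * (‖D q‖ : ℂ) ^ 2) :
    ∀ᶠ q in 𝓝 p, θ q = θ p + (Complex.log (D q / D p)).im := by
  have hdiv : ContinuousAt (fun q => D q / D p) p := hD.div_const _
  have h1 : D p / D p = 1 := div_self hDp
  have harg : ContinuousAt (fun q => (Complex.log (D q / D p)).im - (θ q - θ p)) p := by
    refine ContinuousAt.sub ?_ (hθ.sub continuousAt_const)
    refine Complex.continuous_im.continuousAt.comp (hdiv.clog ?_)
    rw [h1]; exact Complex.one_mem_slitPlane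
  have hsmall : ∀ᶠ q in 𝓝 p, |(Complex.log (D q / D p)).im - (θ q - θ p)| < Real.pi := by
    refine harg.abs.eventually (gt_mem_nhds ?_)
    simp [h1, Real.pi_pos]
  filter_upwards [h, hsmall, hD.eventually_ne hDp] with q hq hs hDq
  have hp := h.self_of_nhds
  set α := (Complex.log (D q / D p)).im with hα
  set y := α - (θ q - θ p) with hy
  have hz : D q / D p ≠ 0 := div_ne_zero hDq hDp
  have hne : ((‖D q‖ : ℝ) : ℂ) ≠ 0 := by exact_mod_cast norm_ne_zero_iff.2 hDq
  have hnep : ((‖D p‖ : ℝ) : ℂ) ≠ 0 := by exact_mod_cast norm_ne_zero_iff.2 hDp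
  have hpolar : D q / D p = ((‖D q‖ / ‖D p‖ : ℝ) : ℂ) * Complex.exp (Complex.I * α) := by
    rw [← norm_div]
    conv_lhs => rw [← Complex.norm_mul_exp_arg_mul_I (D q / D p)]
    rw [hα, Complex.log_im, mul_comm Complex.I]
  have hexp : Complex.exp (2 * Complex.I * y) = 1 := by
    have e1 : Complex.exp (2 * Complex.I * y) =
        Complex.exp (Complex.I * α) ^ 2 * Complex.exp (Complex.I * θ p) ^ 2 /
          Complex.exp (Complex.I * θ q) ^ 2 := by
      rw [← Complex.exp_nat_mul, ← Complex.exp_nat_mul, ← Complex.exp_nat_mul, ← Complex.exp_add,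
        ← Complex.exp_sub]
      congr 1
      rw [hy]; push_cast; ring
    rw [e1, div_eq_one_iff_eq (pow_ne_zero 2 (Complex.exp_ne_zero _))]
    have e2 : Complex.exp (Complex.I * α) = D q / D p * (‖D p‖ / ‖D q‖) := by
      rw [hpolar]; push_cast; field_simp
    rw [e2]
    have e3 : Complex.exp (Complex.I * θ p) ^ 2 = D p ^ 2 / (‖D p‖ : ℂ) ^ 2 := by
      rw [hp]; field_simp
    have e4 : Complex.exp (Complex.I * θ q) ^ 2 = D q ^ 2 / (‖D q‖ : ℂ) ^ 2 := by
      rw [hq]; field_simp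
    rw [e3, e4]
    field_simp
  obtain ⟨k, hk⟩ := Complex.exp_eq_one_iff.1 hexp
  have hk' : y = k * Real.pi := by
    have h2 : (2 * Complex.I) * (y : ℂ) = (2 * Complex.I) * (k * Real.pi : ℂ) := by rw [hk]; ring
    have h3 := mul_left_cancel₀ (by simp) h2
    exact_mod_cast h3
  have hk0 : k = 0 := by
    rw [hk', abs_mul, abs_of_pos Real.pi_pos] at hs
    have h4 : |(k : ℝ)| < 1 := by
      by_contra hcon
      push Not at hcon
      nlinarith [Real.pi_pos]
    rw [← Int.cast_abs] at h4
    exact Int.abs_lt_one_iff.1 (by exact_mod_cast h4)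
  rw [hk0, Int.cast_zero, zero_mul] at hk'
  linarith

variable [NormedSpace ℝ G]

/-- The derivative of the angle is the imaginary part of the logarithmic derivative of `D`. -/
lemma hasFDerivAt_angle {D : G → ℂ} {θ : G → ℝ} {p : G} {D' : G →L[ℝ] ℂ}
    (hD : HasFDerivAt D D' p) (hDp : D p ≠ 0) (hθ : ContinuousAt θ p)
    (h : ∀ᶠ q in 𝓝 p, D q ^ 2 = Complex.exp (Complex.I * θ q) ^ 2 * (‖D q‖ : ℂ) ^ 2) :
    DifferentiableAt ℝ θ p ∧ ∀ v, fderiv ℝ θ p v = (D' v / D p).im := by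
  have h1 : HasFDerivAt (fun q => D q / D p) ((D p)⁻¹ • D') p := by
    simpa only [div_eq_mul_inv] using hD.mul_const (D p)⁻¹
  have h2 : HasFDerivAt (fun q => Complex.log (D q / D p)) ((D p / D p)⁻¹ • ((D p)⁻¹ • D')) p :=
    by
    have hl : HasFDerivAt Complex.log _ (D p / D p) := (Complex.hasDerivAt_log
      (by rw [div_self hDp]; exact Complex.one_mem_slitPlane)).hasFDerivAt.restrictScalars ℝ
    refine (hl.comp p h1).congr_fderiv ?_
    ext v
    simp [div_self hDp]
  have h3 := ((Complex.imCLM.hasFDerivAt.comp p h2).const_add (θ p)).congr_of_eventuallyEq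
    (eventually_angle_eq hD.continuousAt hDp hθ h)
  refine ⟨h3.differentiableAt, fun v => ?_⟩
  rw [h3.fderiv, div_self hDp]
  simp [div_eq_inv_mul]

lemma contDiffAt_angle {m : ℕ∞ω} {D : G → ℂ} {θ : G → ℝ} {p : G}
    (hD : ContDiffAt ℝ m D p) (hDp : D p ≠ 0) (hθ : ContinuousAt θ p)
    (h : ∀ᶠ q in 𝓝 p, D q ^ 2 = Complex.exp (Complex.I * θ q) ^ 2 * (‖D q‖ : ℂ) ^ 2) :
    ContDiffAt ℝ m θ p := by
  refine ContDiffAt.congr_of_eventuallyEq ?_ (eventually_angle_eq hD.continuousAt hDp hθ h)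
  have hlog : ContDiffAt ℝ m (fun q => Complex.log (D q / D p)) p := ?_
  · exact contDiffAt_const.add (Complex.imCLM.contDiff.contDiffAt.comp p hlog)
  refine ContDiffAt.comp p (g := Complex.log) ?_
    (by simpa only [div_eq_mul_inv] using hD.mul contDiffAt_const)
  rw [div_self hDp]
  exact (Complex.contDiffAt_log Complex.one_mem_slitPlane).restrict_scalars ℝ

/-- The logarithmic derivative of `|D|` is the real part of that of `D`. -/
lemma hasFDerivAt_norm_complex {D : G → ℂ} {p : G} {D' : G →L[ℝ] ℂ}
    (hD : HasFDerivAt D D' p) (hDp : D p ≠ 0) :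
    DifferentiableAt ℝ (fun q => ‖D q‖) p ∧
      ∀ v, fderiv ℝ (fun q => ‖D q‖) p v = ‖D p‖ * (D' v / D p).re := by
  have h1 : DifferentiableAt ℝ (fun q => ‖D q‖) p := hD.differentiableAt.norm ℝ hDp
  refine ⟨h1, fun v => ?_⟩
  have h2 := hD.norm_sq.unique (h1.hasFDerivAt.pow 2)
  have h3 := congrArg (fun L : G →L[ℝ] ℝ => L v) h2
  have hn : ‖D p‖ ≠ 0 := norm_ne_zero_iff.2 hDp
  simp at h3
  rw [Complex.div_re, Complex.normSq_eq_norm_sq]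
  field_simp
  nlinarith [h3]

end Angle

/-! ### Evolution equations in coordinates -/

section Evolution

variable {n : ℕ} {G : Type*} [NormedAddCommGroup G] [NormedSpace ℝ G]
  {F : G → Cn n} {e : Fin n → G} {p : G}

/-- For a Lagrangian immersion, the trilinear form `⟨i ∂ⱼF, ∂ₘ∂ₖF⟩` is totally symmetric. -/
lemma inner_I_secondDeriv_symm (hF : ContDiffAt ℝ 2 F p)
    (hiso : ∀ᶠ q in 𝓝 p, IsIsotropic (derivFrame F e q)) (j m k : Fin n) :
    inner ℝ (Complex.I • derivFrame F e p j) (fderiv ℝ (fderiv ℝ F) p (e m) (e k)) =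
      inner ℝ (Complex.I • derivFrame F e p m) (fderiv ℝ (fderiv ℝ F) p (e k) (e j)) := by
  have h1 : HasFDerivAt (fun q => inner ℝ (Complex.I • fderiv ℝ F q (e j)) (fderiv ℝ F q (e m)))
      _ p := ((hasFDerivAt_derivFrame hF (e j)).const_smul Complex.I).inner ℝ
        (hasFDerivAt_derivFrame hF (e m))
  have h0 : (fun q => inner ℝ (Complex.I • fderiv ℝ F q (e j)) (fderiv ℝ F q (e m))) =ᶠ[𝓝 p]
      fun _ => (0 : ℝ) := by
    filter_upwards [hiso] with q hq using hq j m
  have h2 := (h1.congr_of_eventuallyEq h0.symm).unique (hasFDerivAt_const (0 : ℝ) p)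
  have h3 := congrArg (fun L : G →L[ℝ] ℝ => L (e k)) h2
  have h4 : inner ℝ (Complex.I • derivFrame F e p j) (fderiv ℝ (fderiv ℝ F) p (e k) (e m)) +
      inner ℝ (Complex.I • fderiv ℝ (fderiv ℝ F) p (e k) (e j)) (derivFrame F e p m) = 0 := by
    simpa [fderivInnerCLM_apply, derivFrame] using h3
  have h5 : inner ℝ (Complex.I • fderiv ℝ (fderiv ℝ F) p (e k) (e j)) (derivFrame F e p m) =
      - inner ℝ (Complex.I • derivFrame F e p m) (fderiv ℝ (fderiv ℝ F) p (e k) (e j)) := by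
    rw [real_inner_I_smul_left, real_inner_I_smul_left, ← inner_conj_symm, Complex.conj_im]
  rw [fderiv_fderiv_comm hF (e m)]
  rw [h5] at h4; linarith

/-- The Lagrangian angle is a potential of the mean curvature: `dθ(v) = ⟨i dF(v), H⟩`, where `H` is
the trace of the second fundamental form. -/
lemma fderiv_angle_eq_inner_trace (hF : ContDiffAt ℝ 2 F p)
    (hiso : ∀ᶠ q in 𝓝 p, IsIsotropic (derivFrame F e q)) (hD : derivVol F e p ≠ 0) {θ : G → ℝ}
    (hθ : ContinuousAt θ p)
    (hang : ∀ᶠ q in 𝓝 p, derivVol F e q ^ 2 =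
      Complex.exp (Complex.I * θ q) ^ 2 * (‖derivVol F e q‖ : ℂ) ^ 2) (m : Fin n) :
    fderiv ℝ θ p (e m) = inner ℝ (Complex.I • derivFrame F e p m)
      (∑ i, ∑ j, (Matrix.gram ℝ (derivFrame F e p))⁻¹ i j •
        (Submodule.span ℝ (range (derivFrame F e p)))ᗮ.starProjection
          (fderiv ℝ (fderiv ℝ F) p (e i) (e j))) := by
  have hp := hiso.self_of_nhds
  have hDd : HasFDerivAt (derivVol F e) (fderiv ℝ (derivVol F e) p) p :=
    ((contDiffAt_derivVol (m := 1) hF (by norm_num)).differentiableAt (by norm_num)).hasFDerivAt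
  rw [(hasFDerivAt_angle hDd hD hθ hang).2, hasFDerivAt_derivVol hF, Finset.sum_div,
    Complex.im_sum, inner_sum]
  refine Finset.sum_congr rfl fun k _ => ?_
  change (frameCoord (derivFrame F e p) _ k).im = _
  rw [hp.im_frameCoord hD, inner_sum]
  refine Finset.sum_congr rfl fun j _ => ?_
  rw [inner_smul_right, hp.starProjection_orthogonal hD]
  congr 1
  rw [hp.inner_I_sum_smul, inner_I_secondDeriv_symm hF hiso]
  conv_lhs => rw [← sum_frameCoord hD (fderiv ℝ (fderiv ℝ F) p (e k) (e j)), hp.inner_I_sum_smul]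
  simp

/-- The coefficients `aₖ` of `H = i ∑ aₖ ∂ₖF`, where `H = ∂ᵥF`. -/
def velCoord (F : G → Cn n) (e : Fin n → G) (v : G) (k : Fin n) (q : G) : ℝ :=
  (frameCoord (derivFrame F e q) (fderiv ℝ F q v) k).im

/-- The coefficients `bₖ` of the tangential part `∑ bₖ ∂ₖF` of the position vector `F - X₀`. -/
def posCoord (F : G → Cn n) (e : Fin n → G) (X₀ : Cn n) (k : Fin n) (q : G) : ℝ :=
  (frameCoord (derivFrame F e q) (F q - X₀) k).re

/-- Derivatives of a complex volume function `D = ± w e^{iθ}` in terms of those of `θ` and `w`. -/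
lemma derivVol_logDeriv (hF : ContDiffAt ℝ 2 F p) (hD : derivVol F e p ≠ 0) {θ : G → ℝ}
    (hθ : ContinuousAt θ p)
    (hang : ∀ᶠ q in 𝓝 p, derivVol F e q ^ 2 =
      Complex.exp (Complex.I * θ q) ^ 2 * (‖derivVol F e q‖ : ℂ) ^ 2) (v : G) :
    (fderiv ℝ (derivVol F e) p v / derivVol F e p).im = fderiv ℝ θ p v ∧
    ‖derivVol F e p‖ * (fderiv ℝ (derivVol F e) p v / derivVol F e p).re =
      fderiv ℝ (fun q => ‖derivVol F e q‖) p v := by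
  have hDd : HasFDerivAt (derivVol F e) (fderiv ℝ (derivVol F e) p) p :=
    ((contDiffAt_derivVol (m := 1) hF (by norm_num)).differentiableAt (by norm_num)).hasFDerivAt
  exact ⟨((hasFDerivAt_angle hDd hD hθ hang).2 v).symm, ((hasFDerivAt_norm_complex hDd hD).2 v).symm⟩

/-- The local data of a Lagrangian mean curvature flow near a point `p` of spacetime `G`, with
spatial coordinate directions `e k` and time direction `v`. -/
structure IsLocalFlowAt (F : G → Cn n) (θ : G → ℝ) (e : Fin n → G) (v p : G) : Prop where
  contDiffAt : ContDiffAt ℝ ∞ F p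
  isotropic : ∀ᶠ q in 𝓝 p, IsIsotropic (derivFrame F e q)
  vol_ne : derivVol F e p ≠ 0
  angle_continuousAt : ContinuousAt θ p
  angle : ∀ᶠ q in 𝓝 p, derivVol F e q ^ 2 =
    Complex.exp (Complex.I * θ q) ^ 2 * (‖derivVol F e q‖ : ℂ) ^ 2
  normal : ∀ᶠ q in 𝓝 p, ∀ j, inner ℝ (derivFrame F e q j) (fderiv ℝ F q v) = 0
  gradient : ∀ k, fderiv ℝ θ p (e k) = inner ℝ (Complex.I • derivFrame F e p k) (fderiv ℝ F p v)

namespace IsLocalFlowAt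

variable {θ : G → ℝ} {v : G}

lemma contDiffAt_two (h : IsLocalFlowAt F θ e v p) : ContDiffAt ℝ 2 F p :=
  h.contDiffAt.of_le (WithTop.coe_le_coe.2 le_top)

lemma vol_eventually_ne (h : IsLocalFlowAt F θ e v p) : ∀ᶠ q in 𝓝 p, derivVol F e q ≠ 0 :=
  (contDiffAt_derivVol (m := 1) h.contDiffAt_two (by norm_num)).continuousAt.eventually_ne h.vol_ne

lemma contDiffAt_angle (h : IsLocalFlowAt F θ e v p) : ContDiffAt ℝ 1 θ p :=
  LagrangianMCF.contDiffAt_angle (contDiffAt_derivVol (m := 1) h.contDiffAt_two (by norm_num))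
    h.vol_ne h.angle_continuousAt h.angle

lemma contDiffAt_norm_vol (h : IsLocalFlowAt F θ e v p) :
    ContDiffAt ℝ 1 (fun q => ‖derivVol F e q‖) p :=
  (contDiffAt_derivVol (m := 1) h.contDiffAt_two (by norm_num)).norm ℝ h.vol_ne

lemma contDiffAt_vel (h : IsLocalFlowAt F θ e v p) : ContDiffAt ℝ 1 (fun q => fderiv ℝ F q v) p :=
  contDiffAt_fderiv_apply h.contDiffAt_two (by norm_num) v

lemma contDiffAt_velFrameCoord (h : IsLocalFlowAt F θ e v p) (k : Fin n) :
    ContDiffAt ℝ 1 (fun q => frameCoord (derivFrame F e q) (fderiv ℝ F q v) k) p :=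
  contDiffAt_frameCoord h.contDiffAt_two (by norm_num) h.vol_ne h.contDiffAt_vel k

lemma contDiffAt_posFrameCoord (h : IsLocalFlowAt F θ e v p) (X₀ : Cn n) (k : Fin n) :
    ContDiffAt ℝ 1 (fun q => frameCoord (derivFrame F e q) (F q - X₀) k) p :=
  contDiffAt_frameCoord h.contDiffAt_two (by norm_num) h.vol_ne
    ((h.contDiffAt.of_le (by exact_mod_cast le_top)).sub contDiffAt_const) k

lemma contDiffAt_velCoord (h : IsLocalFlowAt F θ e v p) (k : Fin n) :
    ContDiffAt ℝ 1 (velCoord F e v k) p :=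
  Complex.imCLM.contDiff.contDiffAt.comp p (h.contDiffAt_velFrameCoord k)

lemma contDiffAt_posCoord (h : IsLocalFlowAt F θ e v p) (X₀ : Cn n) (k : Fin n) :
    ContDiffAt ℝ 1 (posCoord F e X₀ k) p :=
  Complex.reCLM.contDiff.contDiffAt.comp p (h.contDiffAt_posFrameCoord X₀ k)

lemma frameCoord_vel (h : IsLocalFlowAt F θ e v p) (k : Fin n) :
    frameCoord (derivFrame F e p) (fderiv ℝ F p v) k = Complex.I * velCoord F e v k p := by
  have := h.isotropic.self_of_nhds.re_frameCoord_eq_zero h.vol_ne h.normal.self_of_nhds k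
  refine Complex.ext ?_ ?_
  · simpa using this
  · simp [velCoord]

lemma eventually_frameCoord_vel (h : IsLocalFlowAt F θ e v p) (k : Fin n) :
    ∀ᶠ q in 𝓝 p, frameCoord (derivFrame F e q) (fderiv ℝ F q v) k =
      Complex.I * velCoord F e v k q := by
  filter_upwards [h.isotropic, h.vol_eventually_ne, h.normal] with q hq hDq hN
  have := hq.re_frameCoord_eq_zero hDq hN k
  refine Complex.ext ?_ ?_
  · simpa using this
  · simp [velCoord]

lemma vel_eq_sum (h : IsLocalFlowAt F θ e v p) :
    fderiv ℝ F p v = ∑ k, (Complex.I * velCoord F e v k p) • derivFrame F e p k := by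
  conv_lhs => rw [← sum_frameCoord h.vol_ne (fderiv ℝ F p v)]
  simp only [h.frameCoord_vel]

lemma gradient_eq_sum (h : IsLocalFlowAt F θ e v p) (k : Fin n) :
    fderiv ℝ θ p (e k) =
      ∑ m, velCoord F e v m p * inner ℝ (derivFrame F e p k) (derivFrame F e p m) := by
  rw [h.gradient, h.vel_eq_sum, h.isotropic.self_of_nhds.inner_I_sum_smul]
  simp

lemma inner_vel_eq (h : IsLocalFlowAt F θ e v p) (V : Cn n) :
    inner ℝ (fderiv ℝ F p v) V =
      ∑ k, (frameCoord (derivFrame F e p) V k).im * fderiv ℝ θ p (e k) := by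
  have hp := h.isotropic.self_of_nhds
  have h1 : inner ℝ (fderiv ℝ F p v) V = ∑ j, velCoord F e v j p *
      inner ℝ (Complex.I • derivFrame F e p j) V := by
    conv_lhs => rw [h.vel_eq_sum]
    rw [sum_inner]
    refine Finset.sum_congr rfl fun j _ => ?_
    rw [mul_comm Complex.I, mul_smul, Complex.coe_smul, real_inner_smul_left]
  rw [h1]
  simp only [h.gradient_eq_sum]
  conv_lhs => rw [← sum_frameCoord h.vol_ne V]
  simp only [hp.inner_I_sum_smul, Finset.mul_sum]
  rw [Finset.sum_comm]
  refine Finset.sum_congr rfl fun j _ => Finset.sum_congr rfl fun k _ => ?_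
  rw [real_inner_comm (derivFrame F e p k)]
  ring

lemma sum_velCoord_gradient (h : IsLocalFlowAt F θ e v p) :
    ∑ k, velCoord F e v k p * fderiv ℝ θ p (e k) = ‖fderiv ℝ F p v‖ ^ 2 := by
  rw [← real_inner_self_eq_norm_sq, h.inner_vel_eq]
  rfl

/-- Real and imaginary parts of the divergence identity for a vector field `V`. -/
lemma divergence (h : IsLocalFlowAt F θ e v p) {V : G → Cn n} (hV : ContDiffAt ℝ 1 V p) :
    ‖derivVol F e p‖ *
      (∑ k, frameCoord (derivFrame F e p) (fderiv ℝ V p (e k)) k).re =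
      ∑ k, fderiv ℝ (fun q => ‖derivVol F e q‖ * (frameCoord (derivFrame F e q) (V q) k).re) p (e k)
        - ‖derivVol F e p‖ * inner ℝ (fderiv ℝ F p v) (V p) ∧
    ‖derivVol F e p‖ *
      (∑ k, frameCoord (derivFrame F e p) (fderiv ℝ V p (e k)) k).im =
      ∑ k, fderiv ℝ (fun q => ‖derivVol F e q‖ * (frameCoord (derivFrame F e q) (V q) k).im) p (e k)
        + ‖derivVol F e p‖ * ∑ k, (frameCoord (derivFrame F e p) (V p) k).re *
            fderiv ℝ θ p (e k) := by
  have hw := h.contDiffAt_norm_vol.differentiableAt (by norm_num)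
  have hζ : ∀ k, HasFDerivAt (fun q => frameCoord (derivFrame F e q) (V q) k) _ p := fun k =>
    ((contDiffAt_frameCoord h.contDiffAt_two (by norm_num) h.vol_ne hV k).differentiableAt
      (by norm_num)).hasFDerivAt
  have hre : ∀ k, fderiv ℝ (fun q => ‖derivVol F e q‖ *
      (frameCoord (derivFrame F e q) (V q) k).re) p (e k) =
      ‖derivVol F e p‖ * (fderiv ℝ (fun q => frameCoord (derivFrame F e q) (V q) k) p (e k)).re +
      (frameCoord (derivFrame F e p) (V p) k).re *
        fderiv ℝ (fun q => ‖derivVol F e q‖) p (e k) := fun k => by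
    have := hw.hasFDerivAt.mul (Complex.reCLM.hasFDerivAt.comp p (hζ k))
    have h' : fderiv ℝ (fun q => ‖derivVol F e q‖ *
      (frameCoord (derivFrame F e q) (V q) k).re) p = _ := this.fderiv
    rw [h']; simp
  have him : ∀ k, fderiv ℝ (fun q => ‖derivVol F e q‖ *
      (frameCoord (derivFrame F e q) (V q) k).im) p (e k) =
      ‖derivVol F e p‖ * (fderiv ℝ (fun q => frameCoord (derivFrame F e q) (V q) k) p (e k)).im +
      (frameCoord (derivFrame F e p) (V p) k).im *
        fderiv ℝ (fun q => ‖derivVol F e q‖) p (e k) := fun k => by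
    have := hw.hasFDerivAt.mul (Complex.imCLM.hasFDerivAt.comp p (hζ k))
    have h' : fderiv ℝ (fun q => ‖derivVol F e q‖ *
      (frameCoord (derivFrame F e q) (V q) k).im) p = _ := this.fderiv
    rw [h']; simp
  rw [sum_frameCoord_fderiv h.contDiffAt_two h.vol_ne hV, Complex.re_sum, Complex.im_sum,
    h.inner_vel_eq, Finset.mul_sum, Finset.mul_sum, Finset.mul_sum, Finset.mul_sum,
    ← Finset.sum_sub_distrib, ← Finset.sum_add_distrib]
  constructor <;>
  · refine Finset.sum_congr rfl fun k _ => ?_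
    obtain ⟨h1, h2⟩ := derivVol_logDeriv h.contDiffAt_two h.vol_ne h.angle_continuousAt h.angle (e k)
    rw [← h1]
    first
    | rw [hre, ← h2, Complex.add_re, Complex.mul_re]
    | rw [him, ← h2, Complex.add_im, Complex.mul_im]
    ring

/-- Evolution of the area density `w` and of the Lagrangian angle along the flow:
`∂ₜw = -|H|² w` and `w ∂ₜθ = ∑ ∂ₖ(w aₖ)`, that is, `∂ₜθ = Δθ`. -/
lemma evolution (h : IsLocalFlowAt F θ e v p) :
    fderiv ℝ (fun q => ‖derivVol F e q‖) p v = -(‖fderiv ℝ F p v‖ ^ 2 * ‖derivVol F e p‖) ∧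
    ‖derivVol F e p‖ * fderiv ℝ θ p v =
      ∑ k, fderiv ℝ (fun q => ‖derivVol F e q‖ * velCoord F e v k q) p (e k) := by
  obtain ⟨h1, h2⟩ := derivVol_logDeriv h.contDiffAt_two h.vol_ne h.angle_continuousAt h.angle v
  have h3 : fderiv ℝ (derivVol F e) p v / derivVol F e p =
      ∑ k, frameCoord (derivFrame F e p) (fderiv ℝ (fun q => fderiv ℝ F q v) p (e k)) k := by
    rw [hasFDerivAt_derivVol h.contDiffAt_two, Finset.sum_div]
    refine Finset.sum_congr rfl fun k _ => ?_
    rw [(hasFDerivAt_derivFrame h.contDiffAt_two v).fderiv, fderiv_fderiv_comm h.contDiffAt_two v]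
    rfl
  obtain ⟨h4, h5⟩ := h.divergence h.contDiffAt_vel
  rw [← h3] at h4 h5
  constructor
  · rw [← h2, h4, real_inner_self_eq_norm_sq, Finset.sum_eq_zero]
    · ring
    · intro k _
      have : (fun q => ‖derivVol F e q‖ *
          (frameCoord (derivFrame F e q) (fderiv ℝ F q v) k).re) =ᶠ[𝓝 p] fun _ => 0 := by
        filter_upwards [h.eventually_frameCoord_vel k] with q hq
        rw [hq]; simp
      rw [this.fderiv_eq]; simp
  · rw [← h1, h5]
    simp only [h.frameCoord_vel]
    simp [velCoord]

/-- The divergence of the tangential part of the position vector is `n + ⟨H, F - X₀⟩`. -/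
lemma sum_fderiv_posCoord (h : IsLocalFlowAt F θ e v p) (X₀ : Cn n) :
    ∑ k, fderiv ℝ (fun q => ‖derivVol F e q‖ * posCoord F e X₀ k q) p (e k) =
      ‖derivVol F e p‖ * (n + inner ℝ (fderiv ℝ F p v) (F p - X₀)) := by
  have h1 := (h.divergence (V := fun q => F q - X₀)
    ((h.contDiffAt.of_le (by exact_mod_cast le_top)).sub contDiffAt_const)).1
  have h2 : ∀ k, frameCoord (derivFrame F e p) (fderiv ℝ (fun q => F q - X₀) p (e k)) k = 1 := by
    intro k
    rw [fderiv_sub_const]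
    change holVolumeForm (Function.update (derivFrame F e p) k (derivFrame F e p k)) / _ = 1
    rw [Function.update_eq_self]
    exact div_self h.vol_ne
  simp only [h2] at h1
  simp only [Finset.sum_const, Finset.card_univ, Fintype.card_fin, nsmul_eq_mul, mul_one,
    Complex.natCast_re] at h1
  have h3 := eq_add_of_sub_eq h1.symm
  rw [mul_add]
  exact h3

end IsLocalFlowAt

end Evolution

/-! ### The backward heat kernel and the pointwise monotonicity formula -/

section Kernel

variable {n : ℕ}

lemma hasDerivAt_rho {X : ℝ → Cn n} {X' X₀ : Cn n} {t : ℝ → ℝ} {t' t₀ s : ℝ}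
    (hX : HasDerivAt X X' s) (ht : HasDerivAt t t' s) (hlt : t s < t₀) :
    HasDerivAt (fun r => rho (X r) X₀ (t r) t₀)
      (rho (X s) X₀ (t s) t₀ * (t' * (n / (2 * (t₀ - t s)) -
        ‖X s - X₀‖ ^ 2 / (4 * (t₀ - t s) ^ 2)) - inner ℝ (X s - X₀) X' / (2 * (t₀ - t s)))) s := by
  have hτ : 0 < t₀ - t s := sub_pos.2 hlt
  have hb : 0 < 4 * Real.pi * (t₀ - t s) := by positivity
  have h1 : HasDerivAt (fun r => 4 * Real.pi * (t₀ - t r)) (4 * Real.pi * -t') s :=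
    (ht.const_sub t₀).const_mul _
  have h2 := (h1.rpow_const (p := (n : ℝ) / 2) (Or.inl hb.ne')).fun_inv
    (Real.rpow_pos_of_pos hb _).ne'
  have h3 : HasDerivAt (fun r => ‖X r - X₀‖ ^ 2) (2 * inner ℝ (X s - X₀) X') s :=
    (hX.sub_const X₀).norm_sq
  have h4 : HasDerivAt (fun r => 4 * (t₀ - t r)) (4 * -t') s := (ht.const_sub t₀).const_mul _
  have h5 := (h3.fun_div h4 (by positivity)).fun_neg.exp
  have h6 := h2.fun_mul h5
  simp only [rho, one_div]
  refine h6.congr_deriv ?_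
  rw [Real.rpow_sub_one hb.ne']
  have hP := (Real.rpow_pos_of_pos hb ((n : ℝ) / 2)).ne'
  field_simp
  ring

lemma contDiffAt_rho {G : Type*} [NormedAddCommGroup G] [NormedSpace ℝ G] {m : ℕ∞ω}
    {X : G → Cn n} {t : G → ℝ} {p : G} (hX : ContDiffAt ℝ m X p) (ht : ContDiffAt ℝ m t p)
    (X₀ : Cn n) {t₀ : ℝ} (hlt : t p < t₀) :
    ContDiffAt ℝ m (fun q => rho (X q) X₀ (t q) t₀) p := by
  have hτ : 0 < t₀ - t p := sub_pos.2 hlt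
  have hb : 0 < 4 * Real.pi * (t₀ - t p) := by positivity
  have hs : ContDiffAt ℝ m (fun q => t₀ - t q) p := contDiffAt_const.sub ht
  simp only [rho, one_div]
  refine ContDiffAt.mul ?_ ?_
  · refine ContDiffAt.inv ?_ (Real.rpow_pos_of_pos hb _).ne'
    exact (contDiffAt_const.mul hs).rpow_const_of_ne hb.ne'
  · refine (ContDiffAt.div ((hX.sub contDiffAt_const).norm_sq ℝ) (contDiffAt_const.mul hs) ?_).neg.exp
    positivity

end Kernel

/-- The coefficients of the vector field whose divergence appears in the monotonicity formula,
multiplied by the area density: the gradient of `f(θ)` times `ρ`, minus `f(θ)` times the tangential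
gradient of `ρ`. -/
def flux {n : ℕ} {G : Type*} [NormedAddCommGroup G] [NormedSpace ℝ G]
    (F : G → Cn n) (θ : G → ℝ) (e : Fin n → G) (v : G) (tm : G →L[ℝ] ℝ) (f : ℝ → ℝ)
    (X₀ : Cn n) (t₀ : ℝ) (k : Fin n) (q : G) : ℝ :=
  ‖derivVol F e q‖ * (rho (F q) X₀ (tm q) t₀ * (deriv f (θ q) * velCoord F e v k q +
    f (θ q) * posCoord F e X₀ k q / (2 * (t₀ - tm q))))

namespace IsLocalFlowAt

variable {n : ℕ} {G : Type*} [NormedAddCommGroup G] [NormedSpace ℝ G]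
  {F : G → Cn n} {e : Fin n → G} {p v : G} {θ : G → ℝ}

/-- Decomposition of the position vector `F - X₀` into a tangential part, with coefficients
`posCoord`, and the normal component `N`, and the inner products that follow from it. -/
lemma normalPos_facts (h : IsLocalFlowAt F θ e v p) (X₀ : Cn n) {N : Cn n}
    (hN : N = (Submodule.span ℝ (range (derivFrame F e p)))ᗮ.starProjection (F p - X₀)) :
    F p - X₀ = ∑ k, posCoord F e X₀ k p • derivFrame F e p k + N ∧
    ∑ k, posCoord F e X₀ k p * inner ℝ (F p - X₀) (derivFrame F e p k) =
      ‖F p - X₀‖ ^ 2 - ‖N‖ ^ 2 ∧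
    inner ℝ (fderiv ℝ F p v) (F p - X₀) = inner ℝ (fderiv ℝ F p v) N ∧
    ∑ k, velCoord F e v k p * inner ℝ (F p - X₀) (derivFrame F e p k) =
      ∑ k, posCoord F e X₀ k p * fderiv ℝ θ p (e k) := by
  have hp := h.isotropic.self_of_nhds
  set V := F p - X₀ with hV
  set T := ∑ k, posCoord F e X₀ k p • derivFrame F e p k with hT
  have hsum : V = T + N := by
    rw [hN, hp.starProjection_orthogonal h.vol_ne, hT, ← Finset.sum_add_distrib]
    conv_lhs => rw [← sum_frameCoord h.vol_ne V]
    refine Finset.sum_congr rfl fun m _ => ?_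
    rw [← Complex.coe_smul, ← add_smul, posCoord, ← hV]
    congr 1
    rw [mul_comm Complex.I]
    exact (Complex.re_add_im _).symm
  have hNort : ∀ k, inner ℝ N (derivFrame F e p k) = 0 := by
    intro k
    have : N ∈ (Submodule.span ℝ (range (derivFrame F e p)))ᗮ := by
      rw [hN]; exact Submodule.starProjection_apply_mem _ _
    rw [real_inner_comm]
    exact (Submodule.mem_orthogonal _ _).1 this _ (Submodule.subset_span ⟨k, rfl⟩)
  have hin : ∀ k, inner ℝ V (derivFrame F e p k) = inner ℝ T (derivFrame F e p k) := by
    intro k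
    rw [hsum, inner_add_left, hNort, add_zero]
  have hTN : inner ℝ T N = 0 := by
    rw [hT, sum_inner]
    refine Finset.sum_eq_zero fun k _ => ?_
    rw [real_inner_smul_left, real_inner_comm, hNort, mul_zero]
  have hTT : ∀ W : Cn n, inner ℝ W T = ∑ k, posCoord F e X₀ k p * inner ℝ W (derivFrame F e p k) := by
    intro W
    rw [hT, inner_sum]
    simp only [real_inner_smul_right]
  refine ⟨hsum, ?_, ?_, ?_⟩
  · simp only [hin]
    rw [← hTT, real_inner_self_eq_norm_sq, hsum, norm_add_sq_real, hTN]
    ring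
  · rw [hsum, inner_add_right, hTT]
    have : ∀ k, inner ℝ (fderiv ℝ F p v) (derivFrame F e p k) = 0 := fun k => by
      rw [real_inner_comm]; exact h.normal.self_of_nhds k
    simp [this]
  · simp only [hin, h.gradient_eq_sum, hT, sum_inner, real_inner_smul_left, Finset.mul_sum]
    rw [Finset.sum_comm]
    refine Finset.sum_congr rfl fun k _ => Finset.sum_congr rfl fun m _ => ?_
    ring

lemma _root_.hasLineDerivAt_fderiv_of_contDiffAt {h : G → ℝ} (hh : ContDiffAt ℝ 1 h p) (w : G) :
    HasLineDerivAt ℝ h (fderiv ℝ h p w) p w :=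
  (hh.differentiableAt (by norm_num)).hasFDerivAt.hasLineDerivAt w

lemma hasLineDerivAt_rho (hF : ContDiffAt ℝ 1 F p) (X₀ : Cn n) {t₀ : ℝ} (tm : G →L[ℝ] ℝ)
    (hlt : tm p < t₀) (w : G) :
    HasLineDerivAt ℝ (fun q => rho (F q) X₀ (tm q) t₀) (rho (F p) X₀ (tm p) t₀ *
      (tm w * (n / (2 * (t₀ - tm p)) - ‖F p - X₀‖ ^ 2 / (4 * (t₀ - tm p) ^ 2)) -
        inner ℝ (F p - X₀) (fderiv ℝ F p w) / (2 * (t₀ - tm p)))) p w := by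
  have h1 : HasDerivAt (fun s : ℝ => F (p + s • w)) (fderiv ℝ F p w) 0 :=
    (hF.differentiableAt (by norm_num)).hasFDerivAt.hasLineDerivAt w
  have h2 : HasDerivAt (fun s : ℝ => tm (p + s • w)) (tm w) 0 :=
    tm.hasFDerivAt.hasLineDerivAt w
  have := hasDerivAt_rho (X₀ := X₀) (t₀ := t₀) h1 h2 (by simpa using hlt)
  unfold HasLineDerivAt
  simpa using this

/-- Pointwise form of the weighted monotonicity formula: up to the divergence of the flux, localized
by a test function `η`, the time derivative of the weighted area density `η f(θ) ρ w` is `w` times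
the integrand of the formula. -/
lemma deriv_density_eq_divergence_add (h : IsLocalFlowAt F θ e v p) (X₀ : Cn n) {t₀ : ℝ}
    (tm : G →L[ℝ] ℝ) (htv : tm v = 1) (hte : ∀ k, tm (e k) = 0) (hlt : tm p < t₀)
    {f : ℝ → ℝ} (hf : ContDiff ℝ 1 f) {η : G → ℝ} (hη : ContDiffAt ℝ 1 η p) {κ : ℝ}
    (hκ : ∀ k, HasLineDerivAt ℝ (fun q => deriv f (θ q)) (κ * fderiv ℝ θ p (e k)) p (e k))
    {N : Cn n}
    (hN : N = (Submodule.span ℝ (range (derivFrame F e p)))ᗮ.starProjection (F p - X₀)) :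
    fderiv ℝ (fun q => η q * (f (θ q) * rho (F q) X₀ (tm q) t₀ * ‖derivVol F e q‖)) p v =
      ∑ k, lineDeriv ℝ (fun q => η q * flux F θ e v tm f X₀ t₀ k q) p (e k) +
      ‖derivVol F e p‖ * (
        η p * (-(f (θ p) * rho (F p) X₀ (tm p) t₀ *
            ‖fderiv ℝ F p v + (1 / (2 * (t₀ - tm p))) • N‖ ^ 2) -
          κ * ‖fderiv ℝ F p v‖ ^ 2 * rho (F p) X₀ (tm p) t₀) +
        fderiv ℝ η p v * (f (θ p) * rho (F p) X₀ (tm p) t₀) -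
        ∑ k, fderiv ℝ η p (e k) * (rho (F p) X₀ (tm p) t₀ *
          (deriv f (θ p) * velCoord F e v k p +
            f (θ p) * posCoord F e X₀ k p / (2 * (t₀ - tm p))))) := by
  obtain ⟨-, hN2, hN3, hN4⟩ := h.normalPos_facts X₀ hN
  obtain ⟨hw, hθt⟩ := h.evolution
  have hb := h.sum_fderiv_posCoord X₀
  have hτ : 0 < t₀ - tm p := sub_pos.2 hlt
  have hF1 : ContDiffAt ℝ 1 F p := h.contDiffAt.of_le (WithTop.coe_le_coe.2 le_top)
  have hθ1 := h.contDiffAt_angle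
  have hfd : HasDerivAt f (deriv f (θ p)) (θ p) :=
    (hf.differentiable (by norm_num) _).hasDerivAt
  have hρ := hasLineDerivAt_rho (p := p) hF1 X₀ tm hlt
  have hρ1 : ContDiffAt ℝ 1 (fun q => rho (F q) X₀ (tm q) t₀) p :=
    contDiffAt_rho hF1 tm.contDiff.contDiffAt X₀ hlt
  have hfθ1 : ContDiffAt ℝ 1 (fun q => f (θ q)) p := hf.contDiffAt.comp p hθ1
  have hfθ : ∀ w, HasLineDerivAt ℝ (fun q => f (θ q)) (deriv f (θ p) * fderiv ℝ θ p w) p w := by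
    intro w
    have := hfd.comp_hasFDerivAt p (hθ1.differentiableAt (by norm_num)).hasFDerivAt
    exact this.hasLineDerivAt w
  -- the flux coefficients are treated as products of `w aₖ`, `w bₖ` with scalar functions
  have hAw : ∀ k, ContDiffAt ℝ 1 (fun q => ‖derivVol F e q‖ * velCoord F e v k q) p := fun k =>
    h.contDiffAt_norm_vol.mul (h.contDiffAt_velCoord k)
  have hBw : ∀ k, ContDiffAt ℝ 1 (fun q => ‖derivVol F e q‖ * posCoord F e X₀ k q) p := fun k =>
    h.contDiffAt_norm_vol.mul (h.contDiffAt_posCoord X₀ k)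
  set ρ := rho (F p) X₀ (tm p) t₀ with hρdef
  set w := ‖derivVol F e p‖ with hwdef
  set τ := t₀ - tm p with hτdef
  set A' : Fin n → ℝ := fun k => fderiv ℝ (fun q => ‖derivVol F e q‖ * velCoord F e v k q) p (e k)
    with hA'
  set B' : Fin n → ℝ := fun k =>
    fderiv ℝ (fun q => ‖derivVol F e q‖ * posCoord F e X₀ k q) p (e k) with hB'
  have hflux : ∀ k, lineDeriv ℝ (fun q => η q * flux F θ e v tm f X₀ t₀ k q) p (e k) =
      w * (fderiv ℝ η p (e k) * (ρ * (deriv f (θ p) * velCoord F e v k p +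
        f (θ p) * posCoord F e X₀ k p / (2 * τ)))) +
      (η p * ρ * deriv f (θ p)) * A' k + (η p * ρ * f (θ p) / (2 * τ)) * B' k +
      (η p * w * ρ * κ) * (velCoord F e v k p * fderiv ℝ θ p (e k)) +
      (-(η p * w * ρ * deriv f (θ p) / (2 * τ))) *
        (velCoord F e v k p * inner ℝ (F p - X₀) (derivFrame F e p k)) +
      (η p * w * ρ * deriv f (θ p) / (2 * τ)) * (posCoord F e X₀ k p * fderiv ℝ θ p (e k)) +
      (-(η p * w * ρ * f (θ p) / (4 * τ ^ 2))) *
        (posCoord F e X₀ k p * inner ℝ (F p - X₀) (derivFrame F e p k)) := by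
    intro k
    have d1 := (hasLineDerivAt_fderiv_of_contDiffAt hη (e k))
    have dA := (hasLineDerivAt_fderiv_of_contDiffAt (hAw k) (e k))
    have dB := (hasLineDerivAt_fderiv_of_contDiffAt (hBw k) (e k))
    have dρ := hρ (e k)
    have dt : HasLineDerivAt ℝ (fun q => 2 * (t₀ - tm q)) (2 * -(tm (e k))) p (e k) :=
      HasDerivAt.const_mul 2 (HasDerivAt.const_sub t₀ (tm.hasFDerivAt.hasLineDerivAt (e k)))
    have h1 : HasLineDerivAt ℝ (fun q => η q * (‖derivVol F e q‖ * velCoord F e v k q *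
        (rho (F q) X₀ (tm q) t₀ * deriv f (θ q)) +
        ‖derivVol F e q‖ * posCoord F e X₀ k q * (rho (F q) X₀ (tm q) t₀ * f (θ q) /
          (2 * (t₀ - tm q))))) _ p (e k) :=
      HasDerivAt.fun_mul d1 (HasDerivAt.fun_add (HasDerivAt.fun_mul dA (HasDerivAt.fun_mul dρ (hκ k)))
        (HasDerivAt.fun_mul dB (HasDerivAt.fun_div (HasDerivAt.fun_mul dρ (hfθ (e k))) dt
          (by simpa using hτ.ne'))))
    have h2 : (fun q => η q * flux F θ e v tm f X₀ t₀ k q) = fun q => η q *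
        (‖derivVol F e q‖ * velCoord F e v k q * (rho (F q) X₀ (tm q) t₀ * deriv f (θ q)) +
        ‖derivVol F e q‖ * posCoord F e X₀ k q * (rho (F q) X₀ (tm q) t₀ * f (θ q) /
          (2 * (t₀ - tm q)))) := by
      funext q
      rw [flux]; ring
    rw [h2, h1.lineDeriv]
    simp only [zero_smul, add_zero, hte]
    simp only [← hρdef, ← hwdef, ← hτdef, hA', hB', derivFrame]
    field_simp
    ring
  have hlhs : fderiv ℝ (fun q => η q * (f (θ q) * rho (F q) X₀ (tm q) t₀ *
      ‖derivVol F e q‖)) p v = fderiv ℝ η p v * (f (θ p) * ρ * w) +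
      η p * (deriv f (θ p) * ρ * (w * fderiv ℝ θ p v) +
        f (θ p) * w * (ρ * ((n / (2 * τ) - ‖F p - X₀‖ ^ 2 / (4 * τ ^ 2)) -
          inner ℝ (fderiv ℝ F p v) (F p - X₀) / (2 * τ))) -
        f (θ p) * ρ * (‖fderiv ℝ F p v‖ ^ 2 * w)) := by
    have hall : ContDiffAt ℝ 1 (fun q => η q * (f (θ q) * rho (F q) X₀ (tm q) t₀ *
      ‖derivVol F e q‖)) p := hη.mul ((hfθ1.mul hρ1).mul h.contDiffAt_norm_vol)
    have d1 := hasLineDerivAt_fderiv_of_contDiffAt hη v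
    have dw := hasLineDerivAt_fderiv_of_contDiffAt h.contDiffAt_norm_vol v
    have h1 : HasLineDerivAt ℝ (fun q => η q * (f (θ q) * rho (F q) X₀ (tm q) t₀ *
      ‖derivVol F e q‖)) _ p v :=
      HasDerivAt.fun_mul d1 (HasDerivAt.fun_mul (HasDerivAt.fun_mul (hfθ v) (hρ v)) dw)
    have h2 : HasDerivAt _ _ _ := h1
    have h3 : HasDerivAt _ _ _ := hasLineDerivAt_fderiv_of_contDiffAt hall v
    rw [h3.unique h2]
    simp only [zero_smul, add_zero, htv, hw, ← hρdef, ← hwdef]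
    rw [real_inner_comm (F p - X₀)]
    ring
  have hnorm : ‖fderiv ℝ F p v + (1 / (2 * τ)) • N‖ ^ 2 = ‖fderiv ℝ F p v‖ ^ 2 +
      inner ℝ (fderiv ℝ F p v) N / τ + ‖N‖ ^ 2 / (4 * τ ^ 2) := by
    rw [norm_add_sq_real, real_inner_smul_right, norm_smul, mul_pow, Real.norm_eq_abs, sq_abs]
    field_simp
    ring
  simp only [hflux, Finset.sum_add_distrib, ← Finset.mul_sum]
  rw [hlhs, hnorm, h.sum_velCoord_gradient, hN2, hN4, ← hθt, hb, hN3]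
  field_simp
  ring

end IsLocalFlowAt

/-! ### The local integrated formula -/

section LipschitzProducts

variable {E : Type*} [NormedAddCommGroup E]

lemma exists_lipschitzOnWith_nhds_mul {g h : E → ℝ} {u : E}
    (hg : ∃ C, ∃ t ∈ 𝓝 u, LipschitzOnWith C g t) (hh : ∃ C, ∃ t ∈ 𝓝 u, LipschitzOnWith C h t) :
    ∃ C, ∃ t ∈ 𝓝 u, LipschitzOnWith C (fun v => g v * h v) t := by
  obtain ⟨C, t, ht, hC⟩ := hg
  obtain ⟨C', t', ht', hC'⟩ := hh
  have hpair : LipschitzOnWith (max C C') (fun v => (g v, h v)) (t ∩ t') :=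
    (hC.mono inter_subset_left).prodMk (hC'.mono inter_subset_right)
  obtain ⟨B, s, hs, hB⟩ := (contDiff_mul (𝕜 := ℝ) (𝔸 := ℝ) (n := 1)).contDiffAt
    (x := (g u, h u)) |>.exists_lipschitzOnWith
  have hcont : ContinuousAt (fun v => (g v, h v)) u :=
    (hpair.continuousOn).continuousAt (inter_mem ht ht')
  refine ⟨B * max C C', t ∩ t' ∩ (fun v => (g v, h v)) ⁻¹' s,
    inter_mem (inter_mem ht ht') (hcont hs), ?_⟩
  exact hB.comp (hpair.mono inter_subset_left) fun v hv => hv.2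

lemma exists_lipschitzOnWith_nhds_add {g h : E → ℝ} {u : E}
    (hg : ∃ C, ∃ t ∈ 𝓝 u, LipschitzOnWith C g t) (hh : ∃ C, ∃ t ∈ 𝓝 u, LipschitzOnWith C h t) :
    ∃ C, ∃ t ∈ 𝓝 u, LipschitzOnWith C (fun v => g v + h v) t := by
  obtain ⟨C, t, ht, hC⟩ := hg
  obtain ⟨C', t', ht', hC'⟩ := hh
  exact ⟨C + C', t ∩ t', inter_mem ht ht',
    (hC.mono inter_subset_left).add (hC'.mono inter_subset_right)⟩

variable [NormedSpace ℝ E]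

lemma exists_lipschitzOnWith_nhds_deriv_comp {f : ℝ → ℝ} (hf : ContDiff ℝ 1 f)
    (hf'' : PiecewiseContinuousSecondDeriv f) {θ : E → ℝ} {u : E} (hθ : ContDiffAt ℝ 1 θ u) :
    ∃ C, ∃ t ∈ 𝓝 u, LipschitzOnWith C (fun v => deriv f (θ v)) t := by
  obtain ⟨C, t, ht, hC⟩ := hθ.exists_lipschitzOnWith
  obtain ⟨C', t', ht', hC'⟩ := exists_lipschitzOnWith_deriv_nhds hf hf'' (θ u)
  exact ⟨C' * C, t ∩ θ ⁻¹' t', inter_mem ht (hθ.continuousAt ht'),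
    hC'.comp (hC.mono inter_subset_left) fun v hv => hv.2⟩

end LipschitzProducts

section LocalFormula

variable {n : ℕ}

/-- The `k`-th coordinate direction of `ℝⁿ`, as a direction in the spacetime `ℝ × ℝⁿ`. -/
def spaceDir (k : Fin n) : ℝ × EuclideanSpace ℝ (Fin n) := (0, EuclideanSpace.single k 1)

/-- The time direction of the spacetime `ℝ × ℝⁿ`. -/
def timeDir : ℝ × EuclideanSpace ℝ (Fin n) := (1, 0)

/-- The integrand of the localized monotonicity formula in coordinates, for the test function
`η`. -/
def localIntegrand (F : ℝ × EuclideanSpace ℝ (Fin n) → Cn n)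
    (θ : ℝ × EuclideanSpace ℝ (Fin n) → ℝ) (f : ℝ → ℝ) (X₀ : Cn n) (t₀ : ℝ)
    (η : ℝ × EuclideanSpace ℝ (Fin n) → ℝ) (p : ℝ × EuclideanSpace ℝ (Fin n)) : ℝ :=
  η p * (-(f (θ p) * rho (F p) X₀ p.1 t₀ *
      ‖fderiv ℝ F p timeDir + (1 / (2 * (t₀ - p.1))) •
        (Submodule.span ℝ (range (derivFrame F spaceDir p)))ᗮ.starProjection (F p - X₀)‖ ^ 2) -
    deriv (deriv f) (θ p) * ‖fderiv ℝ F p timeDir‖ ^ 2 * rho (F p) X₀ p.1 t₀) +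
  fderiv ℝ η p timeDir * (f (θ p) * rho (F p) X₀ p.1 t₀) -
  ∑ k, fderiv ℝ η p (spaceDir k) * (rho (F p) X₀ p.1 t₀ *
    (deriv f (θ p) * velCoord F spaceDir timeDir k p +
      f (θ p) * posCoord F spaceDir X₀ k p / (2 * (t₀ - p.1))))

lemma integrable_of_continuousOn_of_eq_zero {E : Type*} [NormedAddCommGroup E] [MeasurableSpace E]
    [BorelSpace E] {μ : Measure E} [IsFiniteMeasureOnCompacts μ] {h : E → ℝ} {K : Set E}
    (hK : IsCompact K) (hc : ContinuousOn h K) (h0 : ∀ u ∉ K, h u = 0) : Integrable h μ := by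
  rw [← integrableOn_iff_integrable_of_support_subset (s := K)]
  · exact hc.integrableOn_compact hK
  · intro u hu
    by_contra hn
    exact hu (h0 u hn)

/-- The localized monotonicity formula in coordinates. The second derivative of `f` only enters
after the integration by parts, where Lipschitz regularity of `f'` is enough. -/
lemma hasDerivAt_integral_local {F : ℝ × EuclideanSpace ℝ (Fin n) → Cn n}
    {θ : ℝ × EuclideanSpace ℝ (Fin n) → ℝ} {a b : ℝ} {U K : Set (EuclideanSpace ℝ (Fin n))}
    (hU : IsOpen U) (hK : IsCompact K) (hKU : K ⊆ U)
    (hflow : ∀ p ∈ Ioo a b ×ˢ U, IsLocalFlowAt F θ spaceDir timeDir p)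
    {f : ℝ → ℝ} (hf : ContDiff ℝ 1 f) (hf'' : PiecewiseContinuousSecondDeriv f)
    (X₀ : Cn n) {t₀ : ℝ} (hb : b ≤ t₀) {η : ℝ × EuclideanSpace ℝ (Fin n) → ℝ}
    (hη : ∀ p ∈ Ioo a b ×ˢ U, ContDiffAt ℝ 1 η p)
    (hη0 : ∀ s ∈ Ioo a b, ∀ u ∉ K, η (s, u) = 0) {t : ℝ} (ht : t ∈ Ioo a b) :
    IntegrableOn (fun u => ‖derivVol F spaceDir (t, u)‖ *
      localIntegrand F θ f X₀ t₀ η (t, u)) U ∧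
    HasDerivAt (fun s => ∫ u in U, η (s, u) * (f (θ (s, u)) * rho (F (s, u)) X₀ s t₀ *
        ‖derivVol F spaceDir (s, u)‖))
      (∫ u in U, ‖derivVol F spaceDir (t, u)‖ * localIntegrand F θ f X₀ t₀ η (t, u)) t := by
  set Φ : ℝ × EuclideanSpace ℝ (Fin n) → ℝ := fun q =>
    η q * (f (θ q) * rho (F q) X₀ q.1 t₀ * ‖derivVol F spaceDir q‖) with hΦ
  have hW : IsOpen (Ioo a b ×ˢ U) := isOpen_Ioo.prod hU
  have hF1 : ∀ p ∈ Ioo a b ×ˢ U, ContDiffAt ℝ 1 F p := fun p hp =>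
    (hflow p hp).contDiffAt.of_le (WithTop.coe_le_coe.2 le_top)
  have hρ1 : ∀ p ∈ Ioo a b ×ˢ U, ContDiffAt ℝ 1 (fun q => rho (F q) X₀ q.1 t₀) p := fun p hp =>
    contDiffAt_rho (hF1 p hp) contDiffAt_fst X₀ (hp.1.2.trans_le hb)
  have hΦ1 : ∀ p ∈ Ioo a b ×ˢ U, ContDiffAt ℝ 1 Φ p := fun p hp =>
    (hη p hp).mul (((hf.contDiffAt.comp p (hflow p hp).contDiffAt_angle).mul (hρ1 p hp)).mul
      (hflow p hp).contDiffAt_norm_vol)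
  have hΦ0 : ∀ s ∈ Ioo a b, ∀ u ∉ K, Φ (s, u) = 0 := fun s hs u hu => by
    simp [hΦ, hη0 s hs u hu]
  have hΦ'0 : ∀ s ∈ Ioo a b, ∀ u ∉ K, fderiv ℝ Φ (s, u) = 0 := fun s hs u hu => by
    have : Φ =ᶠ[𝓝 (s, u)] fun _ => 0 := by
      filter_upwards [(isOpen_Ioo.prod hK.isClosed.isOpen_compl).mem_nhds
        (show (s, u) ∈ Ioo a b ×ˢ Kᶜ from ⟨hs, hu⟩)] with q hq
      exact hΦ0 q.1 hq.1 q.2 hq.2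
    rw [this.fderiv_eq]; simp
  have hΦ'c : ContinuousOn (fun q => fderiv ℝ Φ q timeDir) (Ioo a b ×ˢ U) := fun p hp =>
    ((hΦ1 p hp).continuousAt_fderiv (by norm_num)).clm_apply continuousAt_const
      |>.continuousWithinAt
  have hslice : ∀ s : ℝ, Continuous fun u : EuclideanSpace ℝ (Fin n) => (s, u) :=
    fun s => by fun_prop
  have hΦ'i : Integrable (fun u => fderiv ℝ Φ (t, u) timeDir) := by
    refine integrable_of_continuousOn_of_eq_zero hK ?_ fun u hu => by rw [hΦ'0 t ht u hu]; simp
    exact hΦ'c.comp (hslice t).continuousOn fun u hu => ⟨ht, hKU hu⟩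
  -- differentiation under the integral sign
  have hderiv : HasDerivAt (fun s => ∫ u in U, Φ (s, u))
      (∫ u in U, fderiv ℝ Φ (t, u) timeDir) t := by
    obtain ⟨δ, hδ, hδs⟩ := Metric.isOpen_iff.1 (isOpen_Ioo (a := a) (b := b)) t ht
    have hsub : Icc (t - δ / 2) (t + δ / 2) ⊆ Ioo a b := fun s hs => hδs <| by
      rw [Metric.mem_ball, Real.dist_eq, abs_lt]
      constructor <;> linarith [hs.1, hs.2]
    obtain ⟨M, hM⟩ := (isCompact_Icc.prod hK).exists_bound_of_continuousOn
      (hΦ'c.mono (prod_mono hsub hKU))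
    refine (hasDerivAt_integral_of_dominated_loc_of_deriv_le
      (s := Ioo (t - δ / 2) (t + δ / 2)) (bound := K.indicator fun _ => M)
      (F := fun s u => Φ (s, u)) (F' := fun s u => fderiv ℝ Φ (s, u) timeDir)
      (Ioo_mem_nhds (by linarith) (by linarith)) ?_ ?_ ?_ ?_ ?_ ?_).2
    · filter_upwards [Ioo_mem_nhds ht.1 ht.2] with s hs
      refine ContinuousOn.aestronglyMeasurable ?_ hU.measurableSet
      exact fun u hu => (((hΦ1 (s, u) ⟨hs, hu⟩).continuousAt).comp
        (hslice s).continuousAt).continuousWithinAt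
    · refine Integrable.integrableOn (integrable_of_continuousOn_of_eq_zero hK ?_ (hΦ0 t ht))
      exact fun u hu => (((hΦ1 (t, u) ⟨ht, hKU hu⟩).continuousAt).comp
        (hslice t).continuousAt).continuousWithinAt
    · exact hΦ'i.aestronglyMeasurable.restrict
    · refine Eventually.of_forall fun u s hs => ?_
      have hs' : s ∈ Icc (t - δ / 2) (t + δ / 2) := Ioo_subset_Icc_self hs
      by_cases hu : u ∈ K
      · rw [indicator_of_mem hu]
        exact hM (s, u) ⟨hs', hu⟩
      · rw [indicator_of_notMem hu, hΦ'0 s (hsub hs') u hu]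
        simp
    · exact ((integrable_indicator_iff hK.measurableSet).2
        (integrableOn_const hK.measure_lt_top.ne)).integrableOn
    · refine (ae_restrict_mem hU.measurableSet).mono fun u hu s hs => ?_
      have hs' : s ∈ Ioo a b := hsub (Ioo_subset_Icc_self hs)
      have h1 := ((hΦ1 (s, u) ⟨hs', hu⟩).differentiableAt (by norm_num)).hasFDerivAt
      have h2 : HasDerivAt (fun r : ℝ => (r, u)) (1, 0) s :=
        (hasDerivAt_id s).prodMk (hasDerivAt_const s u)
      exact h1.comp_hasDerivAt s h2
  -- integration by parts
  set hk : Fin n → EuclideanSpace ℝ (Fin n) → ℝ := fun k u =>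
    η (t, u) * flux F θ spaceDir timeDir (ContinuousLinearMap.fst ℝ ℝ _) f X₀ t₀ k (t, u) with hhk
  have hk0 : ∀ k, ∀ u ∉ K, hk k u = 0 := fun k u hu => by simp [hhk, hη0 t ht u hu]
  have hksl : ∀ u ∈ U, ∀ {g : ℝ × EuclideanSpace ℝ (Fin n) → ℝ}, ContDiffAt ℝ 1 g (t, u) →
      ContDiffAt ℝ 1 (fun u => g (t, u)) u := fun u hu g hg =>
    hg.comp u (contDiffAt_const.prodMk contDiffAt_id)
  have hkl : ∀ k, LocallyLipschitz (hk k) := by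
    intro k u
    by_cases hu : u ∈ K
    · have hp : (t, u) ∈ Ioo a b ×ˢ U := ⟨ht, hKU hu⟩
      have hfl := hflow _ hp
      have hτ : t₀ - t ≠ 0 := (sub_pos.2 (ht.2.trans_le hb)).ne'
      have c1 := (hksl u (hKU hu) ((hη _ hp).mul (hfl.contDiffAt_norm_vol.mul ((hρ1 _ hp).mul
        (hfl.contDiffAt_velCoord k))))).exists_lipschitzOnWith
      have c2 := (hksl u (hKU hu) ((hη _ hp).mul (hfl.contDiffAt_norm_vol.mul ((hρ1 _ hp).mul
        ((((hf.contDiffAt.comp _ hfl.contDiffAt_angle)).mul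
          (hfl.contDiffAt_posCoord X₀ k)).mul
            (contDiffAt_const (c := (2 * (t₀ - t))⁻¹))))))).exists_lipschitzOnWith
      have c3 := exists_lipschitzOnWith_nhds_deriv_comp hf hf''
        (hksl u (hKU hu) hfl.contDiffAt_angle)
      obtain ⟨C, s, hs, hC⟩ := exists_lipschitzOnWith_nhds_add
        (exists_lipschitzOnWith_nhds_mul c1 c3) c2
      refine ⟨C, s, hs, (?_ : _ = hk k) ▸ hC⟩
      funext u'
      simp only [hhk, flux, Function.comp_apply, ContinuousLinearMap.coe_fst']
      ring
    · refine ⟨0, Kᶜ, hK.isClosed.isOpen_compl.mem_nhds hu, ?_⟩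
      intro x hx y hy
      rw [hk0 k x hx, hk0 k y hy]
      simp
  have hkc : ∀ k, HasCompactSupport (hk k) := fun k => HasCompactSupport.intro hK (hk0 k)
  have hibp := fun k => integral_lineDeriv_eq_zero volume (hkl k) (hkc k) (EuclideanSpace.single k 1)
  have hline0 : ∀ k, ∀ u ∉ U, lineDeriv ℝ (hk k) u (EuclideanSpace.single k 1) = 0 := by
    intro k u hu
    have : hk k =ᶠ[𝓝 u] fun _ => 0 := by
      filter_upwards [hK.isClosed.isOpen_compl.mem_nhds (fun h => hu (hKU h))] with u' hu'
      exact hk0 k u' hu'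
    rw [this.lineDeriv_eq]
    simp [lineDeriv]
  have hibpU : ∀ k, ∫ u in U, lineDeriv ℝ (hk k) u (EuclideanSpace.single k 1) = 0 := fun k => by
    rw [setIntegral_eq_integral_of_forall_compl_eq_zero fun u hu => hline0 k u hu, (hibp k).2]
  have hpoint : ∀ᵐ u ∂(volume.restrict U), ‖derivVol F spaceDir (t, u)‖ *
      localIntegrand F θ f X₀ t₀ η (t, u) = fderiv ℝ Φ (t, u) timeDir -
        ∑ k, lineDeriv ℝ (hk k) u (EuclideanSpace.single k 1) := by
    have hθU : ContDiffOn ℝ 1 (fun u => θ (t, u)) U := fun u hu =>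
      (hksl u hu (hflow (t, u) ⟨ht, hu⟩).contDiffAt_angle).contDiffWithinAt
    filter_upwards [ae_restrict_of_ae (ae_differentiableAt_deriv_or_fderiv_eq_zero volume hU hθU hf''),
      ae_restrict_mem hU.measurableSet] with u hu huU
    have hp : (t, u) ∈ Ioo a b ×ˢ U := ⟨ht, huU⟩
    have hfl := hflow _ hp
    have hθd := ((hksl u huU hfl.contDiffAt_angle).differentiableAt (by norm_num)).hasFDerivAt
    have hchain := hasFDerivAt_deriv_comp hf hf'' hθd ((hu huU).imp And.left id)
    have hsl : ∀ w, fderiv ℝ (fun u => θ (t, u)) u w = fderiv ℝ θ (t, u) (0, w) := by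
      intro w
      have h1 : HasFDerivAt (fun u => θ (t, u)) _ u :=
        (hfl.contDiffAt_angle.differentiableAt (by norm_num)).hasFDerivAt.comp u
          ((hasFDerivAt_const t u).prodMk (hasFDerivAt_id u))
      rw [h1.fderiv]; simp
    have hκ : ∀ k, HasLineDerivAt ℝ (fun q => deriv f (θ q))
        (deriv (deriv f) (θ (t, u)) * fderiv ℝ θ (t, u) (spaceDir k)) (t, u) (spaceDir k) := by
      intro k
      have h1 := hchain.hasLineDerivAt (EuclideanSpace.single k 1)
      simp only [smul_apply, smul_eq_mul, hsl] at h1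
      unfold HasLineDerivAt at h1 ⊢
      simpa [spaceDir] using h1
    have hmain := hfl.deriv_density_eq_divergence_add X₀ (t₀ := t₀)
      (ContinuousLinearMap.fst ℝ ℝ _) (by simp [timeDir]) (by simp [spaceDir])
      (by simpa using ht.2.trans_le hb) hf (hη _ hp) hκ rfl
    have hld : ∀ k, lineDeriv ℝ (fun q => η q * flux F θ spaceDir timeDir
        (ContinuousLinearMap.fst ℝ ℝ _) f X₀ t₀ k q) (t, u) (spaceDir k) =
        lineDeriv ℝ (hk k) u (EuclideanSpace.single k 1) := by
      intro k
      simp [lineDeriv, hhk, spaceDir]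
    simp only [hld] at hmain
    exact eq_sub_of_add_eq' hmain.symm
  have hsumi : Integrable (fun u => ∑ k, lineDeriv ℝ (hk k) u (EuclideanSpace.single k 1))
      (volume.restrict U) := integrable_finsetSum _ fun k _ => (hibp k).1.integrableOn
  constructor
  · exact (hΦ'i.integrableOn.sub hsumi).congr (hpoint.mono fun u hu => hu.symm)
  · rw [integral_congr_ae hpoint, integral_sub hΦ'i.integrableOn hsumi,
      integral_finsetSum _ fun k _ => (hibp k).1.integrableOn]
    simp only [hibpU, Finset.sum_const_zero, sub_zero]
    exact hderiv

end LocalFormula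

/-! ### The area measure in charts -/

section Gram

variable {n : ℕ}

/-- The area density transforms with the Jacobian under a change of coordinates. -/
lemma sqrt_det_gram_comp (L : EuclideanSpace ℝ (Fin n) →L[ℝ] Cn n)
    (A : EuclideanSpace ℝ (Fin n) →L[ℝ] EuclideanSpace ℝ (Fin n)) :
    Real.sqrt (Matrix.gram ℝ fun i => L (A (EuclideanSpace.single i 1))).det =
      |A.det| * Real.sqrt (Matrix.gram ℝ fun i => L (EuclideanSpace.single i 1)).det := by
  set b := (EuclideanSpace.basisFun (Fin n) ℝ).toBasis
  set M := LinearMap.toMatrix b b A.toLinearMap with hM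
  have hMij : ∀ i j, M j i = A (EuclideanSpace.single i 1) j := fun i j => by
    simp [hM, LinearMap.toMatrix_apply, b]
  have hsum : ∀ i, A (EuclideanSpace.single i 1) =
      ∑ j, M j i • (EuclideanSpace.single j 1 : EuclideanSpace ℝ (Fin n)) := fun i => by
    simp only [hMij]
    have := (EuclideanSpace.basisFun (Fin n) ℝ).sum_repr (A (EuclideanSpace.single i 1))
    simpa using this.symm
  have h1 : (Matrix.gram ℝ fun i => L (A (EuclideanSpace.single i 1))) =
      M.transpose * (Matrix.gram ℝ fun i => L (EuclideanSpace.single i 1)) * M := by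
    ext i k
    rw [Matrix.gram_apply, hsum i, hsum k, map_sum, map_sum, Matrix.mul_apply, inner_sum]
    refine Finset.sum_congr rfl fun l _ => ?_
    rw [sum_inner, Matrix.mul_apply, Finset.sum_mul]
    refine Finset.sum_congr rfl fun j _ => ?_
    rw [map_smul, map_smul, inner_smul_left, inner_smul_right, Matrix.gram_apply,
      Matrix.transpose_apply]
    simp only [conj_trivial]
    ring
  have hdet : M.det = A.det := LinearMap.det_toMatrix b A.toLinearMap
  rw [h1, Matrix.det_mul, Matrix.det_mul, Matrix.det_transpose, hdet, mul_right_comm,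
    Real.sqrt_mul (mul_self_nonneg _), Real.sqrt_mul_self_eq_abs]

end Gram

section AreaMeasure

variable {n : ℕ} {S : Type*} [TopologicalSpace S] [ChartedSpace (EuclideanSpace ℝ (Fin n)) S]

/-- The area density `√(det g)` in the chart `e`. -/
def areaDensity (F : S → Cn n) (e : OpenPartialHomeomorph S (EuclideanSpace ℝ (Fin n)))
    (u : EuclideanSpace ℝ (Fin n)) : ℝ :=
  Real.sqrt (inducedMetric F e u).det

/-- The measure `√(det g) du` carried by the chart `e`, as a measure on `S`. -/
def chartMeasure [MeasurableSpace S] (F : S → Cn n)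
    (e : OpenPartialHomeomorph S (EuclideanSpace ℝ (Fin n))) : Measure S :=
  ((volume.restrict e.target).withDensity fun u => ENNReal.ofReal (areaDensity F e u)).map e.symm

variable {F : S → Cn n} {e e' : OpenPartialHomeomorph S (EuclideanSpace ℝ (Fin n))}

section Smooth

variable [IsManifold (𝓡 n) ∞ S]

lemma contDiffOn_comp_chart_symm (hF : ContMDiff (𝓡 n) 𝓘(ℝ, Cn n) ∞ F)
    (he : e ∈ atlas (EuclideanSpace ℝ (Fin n)) S) : ContDiffOn ℝ ∞ (F ∘ e.symm) e.target := by
  rw [← contMDiffOn_iff_contDiffOn]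
  exact hF.comp_contMDiffOn (contMDiffOn_symm_of_mem_maximalAtlas
    (IsManifold.subset_maximalAtlas he))

lemma contDiffOn_transition (he : e ∈ atlas (EuclideanSpace ℝ (Fin n)) S)
    (he' : e' ∈ atlas (EuclideanSpace ℝ (Fin n)) S) :
    ContDiffOn ℝ ∞ (e' ∘ e.symm) (e.target ∩ e.symm ⁻¹' e'.source) := by
  rw [← contMDiffOn_iff_contDiffOn]
  exact (contMDiffOn_of_mem_maximalAtlas (IsManifold.subset_maximalAtlas he')).comp
    ((contMDiffOn_symm_of_mem_maximalAtlas (I := 𝓡 n) (n := ∞)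
      (IsManifold.subset_maximalAtlas he)).mono inter_subset_left) fun u hu => hu.2

lemma continuousOn_areaDensity (hF : ContMDiff (𝓡 n) 𝓘(ℝ, Cn n) ∞ F)
    (he : e ∈ atlas (EuclideanSpace ℝ (Fin n)) S) : ContinuousOn (areaDensity F e) e.target := by
  have h1 : ContinuousOn (fderiv ℝ (F ∘ e.symm)) e.target :=
    (contDiffOn_comp_chart_symm hF he).continuousOn_fderiv_of_isOpen e.open_target
      (WithTop.coe_le_coe.2 le_top)
  refine Real.continuous_sqrt.comp_continuousOn ?_
  rw [continuousOn_iff_continuous_domRestrict] at h1 ⊢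
  refine Continuous.matrix_det ?_
  refine continuous_matrix fun i j => ?_
  exact (h1.clm_apply continuous_const).inner (h1.clm_apply continuous_const)

lemma areaDensity_transition (hF : ContMDiff (𝓡 n) 𝓘(ℝ, Cn n) ∞ F)
    (he : e ∈ atlas (EuclideanSpace ℝ (Fin n)) S) (he' : e' ∈ atlas (EuclideanSpace ℝ (Fin n)) S)
    {u : EuclideanSpace ℝ (Fin n)} (hu : u ∈ e.target ∩ e.symm ⁻¹' e'.source) :
    areaDensity F e u = |(fderiv ℝ (e' ∘ e.symm) u).det| * areaDensity F e' (e' (e.symm u)) := by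
  have hopen : IsOpen (e.target ∩ e.symm ⁻¹' e'.source) :=
    e.isOpen_inter_preimage_symm e'.open_source
  have h1 : HasFDerivAt (e' ∘ e.symm) (fderiv ℝ (e' ∘ e.symm) u) u :=
    (((contDiffOn_transition he he').contDiffAt (hopen.mem_nhds hu)).differentiableAt
      (by simp)).hasFDerivAt
  have h2 : HasFDerivAt (F ∘ e'.symm) (fderiv ℝ (F ∘ e'.symm) (e' (e.symm u))) (e' (e.symm u)) :=
    (((contDiffOn_comp_chart_symm hF he').contDiffAt (e'.open_target.mem_nhds
      (e'.map_source hu.2))).differentiableAt (by simp)).hasFDerivAt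
  have h3 : F ∘ e.symm =ᶠ[𝓝 u] (F ∘ e'.symm) ∘ (e' ∘ e.symm) := by
    filter_upwards [hopen.mem_nhds hu] with v hv
    simp [e'.left_inv hv.2]
  have h4 : fderiv ℝ (F ∘ e.symm) u = _ := h3.fderiv_eq.trans (h2.comp u h1).fderiv
  have h5 := sqrt_det_gram_comp (fderiv ℝ (F ∘ e'.symm) (e' (e.symm u)))
    (fderiv ℝ (e' ∘ e.symm) u)
  rw [areaDensity, areaDensity, inducedMetric, inducedMetric]
  have h6 : coordTangent F e u = fun i => fderiv ℝ (F ∘ e'.symm) (e' (e.symm u))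
      (fderiv ℝ (e' ∘ e.symm) u (EuclideanSpace.single i 1)) := by
    funext i
    rw [coordTangent, h4]
    rfl
  rw [h6]
  exact h5

end Smooth

variable [MeasurableSpace S] [BorelSpace S]

omit [ChartedSpace (EuclideanSpace ℝ (Fin n)) S] in
lemma measurableSet_target_inter_preimage
    (e : OpenPartialHomeomorph S (EuclideanSpace ℝ (Fin n))) {B : Set S} (hB : MeasurableSet B) :
    MeasurableSet (e.target ∩ e.symm ⁻¹' B) := by
  have h1 := (continuousOn_iff_continuous_domRestrict.1 e.continuousOn_symm).measurable hB
  have h2 := e.open_target.measurableSet.subtype_image h1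
  convert h2 using 1
  ext u
  simp [and_comm]

omit [ChartedSpace (EuclideanSpace ℝ (Fin n)) S] in
lemma aemeasurable_chart_symm (e : OpenPartialHomeomorph S (EuclideanSpace ℝ (Fin n)))
    (d : EuclideanSpace ℝ (Fin n) → ENNReal) :
    AEMeasurable e.symm ((volume.restrict e.target).withDensity d) :=
  (e.continuousOn_symm.aemeasurable e.open_target.measurableSet).mono_ac
    (withDensity_absolutelyContinuous _ _)

omit [ChartedSpace (EuclideanSpace ℝ (Fin n)) S] in
lemma chartMeasure_apply (F : S → Cn n) (e : OpenPartialHomeomorph S (EuclideanSpace ℝ (Fin n)))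
    {B : Set S} (hB : MeasurableSet B) :
    chartMeasure F e B =
      ∫⁻ u in e.target ∩ e.symm ⁻¹' B, ENNReal.ofReal (areaDensity F e u) := by
  rw [chartMeasure, Measure.map_apply_of_aemeasurable (aemeasurable_chart_symm e _) hB,
    withDensity_apply', Measure.restrict_restrict' e.open_target.measurableSet, inter_comm]

omit [ChartedSpace (EuclideanSpace ℝ (Fin n)) S] in
lemma chartMeasure_restrict_source (F : S → Cn n)
    (e : OpenPartialHomeomorph S (EuclideanSpace ℝ (Fin n))) :
    (chartMeasure F e).restrict e.source = chartMeasure F e := by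
  ext B hB
  rw [Measure.restrict_apply hB, chartMeasure_apply F e hB,
    chartMeasure_apply F e (hB.inter e.open_source.measurableSet)]
  congr 2
  ext u
  simp only [mem_inter_iff, mem_preimage]
  exact ⟨fun h => ⟨h.1, h.2.1⟩, fun h => ⟨h.1, h.2, e.map_target h.1⟩⟩

variable [IsManifold (𝓡 n) ∞ S]

/-- The area measures of two charts agree on the overlap, by the change of variables formula. -/
lemma chartMeasure_inter (hF : ContMDiff (𝓡 n) 𝓘(ℝ, Cn n) ∞ F)
    (he : e ∈ atlas (EuclideanSpace ℝ (Fin n)) S) (he' : e' ∈ atlas (EuclideanSpace ℝ (Fin n)) S)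
    {B : Set S} (hB : MeasurableSet B) :
    chartMeasure F e (B ∩ e'.source) = chartMeasure F e' (B ∩ e.source) := by
  rw [chartMeasure_apply F e (hB.inter e'.open_source.measurableSet),
    chartMeasure_apply F e' (hB.inter e.open_source.measurableSet)]
  set A := e.target ∩ e.symm ⁻¹' (B ∩ e'.source) with hA
  have hAm : MeasurableSet A :=
    measurableSet_target_inter_preimage e (hB.inter e'.open_source.measurableSet)
  have hsub : A ⊆ e.target ∩ e.symm ⁻¹' e'.source := fun u hu => ⟨hu.1, hu.2.2⟩
  have himg : (e' ∘ e.symm) '' A = e'.target ∩ e'.symm ⁻¹' (B ∩ e.source) := by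
    ext v
    constructor
    · rintro ⟨u, ⟨hu1, hu2, hu3⟩, rfl⟩
      refine ⟨e'.map_source hu3, ?_, ?_⟩ <;> simp only [Function.comp_apply, e'.left_inv hu3]
      · exact hu2
      · exact e.map_target hu1
    · rintro ⟨hv1, hv2, hv3⟩
      refine ⟨e (e'.symm v), ⟨e.map_source hv3, ?_, ?_⟩, ?_⟩
      · simpa only [e.left_inv hv3] using hv2
      · simpa only [e.left_inv hv3, mem_preimage] using e'.map_target hv1
      · simp only [Function.comp_apply, e.left_inv hv3, e'.right_inv hv1]
  have hopen : IsOpen (e.target ∩ e.symm ⁻¹' e'.source) :=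
    e.isOpen_inter_preimage_symm e'.open_source
  have hinj : InjOn (e' ∘ e.symm) A := by
    intro u hu v hv huv
    have h1 := e'.injOn hu.2.2 hv.2.2 huv
    exact e.symm.injOn hu.1 hv.1 h1
  have hcv := lintegral_image_eq_lintegral_abs_det_fderiv_mul volume hAm
    (f := e' ∘ e.symm) (f' := fderiv ℝ (e' ∘ e.symm)) (fun u hu =>
      ((((contDiffOn_transition he he').contDiffAt (hopen.mem_nhds (hsub hu))).differentiableAt
        (by simp)).hasFDerivAt).hasFDerivWithinAt) hinj
    (fun v => ENNReal.ofReal (areaDensity F e' v))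
  rw [← himg, hcv]
  refine setLIntegral_congr_fun hAm fun u hu => ?_
  rw [areaDensity_transition hF he he' (hsub hu), ENNReal.ofReal_mul (abs_nonneg _)]
  rfl

/-- On the domain of a chart, the area measure is the measure `√(det g) du`. -/
lemma areaMeasure_restrict_source [SecondCountableTopology S]
    (hF : ContMDiff (𝓡 n) 𝓘(ℝ, Cn n) ∞ F) (he : e ∈ atlas (EuclideanSpace ℝ (Fin n)) S) :
    (areaMeasure F).restrict e.source = chartMeasure F e := by
  have hle : ∀ e' ∈ atlas (EuclideanSpace ℝ (Fin n)) S, chartMeasure F e' ≤ areaMeasure F :=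
    fun e' he' => le_iSup₂ (f := fun e' (_ : e' ∈ atlas (EuclideanSpace ℝ (Fin n)) S) =>
      chartMeasure F e') e' he'
  rcases isEmpty_or_nonempty S with hS | hS
  · ext B hB
    rw [eq_empty_of_isEmpty B]
    simp
  -- the measures of the charts are glued along a countable partition subordinate to chart domains;
  -- the glued measure `ν` restricts to the measure of every chart and is therefore the supremum
  obtain ⟨s, hsc, hs⟩ := TopologicalSpace.countable_cover_nhds
    (fun x : S => chart_source_mem_nhds (EuclideanSpace ℝ (Fin n)) x)
  have hsne : s.Nonempty := by
    by_contra hne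
    rw [not_nonempty_iff_eq_empty] at hne
    obtain ⟨x⟩ := hS
    have : x ∈ ⋃ x ∈ s, (chartAt (EuclideanSpace ℝ (Fin n)) x).source := hs ▸ mem_univ x
    simp [hne] at this
  obtain ⟨c, rfl⟩ := hsc.exists_eq_range hsne
  set C : ℕ → OpenPartialHomeomorph S (EuclideanSpace ℝ (Fin n)) := fun k => chartAt _ (c k) with hC
  have hCat : ∀ k, C k ∈ atlas (EuclideanSpace ℝ (Fin n)) S := fun k => chart_mem_atlas _ _
  set A : ℕ → Set S := disjointed fun k => (C k).source with hA
  have hAm : ∀ k, MeasurableSet (A k) := MeasurableSet.disjointed fun k =>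
    (C k).open_source.measurableSet
  have hAsub : ∀ k, A k ⊆ (C k).source := fun k => disjointed_subset _ k
  have hAU : ⋃ k, A k = univ := by
    rw [hA, iUnion_disjointed, ← hs]
    simp [hC]
  have hAd : Pairwise (Function.onFun Disjoint A) := disjoint_disjointed _
  set ν : Measure S := Measure.sum fun k => (chartMeasure F (C k)).restrict (A k) with hν
  have key : ∀ e' ∈ atlas (EuclideanSpace ℝ (Fin n)) S, ν.restrict e'.source = chartMeasure F e' := by
    intro e' he'
    ext B hB
    have hBs := hB.inter e'.open_source.measurableSet
    rw [Measure.restrict_apply hB, hν, Measure.sum_apply _ hBs]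
    have h1 : ∀ k, (chartMeasure F (C k)).restrict (A k) (B ∩ e'.source) =
        chartMeasure F e' (B ∩ A k) := by
      intro k
      rw [Measure.restrict_apply hBs, inter_right_comm,
        chartMeasure_inter hF (hCat k) he' (hB.inter (hAm k))]
      congr 1
      exact inter_eq_left.2 (inter_subset_right.trans (hAsub k))
    simp only [h1]
    rw [← measure_iUnion (fun i j hij => (hAd hij).mono inter_subset_right inter_subset_right)
      (fun k => hB.inter (hAm k)), ← inter_iUnion, hAU, inter_univ]
  have hsup : areaMeasure F ≤ ν := iSup₂_le fun e' he' => by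
    change chartMeasure F e' ≤ ν
    rw [← key e' he']
    exact Measure.restrict_le_self
  refine le_antisymm ?_ ?_
  · rw [← key e he]
    exact Measure.restrict_mono le_rfl hsup
  · rw [← chartMeasure_restrict_source F e]
    exact Measure.restrict_mono le_rfl (hle e he)

/-- Integration against the area measure of a function supported in the domain of a chart. -/
lemma integral_areaMeasure_of_chart [SecondCountableTopology S]
    (hF : ContMDiff (𝓡 n) 𝓘(ℝ, Cn n) ∞ F) (he : e ∈ atlas (EuclideanSpace ℝ (Fin n)) S)
    {h : S → ℝ} (h0 : ∀ x ∉ e.source, h x = 0)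
    (hint : IntegrableOn (fun u => areaDensity F e u * h (e.symm u)) e.target) :
    Integrable h (areaMeasure F) ∧
      ∫ x, h x ∂(areaMeasure F) = ∫ u in e.target, areaDensity F e u * h (e.symm u) := by
  set d : EuclideanSpace ℝ (Fin n) → ENNReal := fun u => ENNReal.ofReal (areaDensity F e u) with hd
  have hdm : AEMeasurable (areaDensity F e) (volume.restrict e.target) :=
    (continuousOn_areaDensity hF he).aemeasurable e.open_target.measurableSet
  have hdm' : AEMeasurable d (volume.restrict e.target) := hdm.ennreal_ofReal
  have hdf : ∀ᵐ u ∂(volume.restrict e.target), d u < ⊤ :=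
    Eventually.of_forall fun _ => ENNReal.ofReal_lt_top
  have htr : ∀ u, (d u).toReal = areaDensity F e u := fun u =>
    ENNReal.toReal_ofReal (Real.sqrt_nonneg _)
  have hint' : Integrable (h ∘ e.symm) ((volume.restrict e.target).withDensity d) := by
    rw [integrable_withDensity_iff_integrable_smul₀' hdm' hdf]
    simp only [htr]
    exact hint
  have hem := aemeasurable_chart_symm e d
  have hrest : Integrable h (chartMeasure F e) ∧ ∫ x, h x ∂(chartMeasure F e) =
      ∫ u in e.target, areaDensity F e u * h (e.symm u) := by
    have heA : AEMeasurable e (chartMeasure F e) := by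
      rw [← chartMeasure_restrict_source F e]
      exact e.continuousOn.aemeasurable e.open_source.measurableSet
    have hmm : (chartMeasure F e).map e = (volume.restrict e.target).withDensity d := by
      rw [chartMeasure, AEMeasurable.map_map_of_aemeasurable heA hem]
      conv_rhs => rw [← Measure.map_id (μ := (volume.restrict e.target).withDensity d)]
      refine Measure.map_congr ?_
      refine (withDensity_absolutelyContinuous (volume.restrict e.target) d).ae_le ?_
      filter_upwards [ae_restrict_mem e.open_target.measurableSet] with u hu
      exact e.right_inv hu
    have hsm : AEStronglyMeasurable h (chartMeasure F e) := by
      have h1 : AEStronglyMeasurable ((h ∘ e.symm) ∘ e) (chartMeasure F e) :=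
        AEStronglyMeasurable.comp_aemeasurable (by rw [hmm]; exact hint'.aestronglyMeasurable) heA
      refine h1.congr ?_
      rw [← chartMeasure_restrict_source F e]
      filter_upwards [ae_restrict_mem e.open_source.measurableSet] with x hx
      simp [e.left_inv hx]
    constructor
    · exact (integrable_map_measure hsm hem).2 hint'
    · rw [chartMeasure, integral_map hem hsm]
      change ∫ u, h (e.symm u) ∂((volume.restrict e.target).withDensity d) = _
      rw [integral_withDensity_eq_integral_toReal_smul₀ hdm' hdf]
      simp only [htr, smul_eq_mul]
  rw [← areaMeasure_restrict_source hF he] at hrest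
  constructor
  · rw [← integrableOn_iff_integrable_of_support_subset (s := e.source)]
    · exact hrest.1
    · intro x hx
      by_contra hn
      exact hx (h0 x hn)
  · rw [← setIntegral_eq_integral_of_forall_compl_eq_zero h0, hrest.2]

lemma exists_countable_charts (S : Type*) [TopologicalSpace S]
    [ChartedSpace (EuclideanSpace ℝ (Fin n)) S] [SecondCountableTopology S] :
    ∃ s : Set S, s.Countable ∧ ⋃ x : s, (chartAt (EuclideanSpace ℝ (Fin n)) (x : S)).source = univ := by
  obtain ⟨s, hsc, hs⟩ := TopologicalSpace.countable_cover_nhds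
    (fun x : S => chart_source_mem_nhds (EuclideanSpace ℝ (Fin n)) x)
  refine ⟨s, hsc, ?_⟩
  rw [← hs, iUnion_subtype]

/-- A set is null for the area measure as soon as it is null in every chart. -/
lemma ae_areaMeasure_of_charts [SecondCountableTopology S] (hF : ContMDiff (𝓡 n) 𝓘(ℝ, Cn n) ∞ F)
    {P : S → Prop} (h : ∀ e ∈ atlas (EuclideanSpace ℝ (Fin n)) S,
      ∀ᵐ u ∂volume, u ∈ e.target → P (e.symm u)) : ∀ᵐ x ∂(areaMeasure F), P x := by
  obtain ⟨s, hsc, hs⟩ := exists_countable_charts (n := n) S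
  have : Countable s := hsc
  rw [← Measure.restrict_univ (μ := areaMeasure F), ← hs, ae_restrict_iUnion_iff]
  intro x
  set e := chartAt (EuclideanSpace ℝ (Fin n)) (x : S) with he
  rw [areaMeasure_restrict_source hF (chart_mem_atlas _ _)]
  have heA : AEMeasurable e (chartMeasure F e) := by
    rw [← chartMeasure_restrict_source F e]
    exact e.continuousOn.aemeasurable e.open_source.measurableSet
  have hmm : (chartMeasure F e).map e ≪ volume.restrict e.target := by
    rw [chartMeasure, AEMeasurable.map_map_of_aemeasurable heA (aemeasurable_chart_symm e _),
      Measure.map_congr (g := id)]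
    · rw [Measure.map_id]
      exact withDensity_absolutelyContinuous _ _
    · refine (withDensity_absolutelyContinuous (volume.restrict e.target) _).ae_le ?_
      filter_upwards [ae_restrict_mem e.open_target.measurableSet] with u hu
      exact e.right_inv hu
  have h1 : ∀ᵐ u ∂(volume.restrict e.target), P (e.symm u) :=
    (ae_restrict_iff' e.open_target.measurableSet).2 (h e (chart_mem_atlas _ _))
  have h2 := ae_of_ae_map heA (hmm.ae_le h1)
  have h3 : ∀ᵐ y ∂(chartMeasure F e), y ∈ e.source := by
    rw [← chartMeasure_restrict_source F e]
    exact ae_restrict_mem e.open_source.measurableSet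
  filter_upwards [h2, h3] with y hy hys
  rwa [e.left_inv hys] at hy

/-- Two area measures whose densities in all charts differ by a factor `j` differ by `j`. -/
lemma areaMeasure_eq_withDensity [SecondCountableTopology S] {F' : S → Cn n}
    (hF : ContMDiff (𝓡 n) 𝓘(ℝ, Cn n) ∞ F) (hF' : ContMDiff (𝓡 n) 𝓘(ℝ, Cn n) ∞ F')
    {j : S → ℝ} (hj : Measurable j) (hj0 : ∀ x, 0 ≤ j x)
    (h : ∀ e ∈ atlas (EuclideanSpace ℝ (Fin n)) S, ∀ u ∈ e.target,
      areaDensity F' e u = j (e.symm u) * areaDensity F e u) :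
    areaMeasure F' = (areaMeasure F).withDensity fun x => ENNReal.ofReal (j x) := by
  obtain ⟨s, hsc, hs⟩ := exists_countable_charts (n := n) S
  have : Countable s := hsc
  refine (Measure.ext_iff_of_iUnion_eq_univ hs).2 fun x => ?_
  have he := chart_mem_atlas (EuclideanSpace ℝ (Fin n)) (x : S)
  set e := chartAt (EuclideanSpace ℝ (Fin n)) (x : S)
  rw [restrict_withDensity e.open_source.measurableSet, areaMeasure_restrict_source hF he,
    areaMeasure_restrict_source hF' he]
  have hjm : Measurable fun x => ENNReal.ofReal (j x) := hj.ennreal_ofReal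
  have hdm : AEMeasurable (fun u => ENNReal.ofReal (areaDensity F e u))
      (volume.restrict e.target) :=
    ((continuousOn_areaDensity hF he).aemeasurable e.open_target.measurableSet).ennreal_ofReal
  ext B hB
  rw [chartMeasure_apply F' e hB, withDensity_apply _ hB, chartMeasure,
    Measure.restrict_map_of_aemeasurable (aemeasurable_chart_symm e _) hB]
  have hsymm : AEMeasurable e.symm (volume.restrict e.target) :=
    e.continuousOn_symm.aemeasurable e.open_target.measurableSet
  rw [lintegral_map' hjm.aemeasurable (aemeasurable_chart_symm e _).restrict]
  have hpre : ((volume.restrict e.target).withDensity fun u => ENNReal.ofReal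
      (areaDensity F e u)).restrict (e.symm ⁻¹' B) =
      (volume.restrict (e.target ∩ e.symm ⁻¹' B)).withDensity fun u => ENNReal.ofReal
        (areaDensity F e u) := by
    have hT := measurableSet_target_inter_preimage e hB
    rw [← Measure.restrict_restrict_of_subset (s := e.target ∩ e.symm ⁻¹' B) (t := e.target)
      inter_subset_left, ← restrict_withDensity hT]
    refine Measure.restrict_congr_set ?_
    refine (withDensity_absolutelyContinuous (volume.restrict e.target) _).ae_le ?_
    filter_upwards [ae_restrict_mem e.open_target.measurableSet] with u hu
    exact propext ⟨fun h => ⟨hu, h⟩, fun h => h.2⟩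
  rw [hpre, lintegral_withDensity_eq_lintegral_mul₀ (hdm.mono_set inter_subset_left)]
  · refine setLIntegral_congr_fun (measurableSet_target_inter_preimage e hB) fun u hu => ?_
    rw [h e he u hu.1, ENNReal.ofReal_mul (hj0 _), mul_comm]
    rfl
  · exact hjm.comp_aemeasurable (hsymm.mono_set inter_subset_left)

end AreaMeasure

/-! ### Lagrangian immersions in charts -/

section ChartFrames

variable {n : ℕ} {S : Type*} [TopologicalSpace S] [ChartedSpace (EuclideanSpace ℝ (Fin n)) S]
  [IsManifold (𝓡 n) ∞ S] {F : S → Cn n}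
  {e : OpenPartialHomeomorph S (EuclideanSpace ℝ (Fin n))} {u : EuclideanSpace ℝ (Fin n)}

lemma mdifferentiable_chart_symm (he : e ∈ atlas (EuclideanSpace ℝ (Fin n)) S) :
    e.symm.MDifferentiable (𝓡 n) (𝓡 n) := by
  have : IsManifold (𝓡 n) 1 S := IsManifold.of_le (n := ∞) (WithTop.coe_le_coe.2 le_top)
  exact (mdifferentiable_of_mem_atlas he).symm

/-- The basis of the tangent space given by the coordinate vectors of a chart. -/
def chartBasis (he : e ∈ atlas (EuclideanSpace ℝ (Fin n)) S) (hu : u ∈ e.target) :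
    Module.Basis (Fin n) ℝ (TangentSpace (𝓡 n) (e.symm u)) :=
  (EuclideanSpace.basisFun (Fin n) ℝ).toBasis.map
    ((mdifferentiable_chart_symm he).mfderiv (x := u) hu).toLinearEquiv

lemma fderiv_comp_chart_symm {E' : Type*} [NormedAddCommGroup E'] [NormedSpace ℝ E'] {g : S → E'}
    (hg : MDifferentiableAt (𝓡 n) 𝓘(ℝ, E') g (e.symm u))
    (he : e ∈ atlas (EuclideanSpace ℝ (Fin n)) S) (hu : u ∈ e.target) (i : Fin n) :
    fderiv ℝ (g ∘ e.symm) u (EuclideanSpace.single i 1) =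
      mfderiv (𝓡 n) 𝓘(ℝ, E') g (e.symm u) (chartBasis he hu i) := by
  have h1 := mfderiv_comp u hg ((mdifferentiable_chart_symm he).mdifferentiableAt hu)
  rw [mfderiv_eq_fderiv] at h1
  rw [h1]
  change _ = mfderiv (𝓡 n) 𝓘(ℝ, E') g (e.symm u) (mfderiv (𝓡 n) (𝓡 n) e.symm u
    ((EuclideanSpace.basisFun (Fin n) ℝ).toBasis i))
  simp
  rfl

lemma coordTangent_eq (hF : ContMDiff (𝓡 n) 𝓘(ℝ, Cn n) ∞ F)
    (he : e ∈ atlas (EuclideanSpace ℝ (Fin n)) S) (hu : u ∈ e.target) (i : Fin n) :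
    coordTangent F e u i = differential F (e.symm u) (chartBasis he hu i) :=
  fderiv_comp_chart_symm (hF.mdifferentiableAt (by simp)) he hu i

lemma isIsotropic_coordTangent (hF : ContMDiff (𝓡 n) 𝓘(ℝ, Cn n) ∞ F)
    (hlag : ∀ x, ∀ v w : TangentSpace (𝓡 n) x,
      kahlerForm (differential F x v) (differential F x w) = 0)
    (he : e ∈ atlas (EuclideanSpace ℝ (Fin n)) S) (hu : u ∈ e.target) :
    IsIsotropic (coordTangent F e u) := fun i j => by
  rw [coordTangent_eq hF he hu, coordTangent_eq hF he hu]
  exact hlag _ _ _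

lemma span_coordTangent (hF : ContMDiff (𝓡 n) 𝓘(ℝ, Cn n) ∞ F)
    (he : e ∈ atlas (EuclideanSpace ℝ (Fin n)) S) (hu : u ∈ e.target) :
    Submodule.span ℝ (range (coordTangent F e u)) = tangentPlane F (e.symm u) := by
  have h1 : range (coordTangent F e u) =
      (differential F (e.symm u)).toLinearMap '' range (chartBasis he hu) := by
    rw [← range_comp]
    congr 1
    funext i
    exact coordTangent_eq hF he hu i
  rw [h1, Submodule.span_image, (chartBasis he hu).span_eq, Submodule.map_top]
  rfl

lemma holVolumeForm_coordTangent_ne_zero (hF : ContMDiff (𝓡 n) 𝓘(ℝ, Cn n) ∞ F)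
    (himm : ∀ x, Function.Injective (differential F x))
    (hlag : ∀ x, ∀ v w : TangentSpace (𝓡 n) x,
      kahlerForm (differential F x v) (differential F x w) = 0)
    (he : e ∈ atlas (EuclideanSpace ℝ (Fin n)) S) (hu : u ∈ e.target) :
    holVolumeForm (coordTangent F e u) ≠ 0 := by
  have hlin : LinearIndependent ℝ (coordTangent F e u) := by
    have h1 := (chartBasis he hu).linearIndependent.map' (differential F (e.symm u)).toLinearMap
      (LinearMap.ker_eq_bot.2 (himm _))
    have h2 : coordTangent F e u =
        (differential F (e.symm u)).toLinearMap ∘ chartBasis he hu :=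
      funext fun i => coordTangent_eq hF he hu i
    rw [h2]
    exact h1
  have h2 := (Matrix.posDef_gram_of_linearIndependent hlin).det_pos
  rw [(isIsotropic_coordTangent hF hlag he hu).det_gram] at h2
  intro h0
  rw [h0] at h2
  simp at h2

lemma areaDensity_eq_norm (hF : ContMDiff (𝓡 n) 𝓘(ℝ, Cn n) ∞ F)
    (hlag : ∀ x, ∀ v w : TangentSpace (𝓡 n) x,
      kahlerForm (differential F x v) (differential F x w) = 0)
    (he : e ∈ atlas (EuclideanSpace ℝ (Fin n)) S) (hu : u ∈ e.target) :
    areaDensity F e u = ‖holVolumeForm (coordTangent F e u)‖ :=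
  (isIsotropic_coordTangent hF hlag he hu).sqrt_det_gram

/-- Up to a sign that depends on the orientation of the chart, `Ω(∂₁F, …, ∂ₙF) = e^{iθ} √(det g)`.
Squaring removes the sign. -/
lemma holVolumeForm_coordTangent_sq (hn : 1 ≤ n) (hF : ContMDiff (𝓡 n) 𝓘(ℝ, Cn n) ∞ F)
    (hlag : ∀ x, ∀ v w : TangentSpace (𝓡 n) x,
      kahlerForm (differential F x v) (differential F x w) = 0)
    {o : ∀ x : S, Orientation ℝ (TangentSpace (𝓡 n) x) (Fin n)} {θ : S → ℝ}
    (hang : IsLagrangianAngle o F θ)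
    (he : e ∈ atlas (EuclideanSpace ℝ (Fin n)) S) (hu : u ∈ e.target) :
    holVolumeForm (coordTangent F e u) ^ 2 = Complex.exp (Complex.I * θ (e.symm u)) ^ 2 *
      (‖holVolumeForm (coordTangent F e u)‖ : ℂ) ^ 2 := by
  have hct : coordTangent F e u = fun i => differential F (e.symm u) (chartBasis he hu i) :=
    funext fun i => coordTangent_eq hF he hu i
  have hiso : ∀ b : Module.Basis (Fin n) ℝ (TangentSpace (𝓡 n) (e.symm u)),
      IsIsotropic fun i => differential F (e.symm u) (b i) := fun b i j => hlag _ _ _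
  have hb : ∀ b : Module.Basis (Fin n) ℝ (TangentSpace (𝓡 n) (e.symm u)),
      b.orientation = o (e.symm u) →
      holVolumeForm (fun i => differential F (e.symm u) (b i)) ^ 2 =
        Complex.exp (Complex.I * θ (e.symm u)) ^ 2 *
          (‖holVolumeForm (fun i => differential F (e.symm u) (b i))‖ : ℂ) ^ 2 := fun b hbo => by
    rw [← (hiso b).sqrt_det_gram, ← mul_pow]
    congr 1
    exact hang _ b hbo
  set b := chartBasis he hu with hbdef
  rw [hct]
  rcases b.orientation_eq_or_eq_neg (o (e.symm u)) with h | h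
  · exact hb b h.symm
  · set i₀ : Fin n := ⟨0, hn⟩
    set b' := b.unitsSMul (Function.update 1 i₀ (-1)) with hb'
    have h1 := hb b' (by rw [hb', Module.Basis.orientation_neg_single, h])
    have h2 : (fun i => differential F (e.symm u) (b' i)) =
        Function.update (fun i => differential F (e.symm u) (b i)) i₀
          (-(differential F (e.symm u) (b i₀))) := by
      funext i
      rw [hb', Module.Basis.unitsSMul_apply]
      by_cases hi : i = i₀
      · subst hi; simp
      · simp [hi]
    have h3 : holVolumeForm (fun i => differential F (e.symm u) (b' i)) =
        -holVolumeForm (fun i => differential F (e.symm u) (b i)) := by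
      rw [h2, ← det_eq_holVolumeForm, AlternatingMap.map_update_neg, Function.update_eq_self,
        det_eq_holVolumeForm]
    rw [h3, norm_neg, neg_sq] at h1
    exact h1

lemma normalPart_eq (hF : ContMDiff (𝓡 n) 𝓘(ℝ, Cn n) ∞ F)
    (he : e ∈ atlas (EuclideanSpace ℝ (Fin n)) S) (hu : u ∈ e.target) (V : Cn n) :
    normalPart F (e.symm u) V =
      (Submodule.span ℝ (range (coordTangent F e u)))ᗮ.starProjection V := by
  rw [normalPart, span_coordTangent hF he hu]

/-- `dθ(v) = ⟨i dF(v), H⟩`, in an arbitrary chart. The trace defining `H` refers to the preferred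
chart at the given point, where the identity is proved before it is transferred. -/
lemma fderiv_angle_eq_inner_meanCurvature (hn : 1 ≤ n) (hF : ContMDiff (𝓡 n) 𝓘(ℝ, Cn n) ∞ F)
    (himm : ∀ x, Function.Injective (differential F x))
    (hlag : ∀ x, ∀ v w : TangentSpace (𝓡 n) x,
      kahlerForm (differential F x v) (differential F x w) = 0)
    {o : ∀ x : S, Orientation ℝ (TangentSpace (𝓡 n) x) (Fin n)} {θ : S → ℝ}
    (hang : IsLagrangianAngle o F θ) (hθ : Continuous θ)
    (he : e ∈ atlas (EuclideanSpace ℝ (Fin n)) S) (hu : u ∈ e.target) :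
    ContDiffAt ℝ 1 (θ ∘ e.symm) u ∧
    ∀ k, fderiv ℝ (θ ∘ e.symm) u (EuclideanSpace.single k 1) =
      inner ℝ (Complex.I • coordTangent F e u k) (meanCurvature F (e.symm u)) := by
  -- the regularity of `θ` in an arbitrary chart
  have hreg : ∀ {e : OpenPartialHomeomorph S (EuclideanSpace ℝ (Fin n))}
      (_ : e ∈ atlas (EuclideanSpace ℝ (Fin n)) S) {u : EuclideanSpace ℝ (Fin n)}
      (_ : u ∈ e.target), ContDiffAt ℝ 2 (F ∘ e.symm) u ∧
      (∀ᶠ q in 𝓝 u, IsIsotropic (derivFrame (F ∘ e.symm) (fun k => EuclideanSpace.single k 1) q)) ∧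
      derivVol (F ∘ e.symm) (fun k => EuclideanSpace.single k 1) u ≠ 0 ∧
      ContinuousAt (θ ∘ e.symm) u ∧
      (∀ᶠ q in 𝓝 u, derivVol (F ∘ e.symm) (fun k => EuclideanSpace.single k 1) q ^ 2 =
        Complex.exp (Complex.I * (θ ∘ e.symm) q) ^ 2 *
          (‖derivVol (F ∘ e.symm) (fun k => EuclideanSpace.single k 1) q‖ : ℂ) ^ 2) := by
    intro e he u hu
    have hnh := e.open_target.mem_nhds hu
    refine ⟨((contDiffOn_comp_chart_symm hF he).contDiffAt hnh).of_le
      (WithTop.coe_le_coe.2 le_top), ?_, ?_, ?_, ?_⟩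
    · filter_upwards [hnh] with q hq using isIsotropic_coordTangent hF hlag he hq
    · exact holVolumeForm_coordTangent_ne_zero hF himm hlag he hu
    · exact hθ.continuousAt.comp (e.continuousOn_symm.continuousAt hnh)
    · filter_upwards [hnh] with q hq using holVolumeForm_coordTangent_sq hn hF hlag hang he hq
  have hC1 : ∀ {e : OpenPartialHomeomorph S (EuclideanSpace ℝ (Fin n))}
      (_ : e ∈ atlas (EuclideanSpace ℝ (Fin n)) S) {u : EuclideanSpace ℝ (Fin n)}
      (_ : u ∈ e.target), ContDiffAt ℝ 1 (θ ∘ e.symm) u := by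
    intro e he u hu
    obtain ⟨h1, -, h3, h4, h5⟩ := hreg he hu
    exact contDiffAt_angle (contDiffAt_derivVol (m := 1) h1 (by norm_num)) h3 h4 h5
  refine ⟨hC1 he hu, fun k => ?_⟩
  set x := e.symm u with hx
  set e₀ := chartAt (EuclideanSpace ℝ (Fin n)) x with he₀
  have he₀a : e₀ ∈ atlas (EuclideanSpace ℝ (Fin n)) S := chart_mem_atlas _ _
  have hxs : x ∈ e₀.source := mem_chart_source _ _
  have hu₀ : e₀ x ∈ e₀.target := e₀.map_source hxs
  obtain ⟨h1, h2, h3, h4, h5⟩ := hreg he₀a hu₀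
  have hpref : ∀ m, fderiv ℝ (θ ∘ e₀.symm) (e₀ x) (EuclideanSpace.single m 1) =
      inner ℝ (Complex.I • fderiv ℝ (F ∘ e₀.symm) (e₀ x) (EuclideanSpace.single m 1))
        (meanCurvature F x) := by
    intro m
    have h6 := fderiv_angle_eq_inner_trace h1 h2 h3 h4 h5 m
    rw [h6]
    congr 1
    rw [meanCurvature]
    refine Finset.sum_congr rfl fun i _ => Finset.sum_congr rfl fun j _ => ?_
    have h7 := normalPart_eq hF he₀a hu₀ (coordHessian F e₀ (e₀ x) i j)
    rw [e₀.left_inv hxs] at h7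
    rw [h7]
    congr 2
    rw [coordHessian]
    exact congrArg (fun L : EuclideanSpace ℝ (Fin n) →L[ℝ] Cn n => L (EuclideanSpace.single i 1))
      (hasFDerivAt_derivFrame h1 (EuclideanSpace.single j 1)).fderiv.symm
  have hpref' : ∀ v, fderiv ℝ (θ ∘ e₀.symm) (e₀ x) v =
      inner ℝ (Complex.I • fderiv ℝ (F ∘ e₀.symm) (e₀ x) v) (meanCurvature F x) := by
    intro v
    have hv := (EuclideanSpace.basisFun (Fin n) ℝ).sum_repr v
    rw [← hv]
    simp only [map_sum, map_smul, EuclideanSpace.basisFun_apply, hpref, Finset.smul_sum, sum_inner]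
    refine Finset.sum_congr rfl fun m _ => ?_
    rw [smul_comm, real_inner_smul_left, smul_eq_mul]
  -- the chain rule for the transition map
  have hmem : u ∈ e.target ∩ e.symm ⁻¹' e₀.source := ⟨hu, hxs⟩
  have hopen : IsOpen (e.target ∩ e.symm ⁻¹' e₀.source) :=
    e.isOpen_inter_preimage_symm e₀.open_source
  have hφ : HasFDerivAt (e₀ ∘ e.symm) (fderiv ℝ (e₀ ∘ e.symm) u) u :=
    (((contDiffOn_transition he he₀a).contDiffAt (hopen.mem_nhds hmem)).differentiableAt
      (by simp)).hasFDerivAt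
  have htr : ∀ {E' : Type} [NormedAddCommGroup E'] [NormedSpace ℝ E'] (g : S → E')
      (_ : DifferentiableAt ℝ (g ∘ e₀.symm) (e₀ x)) (v : EuclideanSpace ℝ (Fin n)),
      fderiv ℝ (g ∘ e.symm) u v =
        fderiv ℝ (g ∘ e₀.symm) (e₀ x) (fderiv ℝ (e₀ ∘ e.symm) u v) := by
    intro E' _ _ g hg v
    have h8 : g ∘ e.symm =ᶠ[𝓝 u] (g ∘ e₀.symm) ∘ (e₀ ∘ e.symm) := by
      filter_upwards [hopen.mem_nhds hmem] with w hw
      simp [e₀.left_inv hw.2]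
    have h9 := hg.hasFDerivAt.comp u hφ
    rw [h8.fderiv_eq, h9.fderiv]
    rfl
  rw [htr θ ((hC1 he₀a hu₀).differentiableAt (by norm_num)), hpref', coordTangent,
    htr F (h1.differentiableAt (by norm_num))]

omit [IsManifold (𝓡 n) ∞ S] in
lemma meanCurvature_mem_orthogonal (F : S → Cn n) (x : S) :
    meanCurvature F x ∈ (tangentPlane F x)ᗮ :=
  Submodule.sum_mem _ fun _ _ => Submodule.sum_mem _ fun _ _ => Submodule.smul_mem _ _
    (Submodule.starProjection_apply_mem _ _)

lemma inner_coordTangent_meanCurvature (hF : ContMDiff (𝓡 n) 𝓘(ℝ, Cn n) ∞ F)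
    (he : e ∈ atlas (EuclideanSpace ℝ (Fin n)) S) (hu : u ∈ e.target) (k : Fin n) :
    inner ℝ (coordTangent F e u k) (meanCurvature F (e.symm u)) = 0 := by
  refine (Submodule.mem_orthogonal _ _).1 (meanCurvature_mem_orthogonal F (e.symm u)) _ ?_
  rw [← span_coordTangent hF he hu]
  exact Submodule.subset_span ⟨k, rfl⟩

/-- The mean curvature vanishes where `dθ = 0`. -/
lemma meanCurvature_eq_zero_of_fderiv_angle (hn : 1 ≤ n) (hF : ContMDiff (𝓡 n) 𝓘(ℝ, Cn n) ∞ F)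
    (himm : ∀ x, Function.Injective (differential F x))
    (hlag : ∀ x, ∀ v w : TangentSpace (𝓡 n) x,
      kahlerForm (differential F x v) (differential F x w) = 0)
    {o : ∀ x : S, Orientation ℝ (TangentSpace (𝓡 n) x) (Fin n)} {θ : S → ℝ}
    (hang : IsLagrangianAngle o F θ) (hθ : Continuous θ)
    (he : e ∈ atlas (EuclideanSpace ℝ (Fin n)) S) (hu : u ∈ e.target)
    (h0 : fderiv ℝ (θ ∘ e.symm) u = 0) : meanCurvature F (e.symm u) = 0 := by
  have hD := holVolumeForm_coordTangent_ne_zero hF himm hlag he hu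
  have hiso := isIsotropic_coordTangent hF hlag he hu
  have hre := hiso.re_frameCoord_eq_zero hD (inner_coordTangent_meanCurvature hF he hu)
  have him : ∀ k, (frameCoord (coordTangent F e u) (meanCurvature F (e.symm u)) k).im = 0 := by
    intro k
    rw [hiso.im_frameCoord hD]
    refine Finset.sum_eq_zero fun j _ => ?_
    rw [← (fderiv_angle_eq_inner_meanCurvature hn hF himm hlag hang hθ he hu).2 j, h0]
    simp
  rw [← sum_frameCoord hD (meanCurvature F (e.symm u))]
  refine Finset.sum_eq_zero fun k _ => ?_
  rw [Complex.ext (hre k) (him k) (w := 0), zero_smul]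

end ChartFrames

/-! ### The flow in charts -/

section FlowInCharts

variable {n : ℕ} {S : Type*} [TopologicalSpace S] [ChartedSpace (EuclideanSpace ℝ (Fin n)) S]

/-- The flow `F` in the chart `e`, as a map on the spacetime `ℝ × ℝⁿ`. -/
def coordFlow (F : ℝ → S → Cn n) (e : OpenPartialHomeomorph S (EuclideanSpace ℝ (Fin n)))
    (p : ℝ × EuclideanSpace ℝ (Fin n)) : Cn n := F p.1 (e.symm p.2)

/-- The angle `θ` in the chart `e`, as a function on the spacetime `ℝ × ℝⁿ`. -/
def coordAngle (θ : ℝ → S → ℝ) (e : OpenPartialHomeomorph S (EuclideanSpace ℝ (Fin n)))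
    (p : ℝ × EuclideanSpace ℝ (Fin n)) : ℝ := θ p.1 (e.symm p.2)

variable [IsManifold (𝓡 n) ∞ S]
  {o : ∀ x : S, Orientation ℝ (TangentSpace (𝓡 n) x) (Fin n)}
  {T : ℝ} {F : ℝ → S → Cn n} {θ : ℝ → S → ℝ}
  {e : OpenPartialHomeomorph S (EuclideanSpace ℝ (Fin n))}

namespace IsZeroMaslovLMCF

omit [IsManifold (𝓡 n) ∞ S] in
lemma contMDiff_slice (hF : IsZeroMaslovLMCF o T F θ) {t : ℝ} (ht : t ∈ Ico 0 T) :
    ContMDiff (𝓡 n) 𝓘(ℝ, Cn n) ∞ (F t) := by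
  have h1 : ContMDiff (𝓡 n) (𝓘(ℝ, ℝ).prod (𝓡 n)) ∞ (fun x : S => (t, x)) :=
    contMDiff_const.prodMk contMDiff_id
  rw [← contMDiffOn_univ] at h1 ⊢
  exact hF.smooth.comp h1 fun x _ => ⟨ht, mem_univ x⟩

omit [IsManifold (𝓡 n) ∞ S] in
lemma continuous_angle (hF : IsZeroMaslovLMCF o T F θ) {t : ℝ} (ht : t ∈ Ico 0 T) :
    Continuous (θ t) :=
  hF.angle_continuous.comp_continuous (f := fun x : S => (t, x)) (by fun_prop)
    fun x => ⟨ht, mem_univ x⟩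

lemma contDiffOn_coordFlow (hF : IsZeroMaslovLMCF o T F θ)
    (he : e ∈ atlas (EuclideanSpace ℝ (Fin n)) S) :
    ContDiffOn ℝ ∞ (coordFlow F e) (Ico 0 T ×ˢ e.target) := by
  rw [← contMDiffOn_iff_contDiffOn]
  have h1 : ContMDiffOn 𝓘(ℝ, ℝ × EuclideanSpace ℝ (Fin n)) (𝓘(ℝ, ℝ).prod (𝓡 n)) ∞
      (fun p : ℝ × EuclideanSpace ℝ (Fin n) => (p.1, e.symm p.2)) (Ico 0 T ×ˢ e.target) := by
    refine ContMDiffOn.prodMk contDiff_fst.contMDiff.contMDiffOn ?_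
    exact (contMDiffOn_symm_of_mem_maximalAtlas (I := 𝓡 n) (n := ∞)
      (IsManifold.subset_maximalAtlas he)).comp contDiff_snd.contMDiff.contMDiffOn
        fun p hp => hp.2
  exact hF.smooth.comp h1 fun p hp => ⟨hp.1, mem_univ _⟩

omit [ChartedSpace (EuclideanSpace ℝ (Fin n)) S] [IsManifold (𝓡 n) ∞ S] in
lemma uniqueDiffOn_spacetime (T : ℝ) (e : OpenPartialHomeomorph S (EuclideanSpace ℝ (Fin n))) :
    UniqueDiffOn ℝ (Ico 0 T ×ˢ e.target) :=
  (uniqueDiffOn_Ico 0 T).prod e.open_target.uniqueDiffOn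

lemma coordTangent_eq_fderivWithin (hF : IsZeroMaslovLMCF o T F θ)
    (he : e ∈ atlas (EuclideanSpace ℝ (Fin n)) S) {p : ℝ × EuclideanSpace ℝ (Fin n)}
    (hp : p ∈ Ico 0 T ×ˢ e.target) (k : Fin n) :
    coordTangent (F p.1) e p.2 k =
      fderivWithin ℝ (coordFlow F e) (Ico 0 T ×ˢ e.target) p (spaceDir k) := by
  have h1 := ((hF.contDiffOn_coordFlow he).differentiableOn (by simp) p hp).hasFDerivWithinAt
  have h2 : HasFDerivWithinAt (fun u : EuclideanSpace ℝ (Fin n) => (p.1, u)) _ e.target p.2 :=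
    ((hasFDerivAt_const (𝕜 := ℝ) p.1 p.2).prodMk (hasFDerivAt_id p.2)).hasFDerivWithinAt
  have h3 := (HasFDerivWithinAt.comp (f := fun u : EuclideanSpace ℝ (Fin n) => (p.1, u)) p.2 h1 h2
    fun u hu => (⟨hp.1, hu⟩ : (p.1, u) ∈ Ico 0 T ×ˢ e.target)).hasFDerivAt
      (e.open_target.mem_nhds hp.2)
  rw [coordTangent]
  have h4 : F p.1 ∘ e.symm = coordFlow F e ∘ fun u => (p.1, u) := rfl
  rw [h4, h3.fderiv]
  simp [spaceDir]

lemma meanCurvature_eq_fderivWithin (hF : IsZeroMaslovLMCF o T F θ)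
    (he : e ∈ atlas (EuclideanSpace ℝ (Fin n)) S) {p : ℝ × EuclideanSpace ℝ (Fin n)}
    (hp : p ∈ Ico 0 T ×ˢ e.target) :
    meanCurvature (F p.1) (e.symm p.2) =
      fderivWithin ℝ (coordFlow F e) (Ico 0 T ×ˢ e.target) p timeDir := by
  have h1 := ((hF.contDiffOn_coordFlow he).differentiableOn (by simp) p hp).hasFDerivWithinAt
  have h2 : HasDerivWithinAt (fun s : ℝ => (s, p.2)) (1, 0) (Ico 0 T) p.1 :=
    ((hasDerivAt_id p.1).prodMk (hasDerivAt_const p.1 p.2)).hasDerivWithinAt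
  have h3 := HasFDerivWithinAt.comp_hasDerivWithinAt (f := fun s : ℝ => (s, p.2)) p.1 h1 h2
    fun s hs => (⟨hs, hp.2⟩ : (s, p.2) ∈ Ico 0 T ×ˢ e.target)
  exact (((uniqueDiffOn_Ico 0 T) p.1 hp.1).eq_deriv _ (hF.mean_curvature_flow p.1 hp.1 (e.symm p.2)) h3)

/-- On every chart, the coordinate vectors of the flow are jointly continuous up to the initial
time. -/
lemma continuousOn_coordTangent (hF : IsZeroMaslovLMCF o T F θ)
    (he : e ∈ atlas (EuclideanSpace ℝ (Fin n)) S) (k : Fin n) :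
    ContinuousOn (fun p : ℝ × EuclideanSpace ℝ (Fin n) => coordTangent (F p.1) e p.2 k)
      (Ico 0 T ×ˢ e.target) := by
  refine ContinuousOn.congr ?_ fun p hp => hF.coordTangent_eq_fderivWithin he hp k
  exact ((hF.contDiffOn_coordFlow he).continuousOn_fderivWithin (uniqueDiffOn_spacetime T e)
    (by simp)).clm_apply continuousOn_const

lemma continuousOn_meanCurvature_chart (hF : IsZeroMaslovLMCF o T F θ)
    (he : e ∈ atlas (EuclideanSpace ℝ (Fin n)) S) :
    ContinuousOn (fun p : ℝ × EuclideanSpace ℝ (Fin n) => meanCurvature (F p.1) (e.symm p.2))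
      (Ico 0 T ×ˢ e.target) := by
  refine ContinuousOn.congr ?_ fun p hp => hF.meanCurvature_eq_fderivWithin he hp
  exact ((hF.contDiffOn_coordFlow he).continuousOn_fderivWithin (uniqueDiffOn_spacetime T e)
    (by simp)).clm_apply continuousOn_const

lemma vol_ne_zero (hF : IsZeroMaslovLMCF o T F θ)
    (he : e ∈ atlas (EuclideanSpace ℝ (Fin n)) S) {p : ℝ × EuclideanSpace ℝ (Fin n)}
    (hp : p ∈ Ico 0 T ×ˢ e.target) : holVolumeForm (coordTangent (F p.1) e p.2) ≠ 0 :=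
  holVolumeForm_coordTangent_ne_zero (hF.contMDiff_slice hp.1) (hF.immersion _ hp.1)
    (hF.lagrangian _ hp.1) he hp.2

lemma continuousOn_frameCoord (hF : IsZeroMaslovLMCF o T F θ)
    (he : e ∈ atlas (EuclideanSpace ℝ (Fin n)) S) {V : ℝ × EuclideanSpace ℝ (Fin n) → Cn n}
    (hV : ContinuousOn V (Ico 0 T ×ˢ e.target)) (k : Fin n) :
    ContinuousOn (fun p : ℝ × EuclideanSpace ℝ (Fin n) =>
      frameCoord (coordTangent (F p.1) e p.2) (V p) k) (Ico 0 T ×ˢ e.target) := by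
  refine ContinuousOn.div ?_ ?_ fun p hp => hF.vol_ne_zero he hp
  · refine continuous_holVolumeForm.comp_continuousOn (continuousOn_pi.2 fun j => ?_)
    by_cases hj : j = k
    · subst hj; simpa using hV
    · simpa [hj] using hF.continuousOn_coordTangent he j
  · exact continuous_holVolumeForm.comp_continuousOn
      (continuousOn_pi.2 fun j => hF.continuousOn_coordTangent he j)

lemma continuousOn_areaDensity (hF : IsZeroMaslovLMCF o T F θ)
    (he : e ∈ atlas (EuclideanSpace ℝ (Fin n)) S) :
    ContinuousOn (fun p : ℝ × EuclideanSpace ℝ (Fin n) => areaDensity (F p.1) e p.2)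
      (Ico 0 T ×ˢ e.target) := by
  refine ContinuousOn.congr ?_ fun p hp => areaDensity_eq_norm (hF.contMDiff_slice hp.1)
    (hF.lagrangian _ hp.1) he hp.2
  exact (continuous_holVolumeForm.comp_continuousOn
      (continuousOn_pi.2 fun j => hF.continuousOn_coordTangent he j)).norm

lemma areaDensity_pos (hF : IsZeroMaslovLMCF o T F θ)
    (he : e ∈ atlas (EuclideanSpace ℝ (Fin n)) S) {p : ℝ × EuclideanSpace ℝ (Fin n)}
    (hp : p ∈ Ico 0 T ×ˢ e.target) : 0 < areaDensity (F p.1) e p.2 := by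
  rw [areaDensity_eq_norm (hF.contMDiff_slice hp.1) (hF.lagrangian _ hp.1) he hp.2]
  exact norm_pos_iff.2 (hF.vol_ne_zero he hp)

lemma continuousOn_normalPart_chart (hF : IsZeroMaslovLMCF o T F θ)
    (he : e ∈ atlas (EuclideanSpace ℝ (Fin n)) S) (X₀ : Cn n) :
    ContinuousOn (fun p : ℝ × EuclideanSpace ℝ (Fin n) =>
      normalPart (F p.1) (e.symm p.2) (F p.1 (e.symm p.2) - X₀)) (Ico 0 T ×ˢ e.target) := by
  have hV : ContinuousOn (fun p : ℝ × EuclideanSpace ℝ (Fin n) => F p.1 (e.symm p.2) - X₀)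
      (Ico 0 T ×ˢ e.target) := (hF.contDiffOn_coordFlow he).continuousOn.sub continuousOn_const
  have h1 : ∀ p ∈ Ico 0 T ×ˢ e.target, normalPart (F p.1) (e.symm p.2) (F p.1 (e.symm p.2) - X₀) =
      ∑ m, (Complex.I * ((frameCoord (coordTangent (F p.1) e p.2)
        (F p.1 (e.symm p.2) - X₀) m).im : ℂ)) • coordTangent (F p.1) e p.2 m := by
    intro p hp
    rw [normalPart_eq (hF.contMDiff_slice hp.1) he hp.2,
      (isIsotropic_coordTangent (hF.contMDiff_slice hp.1)
        (hF.lagrangian _ hp.1) he hp.2).starProjection_orthogonal (hF.vol_ne_zero he hp)]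
  refine ContinuousOn.congr (continuousOn_finsetSum _ fun m _ => ?_) h1
  refine ContinuousOn.smul (ContinuousOn.mul (M := ℂ) continuousOn_const ?_) (hF.continuousOn_coordTangent he m)
  exact Complex.continuous_ofReal.comp_continuousOn
    (Complex.continuous_im.comp_continuousOn (hF.continuousOn_frameCoord he hV m))

omit [IsManifold (𝓡 n) ∞ S] in
/-- A quantity that is jointly continuous in every chart is jointly continuous. -/
lemma _root_.LagrangianMCF.continuousOn_of_charts {Y : Type*} [TopologicalSpace Y]
    {Q : ℝ → S → Y} {I : Set ℝ} (h : ∀ e ∈ atlas (EuclideanSpace ℝ (Fin n)) S,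
      ContinuousOn (fun p : ℝ × EuclideanSpace ℝ (Fin n) => Q p.1 (e.symm p.2))
        (I ×ˢ e.target)) :
    ContinuousOn (fun p : ℝ × S => Q p.1 p.2) (I ×ˢ univ) := by
  rintro ⟨t, x⟩ ⟨ht, -⟩
  set e := chartAt (EuclideanSpace ℝ (Fin n)) x with he
  have hxs : x ∈ e.source := mem_chart_source _ _
  have h1 : ContinuousOn (fun p : ℝ × S => Q p.1 (e.symm (e p.2))) (I ×ˢ e.source) := by
    refine (h e (chart_mem_atlas _ _)).comp (f := fun p : ℝ × S => (p.1, e p.2)) ?_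
      fun p hp => ⟨hp.1, e.map_source hp.2⟩
    exact continuousOn_fst.prodMk (e.continuousOn.comp continuousOn_snd fun p hp => hp.2)
  have h2 : ContinuousOn (fun p : ℝ × S => Q p.1 p.2) (I ×ˢ e.source) :=
    h1.congr fun p hp => by simp only [e.left_inv hp.2]
  refine (h2 (t, x) ⟨ht, hxs⟩).mono_of_mem_nhdsWithin ?_
  have h3 : (univ : Set ℝ) ×ˢ e.source ∈ 𝓝 (t, x) := prod_mem_nhds univ_mem
    (e.open_source.mem_nhds hxs)
  filter_upwards [mem_nhdsWithin_of_mem_nhds h3, self_mem_nhdsWithin] with p hp hp'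
  exact ⟨hp'.1, hp.2⟩

omit [IsManifold (𝓡 n) ∞ S] in
lemma continuousOn_flow (hF : IsZeroMaslovLMCF o T F θ) :
    ContinuousOn (fun p : ℝ × S => F p.1 p.2) (Ico 0 T ×ˢ univ) := hF.smooth.continuousOn

lemma continuousOn_meanCurvature (hF : IsZeroMaslovLMCF o T F θ) :
    ContinuousOn (fun p : ℝ × S => meanCurvature (F p.1) p.2) (Ico 0 T ×ˢ univ) :=
  continuousOn_of_charts (n := n) (Q := fun t x => meanCurvature (F t) x)
    fun _ he => hF.continuousOn_meanCurvature_chart he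

lemma continuousOn_normalPart (hF : IsZeroMaslovLMCF o T F θ) (X₀ : Cn n) :
    ContinuousOn (fun p : ℝ × S => normalPart (F p.1) p.2 (F p.1 p.2 - X₀)) (Ico 0 T ×ˢ univ) :=
  continuousOn_of_charts (n := n) (Q := fun t x => normalPart (F t) x (F t x - X₀))
    fun _ he => hF.continuousOn_normalPart_chart he X₀

lemma derivFrame_coordFlow (hF : IsZeroMaslovLMCF o T F θ)
    (he : e ∈ atlas (EuclideanSpace ℝ (Fin n)) S) {p : ℝ × EuclideanSpace ℝ (Fin n)}
    (hp : p ∈ Ioo 0 T ×ˢ e.target) :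
    derivFrame (coordFlow F e) spaceDir p = coordTangent (F p.1) e p.2 := by
  have hp' : p ∈ Ico 0 T ×ˢ e.target := ⟨Ioo_subset_Ico_self hp.1, hp.2⟩
  funext k
  rw [hF.coordTangent_eq_fderivWithin he hp', derivFrame, fderivWithin_of_mem_nhds]
  exact mem_of_superset ((isOpen_Ioo.prod e.open_target).mem_nhds hp)
    (prod_mono Ioo_subset_Ico_self subset_rfl)

lemma fderiv_coordFlow_timeDir (hF : IsZeroMaslovLMCF o T F θ)
    (he : e ∈ atlas (EuclideanSpace ℝ (Fin n)) S) {p : ℝ × EuclideanSpace ℝ (Fin n)}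
    (hp : p ∈ Ioo 0 T ×ˢ e.target) :
    fderiv ℝ (coordFlow F e) p timeDir = meanCurvature (F p.1) (e.symm p.2) := by
  have hp' : p ∈ Ico 0 T ×ˢ e.target := ⟨Ioo_subset_Ico_self hp.1, hp.2⟩
  rw [hF.meanCurvature_eq_fderivWithin he hp', fderivWithin_of_mem_nhds]
  exact mem_of_superset ((isOpen_Ioo.prod e.open_target).mem_nhds hp)
    (prod_mono Ioo_subset_Ico_self subset_rfl)

/-- In a chart, a Lagrangian mean curvature flow satisfies the local hypotheses at all positive
times. -/
lemma isLocalFlowAt (hF : IsZeroMaslovLMCF o T F θ) (hn : 1 ≤ n)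
    (he : e ∈ atlas (EuclideanSpace ℝ (Fin n)) S) {p : ℝ × EuclideanSpace ℝ (Fin n)}
    (hp : p ∈ Ioo 0 T ×ˢ e.target) :
    IsLocalFlowAt (coordFlow F e) (coordAngle θ e) spaceDir timeDir p := by
  have hopen : IsOpen (Ioo 0 T ×ˢ e.target) := isOpen_Ioo.prod e.open_target
  have hnh := hopen.mem_nhds hp
  have hsub : Ioo 0 T ×ˢ e.target ⊆ Ico 0 T ×ˢ e.target :=
    prod_mono Ioo_subset_Ico_self subset_rfl
  have hico : ∀ {q : ℝ × EuclideanSpace ℝ (Fin n)}, q ∈ Ioo 0 T ×ˢ e.target → q.1 ∈ Ico 0 T :=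
    fun hq => (hsub hq).1
  have hF2 : ContDiffAt ℝ ∞ (coordFlow F e) p :=
    ((hF.contDiffOn_coordFlow he).mono hsub).contDiffAt hnh
  have hvol : derivVol (coordFlow F e) spaceDir p ≠ 0 := by
    rw [derivVol, hF.derivFrame_coordFlow he hp]
    exact hF.vol_ne_zero he (hsub hp)
  have hθc : ContinuousAt (coordAngle θ e) p := by
    have h1 : ContinuousOn (coordAngle θ e) (Ioo 0 T ×ˢ e.target) :=
      hF.angle_continuous.comp (f := fun q : ℝ × EuclideanSpace ℝ (Fin n) => (q.1, e.symm q.2))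
        (continuousOn_fst.prodMk (e.continuousOn_symm.comp continuousOn_snd fun q hq => hq.2))
        fun q hq => ⟨hico hq, mem_univ _⟩
    exact h1.continuousAt hnh
  have hang : ∀ᶠ q in 𝓝 p, derivVol (coordFlow F e) spaceDir q ^ 2 =
      Complex.exp (Complex.I * coordAngle θ e q) ^ 2 *
        (‖derivVol (coordFlow F e) spaceDir q‖ : ℂ) ^ 2 := by
    filter_upwards [hnh] with q hq
    rw [derivVol, hF.derivFrame_coordFlow he hq]
    exact holVolumeForm_coordTangent_sq hn (hF.contMDiff_slice (hico hq))
      (hF.lagrangian _ (hico hq)) (hF.angle _ (hico hq)) he hq.2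
  refine ⟨hF2, ?_, hvol, hθc, hang, ?_, ?_⟩
  · filter_upwards [hnh] with q hq
    rw [hF.derivFrame_coordFlow he hq]
    exact isIsotropic_coordTangent (hF.contMDiff_slice (hico hq)) (hF.lagrangian _ (hico hq)) he hq.2
  · filter_upwards [hnh] with q hq j
    rw [hF.derivFrame_coordFlow he hq, hF.fderiv_coordFlow_timeDir he hq]
    exact inner_coordTangent_meanCurvature (hF.contMDiff_slice (hico hq)) he hq.2 j
  · intro k
    rw [hF.derivFrame_coordFlow he hp, hF.fderiv_coordFlow_timeDir he hp]
    have h1 := (fderiv_angle_eq_inner_meanCurvature hn (hF.contMDiff_slice (hico hp))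
      (hF.immersion _ (hico hp)) (hF.lagrangian _ (hico hp)) (hF.angle _ (hico hp))
      (hF.continuous_angle (hico hp)) he hp.2).2 k
    rw [← h1]
    have hθd : DifferentiableAt ℝ (coordAngle θ e) p :=
      (contDiffAt_angle (m := 1) (contDiffAt_derivVol (m := 1)
        (hF2.of_le (m := 2) (WithTop.coe_le_coe.2 le_top)) (by norm_num)) hvol hθc
        hang).differentiableAt (by norm_num)
    have h2 : HasFDerivAt (fun u : EuclideanSpace ℝ (Fin n) => (p.1, u)) _ p.2 :=
      (hasFDerivAt_const (𝕜 := ℝ) p.1 p.2).prodMk (hasFDerivAt_id p.2)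
    have h3 := (hθd.hasFDerivAt (x := p)).comp p.2 h2
    have h4 : θ p.1 ∘ e.symm = coordAngle θ e ∘ fun u => (p.1, u) := rfl
    rw [h4, h3.fderiv]
    simp [spaceDir]

end IsZeroMaslovLMCF
end FlowInCharts

/-! ### Change of the area measure along the flow, and the integrands -/

section AreaFactor

variable {n : ℕ} {S : Type*} [TopologicalSpace S] [ChartedSpace (EuclideanSpace ℝ (Fin n)) S]

/-- The factor `exp (-∫₀ᵗ |H|²)` by which the area measure has changed at time `t`. -/
def areaFactor (F : ℝ → S → Cn n) (t : ℝ) (x : S) : ℝ :=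
  Real.exp (-∫ s in (0 : ℝ)..t, ‖meanCurvature (F s) x‖ ^ 2)

lemma areaFactor_pos (F : ℝ → S → Cn n) (t : ℝ) (x : S) : 0 < areaFactor F t x := Real.exp_pos _

lemma areaFactor_le_one (F : ℝ → S → Cn n) {t : ℝ} (ht : 0 ≤ t) (x : S) : areaFactor F t x ≤ 1 := by
  rw [areaFactor, Real.exp_le_one_iff, neg_nonpos]
  exact intervalIntegral.integral_nonneg ht fun s _ => by positivity

variable [IsManifold (𝓡 n) ∞ S]
  {o : ∀ x : S, Orientation ℝ (TangentSpace (𝓡 n) x) (Fin n)}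
  {T : ℝ} {F : ℝ → S → Cn n} {θ : ℝ → S → ℝ}
  {e : OpenPartialHomeomorph S (EuclideanSpace ℝ (Fin n))}

namespace IsZeroMaslovLMCF

lemma norm_derivVol_coordFlow (hF : IsZeroMaslovLMCF o T F θ)
    (he : e ∈ atlas (EuclideanSpace ℝ (Fin n)) S) {p : ℝ × EuclideanSpace ℝ (Fin n)}
    (hp : p ∈ Ioo 0 T ×ˢ e.target) :
    ‖derivVol (coordFlow F e) spaceDir p‖ = areaDensity (F p.1) e p.2 := by
  have ht : p.1 ∈ Ico 0 T := Ioo_subset_Ico_self hp.1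
  rw [derivVol, hF.derivFrame_coordFlow he hp,
    areaDensity_eq_norm (hF.contMDiff_slice ht) (hF.lagrangian _ ht) he hp.2]

lemma continuousOn_meanCurvature_time (hF : IsZeroMaslovLMCF o T F θ) (x : S) :
    ContinuousOn (fun s => meanCurvature (F s) x) (Ico 0 T) :=
  hF.continuousOn_meanCurvature.comp (f := fun s : ℝ => (s, x)) (by fun_prop)
    fun s hs => ⟨hs, mem_univ _⟩

/-- The area density, as the solution of `∂ₜ w = -|H|² w`. -/
lemma areaDensity_eq_areaFactor_mul (hF : IsZeroMaslovLMCF o T F θ) (hn : 1 ≤ n)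
    (he : e ∈ atlas (EuclideanSpace ℝ (Fin n)) S) {t : ℝ} (ht : t ∈ Ico 0 T)
    {u : EuclideanSpace ℝ (Fin n)} (hu : u ∈ e.target) :
    areaDensity (F t) e u = areaFactor F t (e.symm u) * areaDensity (F 0) e u := by
  set x := e.symm u with hx
  set k : ℝ → ℝ := fun s => ‖meanCurvature (F s) x‖ ^ 2 with hk
  have hkc : ContinuousOn k (Ico 0 T) := (hF.continuousOn_meanCurvature_time x).norm.pow 2
  set φ : ℝ → ℝ := fun s => ∫ r in (0 : ℝ)..s, k r with hφ
  set g : ℝ → ℝ := fun s => areaDensity (F s) e u with hg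
  have hgc : ContinuousOn g (Ico 0 T) := (hF.continuousOn_areaDensity he).comp
    (f := fun s : ℝ => (s, u)) (by fun_prop) fun s hs => ⟨hs, hu⟩
  have hg' : ∀ s ∈ Ioo 0 T, HasDerivAt g (-(k s * g s)) s := by
    intro s hs
    have hp : (s, u) ∈ Ioo 0 T ×ˢ e.target := ⟨hs, hu⟩
    have hfl := hF.isLocalFlowAt hn he hp
    have h1 := (hasLineDerivAt_fderiv_of_contDiffAt hfl.contDiffAt_norm_vol timeDir)
    rw [hfl.evolution.1, hF.fderiv_coordFlow_timeDir he hp, hF.norm_derivVol_coordFlow he hp] at h1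
    have h2 : HasDerivAt (fun r : ℝ => ‖derivVol (coordFlow F e) spaceDir ((s, u) + r • timeDir)‖)
      (-(k s * g s)) (s - s) := by rw [sub_self]; exact h1
    have h3 := h2.comp_sub_const s s
    refine h3.congr_of_eventuallyEq ?_
    filter_upwards [Ioo_mem_nhds hs.1 hs.2] with r hr
    have h4 : ((s, u) + (r - s) • timeDir : ℝ × EuclideanSpace ℝ (Fin n)) = (r, u) := by
      simp [timeDir]
    rw [h4, hF.norm_derivVol_coordFlow he (show (r, u) ∈ Ioo 0 T ×ˢ e.target from ⟨hr, hu⟩)]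
  have hint : ∀ s ∈ Ico 0 T, IntervalIntegrable k volume 0 s := fun s hs =>
    (hkc.mono fun r hr => by
      rw [uIcc_of_le hs.1] at hr
      exact ⟨hr.1, hr.2.trans_lt hs.2⟩).intervalIntegrable
  have hφ' : ∀ s ∈ Ioo 0 T, HasDerivAt φ (k s) s := by
    intro s hs
    have hnh : Ico 0 T ∈ 𝓝 s := mem_of_superset (Ioo_mem_nhds hs.1 hs.2) Ioo_subset_Ico_self
    refine intervalIntegral.integral_hasDerivAt_right (hint s (Ioo_subset_Ico_self hs)) ?_
      (hkc.continuousAt hnh)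
    exact ContinuousOn.stronglyMeasurableAtFilter isOpen_Ioo (hkc.mono Ioo_subset_Ico_self) s hs
  rcases ht.1.eq_or_lt with h0 | h0
  · subst h0; simp [areaFactor]
  have hsub : Icc 0 t ⊆ Ico 0 T := fun s hs => ⟨hs.1, hs.2.trans_lt ht.2⟩
  have hφc : ContinuousOn φ (Icc 0 t) := by
    have := intervalIntegral.continuousOn_primitive_interval (f := k) (μ := volume) (a := 0) (b := t)
      ((intervalIntegrable_iff_integrableOn_Icc_of_le h0.le).1 (hint t ht) |>.mono_set
        (by rw [uIcc_of_le h0.le]))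
    rwa [uIcc_of_le h0.le] at this
  obtain ⟨c, hc, hslope⟩ := exists_hasDerivAt_eq_slope (fun s => g s * Real.exp (φ s)) (fun _ => 0) h0
    ((hgc.mono hsub).mul (Real.continuous_exp.comp_continuousOn hφc)) (fun s hs => by
      have hs' : s ∈ Ioo 0 T := ⟨hs.1, hs.2.trans ht.2⟩
      refine ((hg' s hs').mul (hφ' s hs').exp).congr_deriv ?_
      ring)
  have h5 : g t * Real.exp (φ t) = g 0 := by
    have h6 : t - 0 ≠ 0 := by linarith
    have h7 := (div_eq_zero_iff.1 hslope.symm).resolve_right h6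
    have h8 : φ 0 = 0 := intervalIntegral.integral_same
    simp only [h8, Real.exp_zero, mul_one] at h7
    linarith
  change g t = Real.exp (-φ t) * g 0
  rw [← h5, Real.exp_neg]
  field_simp

lemma continuousOn_areaFactor (hF : IsZeroMaslovLMCF o T F θ) (hn : 1 ≤ n) :
    ContinuousOn (fun p : ℝ × S => areaFactor F p.1 p.2) (Ico 0 T ×ˢ univ) := by
  refine continuousOn_of_charts (n := n) (Q := fun t x => areaFactor F t x) fun e he => ?_
  by_cases hT : 0 < T
  · have h0 : (0 : ℝ) ∈ Ico 0 T := ⟨le_rfl, hT⟩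
    have h1 : ContinuousOn (fun p : ℝ × EuclideanSpace ℝ (Fin n) =>
        areaDensity (F p.1) e p.2 / areaDensity (F 0) e p.2) (Ico 0 T ×ˢ e.target) := by
      refine (hF.continuousOn_areaDensity he).div ?_ fun p hp =>
        (hF.areaDensity_pos he (p := (0, p.2)) ⟨h0, hp.2⟩).ne'
      exact (hF.continuousOn_areaDensity he).comp
        (f := fun p : ℝ × EuclideanSpace ℝ (Fin n) => ((0 : ℝ), p.2)) (by fun_prop)
        fun p hp => ⟨h0, hp.2⟩
    refine h1.congr fun p hp => ?_
    change areaFactor F p.1 (e.symm p.2) = areaDensity (F p.1) e p.2 / areaDensity (F 0) e p.2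
    rw [hF.areaDensity_eq_areaFactor_mul hn he hp.1 hp.2, mul_div_assoc,
      div_self (hF.areaDensity_pos he (p := (0, p.2)) ⟨h0, hp.2⟩).ne', mul_one]
  · rw [Ico_eq_empty hT, empty_prod]
    exact continuousOn_empty _

lemma continuous_areaFactor (hF : IsZeroMaslovLMCF o T F θ) (hn : 1 ≤ n) {t : ℝ} (ht : t ∈ Ico 0 T) :
    Continuous (areaFactor F t) :=
  (hF.continuousOn_areaFactor hn).comp_continuous (f := fun x : S => (t, x)) (by fun_prop)
    fun x => ⟨ht, mem_univ x⟩

variable [MeasurableSpace S] [BorelSpace S] [SecondCountableTopology S]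

/-- The area measure at time `t` is the initial one times `areaFactor F t`. Integrals at all times
can therefore be compared as integrals against the one measure `areaMeasure (F 0)`. -/
lemma areaMeasure_eq (hF : IsZeroMaslovLMCF o T F θ) (hn : 1 ≤ n) {t : ℝ} (ht : t ∈ Ico 0 T) :
    areaMeasure (F t) =
      (areaMeasure (F 0)).withDensity fun x => ENNReal.ofReal (areaFactor F t x) :=
  areaMeasure_eq_withDensity (hF.contMDiff_slice ⟨le_rfl, ht.1.trans_lt ht.2⟩)
    (hF.contMDiff_slice ht) (hF.continuous_areaFactor hn ht).measurable
    (fun x => (areaFactor_pos F t x).le) fun _ he _ hu => hF.areaDensity_eq_areaFactor_mul hn he ht hu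

lemma integral_areaMeasure (hF : IsZeroMaslovLMCF o T F θ) (hn : 1 ≤ n) {t : ℝ} (ht : t ∈ Ico 0 T)
    (h : S → ℝ) :
    ∫ x, h x ∂(areaMeasure (F t)) = ∫ x, areaFactor F t x * h x ∂(areaMeasure (F 0)) := by
  rw [hF.areaMeasure_eq hn ht, integral_withDensity_eq_integral_toReal_smul
    (hF.continuous_areaFactor hn ht).measurable.ennreal_ofReal
    (Eventually.of_forall fun _ => ENNReal.ofReal_lt_top)]
  simp only [ENNReal.toReal_ofReal (areaFactor_pos F t _).le, smul_eq_mul]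

lemma integrable_areaMeasure_iff (hF : IsZeroMaslovLMCF o T F θ) (hn : 1 ≤ n) {t : ℝ}
    (ht : t ∈ Ico 0 T) (h : S → ℝ) :
    Integrable h (areaMeasure (F t)) ↔
      Integrable (fun x => areaFactor F t x * h x) (areaMeasure (F 0)) := by
  rw [hF.areaMeasure_eq hn ht, integrable_withDensity_iff_integrable_smul'
    (hF.continuous_areaFactor hn ht).measurable.ennreal_ofReal
    (Eventually.of_forall fun _ => ENNReal.ofReal_lt_top)]
  simp only [ENNReal.toReal_ofReal (areaFactor_pos F t _).le, smul_eq_mul]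

lemma ae_areaMeasure_iff (hF : IsZeroMaslovLMCF o T F θ) (hn : 1 ≤ n) {t : ℝ} (ht : t ∈ Ico 0 T)
    {P : S → Prop} (h : ∀ᵐ x ∂(areaMeasure (F t)), P x) : ∀ᵐ x ∂(areaMeasure (F 0)), P x := by
  rw [hF.areaMeasure_eq hn ht, ae_withDensity_iff
    (hF.continuous_areaFactor hn ht).measurable.ennreal_ofReal] at h
  filter_upwards [h] with x hx
  exact hx (by simpa using areaFactor_pos F t x)

end IsZeroMaslovLMCF

end AreaFactor

section Integrands

variable {n : ℕ} {S : Type*} [TopologicalSpace S] [ChartedSpace (EuclideanSpace ℝ (Fin n)) S]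

/-- The integrand of the right hand side of the monotonicity formula. -/
def monotonicityIntegrand (F : ℝ → S → Cn n) (θ : ℝ → S → ℝ) (f : ℝ → ℝ) (X₀ : Cn n) (t₀ t : ℝ)
    (x : S) : ℝ :=
  -(f (θ t x) * rho (F t x) X₀ t t₀ *
    ‖meanCurvature (F t) x + (1 / (2 * (t₀ - t))) • normalPart (F t) x (F t x - X₀)‖ ^ 2) -
  deriv (deriv f) (θ t x) * ‖meanCurvature (F t) x‖ ^ 2 * rho (F t x) X₀ t t₀

/-- The tangential vector field, as a vector of `ℂⁿ`, whose flux through the boundary of a region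
is the boundary term of the monotonicity formula. -/
def fluxVec (F : ℝ → S → Cn n) (θ : ℝ → S → ℝ) (f : ℝ → ℝ) (X₀ : Cn n) (t₀ t : ℝ) (x : S) : Cn n :=
  rho (F t x) X₀ t t₀ • (deriv f (θ t x) • (-(Complex.I • meanCurvature (F t) x)) +
    (f (θ t x) / (2 * (t₀ - t))) • (F t x - X₀ - normalPart (F t) x (F t x - X₀)))

/-- The integrand of the monotonicity formula localized by the cutoff function `κ` of `ℂⁿ`. -/
def cutoffIntegrand (F : ℝ → S → Cn n) (θ : ℝ → S → ℝ) (f : ℝ → ℝ) (X₀ : Cn n) (t₀ : ℝ)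
    (κ : Cn n → ℝ) (t : ℝ) (x : S) : ℝ :=
  κ (F t x) * monotonicityIntegrand F θ f X₀ t₀ t x +
    fderiv ℝ κ (F t x) (meanCurvature (F t) x) * (f (θ t x) * rho (F t x) X₀ t t₀) -
    fderiv ℝ κ (F t x) (fluxVec F θ f X₀ t₀ t x)

/-- The tangent vector of `S` whose image under `dF` is `fluxVec`. As `dF` is injective and
`fluxVec` lies in its range, an arbitrary left inverse of `dF` yields this vector. -/
def fluxTangent (F : ℝ → S → Cn n) (θ : ℝ → S → ℝ) (f : ℝ → ℝ) (X₀ : Cn n) (t₀ t : ℝ) (x : S) :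
    TangentSpace (𝓡 n) x :=
  haveI : Nonempty (TangentSpace (𝓡 n) x) := ⟨(0 : EuclideanSpace ℝ (Fin n))⟩
  Function.invFun (differential (F t) x) (fluxVec F θ f X₀ t₀ t x)

/-- The derivative at `x` of the function `g` on `S` in the direction of the tangent vector `Y`. -/
def dirDeriv (g : S → ℝ) (x : S) (Y : TangentSpace (𝓡 n) x) : ℝ := mfderiv (𝓡 n) 𝓘(ℝ, ℝ) g x Y

/-- The integrand localized by the function `p` on `S` times the cutoff `κ` of `ℂⁿ`. -/
def patchIntegrand (F : ℝ → S → Cn n) (θ : ℝ → S → ℝ) (f : ℝ → ℝ) (X₀ : Cn n) (t₀ : ℝ)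
    (κ : Cn n → ℝ) (p : S → ℝ) (t : ℝ) (x : S) : ℝ :=
  p x * κ (F t x) * monotonicityIntegrand F θ f X₀ t₀ t x +
    p x * fderiv ℝ κ (F t x) (meanCurvature (F t) x) * (f (θ t x) * rho (F t x) X₀ t t₀) -
    dirDeriv (fun y => p y * κ (F t y)) x (fluxTangent F θ f X₀ t₀ t x)

variable [IsManifold (𝓡 n) ∞ S]
  {o : ∀ x : S, Orientation ℝ (TangentSpace (𝓡 n) x) (Fin n)}
  {T : ℝ} {F : ℝ → S → Cn n} {θ : ℝ → S → ℝ}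
  {e : OpenPartialHomeomorph S (EuclideanSpace ℝ (Fin n))}

namespace IsZeroMaslovLMCF

omit [IsManifold (𝓡 n) ∞ S] in
lemma fluxTangent_eq_of (hF : IsZeroMaslovLMCF o T F θ) {t : ℝ} (ht : t ∈ Ico 0 T) {f : ℝ → ℝ}
    {X₀ : Cn n} {t₀ : ℝ} {x : S} {Y : TangentSpace (𝓡 n) x}
    (hY : differential (F t) x Y = fluxVec F θ f X₀ t₀ t x) :
    fluxTangent F θ f X₀ t₀ t x = Y := by
  have : Nonempty (TangentSpace (𝓡 n) x) := ⟨(0 : EuclideanSpace ℝ (Fin n))⟩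
  rw [fluxTangent, ← hY]
  exact Function.leftInverse_invFun (hF.immersion t ht x) Y

/-- The flux vector in the coordinates of a chart. -/
lemma differential_sum_flux (hF : IsZeroMaslovLMCF o T F θ) (hn : 1 ≤ n)
    (he : e ∈ atlas (EuclideanSpace ℝ (Fin n)) S) {t : ℝ} (ht : t ∈ Ioo 0 T)
    {u : EuclideanSpace ℝ (Fin n)} (hu : u ∈ e.target) (f : ℝ → ℝ) (X₀ : Cn n) (t₀ : ℝ) :
    differential (F t) (e.symm u) (∑ k, (rho (F t (e.symm u)) X₀ t t₀ *
      (deriv f (θ t (e.symm u)) * velCoord (coordFlow F e) spaceDir timeDir k (t, u) +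
        f (θ t (e.symm u)) * posCoord (coordFlow F e) spaceDir X₀ k (t, u) /
          (2 * (t₀ - t)))) • chartBasis he hu k) = fluxVec F θ f X₀ t₀ t (e.symm u) := by
  have ht' := Ioo_subset_Ico_self ht
  have hp : (t, u) ∈ Ioo 0 T ×ˢ e.target := ⟨ht, hu⟩
  have hfl := hF.isLocalFlowAt hn he hp
  have hct : ∀ k, differential (F t) (e.symm u) (chartBasis he hu k) =
      derivFrame (coordFlow F e) spaceDir (t, u) k := fun k => by
    rw [hF.derivFrame_coordFlow he hp, coordTangent_eq (hF.contMDiff_slice ht') he hu]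
  have hH : -(Complex.I • meanCurvature (F t) (e.symm u)) =
      ∑ k, velCoord (coordFlow F e) spaceDir timeDir k (t, u) •
        derivFrame (coordFlow F e) spaceDir (t, u) k := by
    rw [← hF.fderiv_coordFlow_timeDir he hp, hfl.vel_eq_sum, Finset.smul_sum,
      ← Finset.sum_neg_distrib]
    refine Finset.sum_congr rfl fun k _ => ?_
    rw [smul_smul, ← mul_assoc, Complex.I_mul_I, neg_one_mul, neg_smul, neg_neg, Complex.coe_smul]
  have hN := (hfl.normalPos_facts X₀ rfl).1
  have hsp : (Submodule.span ℝ (range (derivFrame (coordFlow F e) spaceDir (t, u))))ᗮ.starProjection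
      (coordFlow F e (t, u) - X₀) = normalPart (F t) (e.symm u) (F t (e.symm u) - X₀) := by
    rw [hF.derivFrame_coordFlow he hp, normalPart_eq (hF.contMDiff_slice ht') he hu]
    rfl
  rw [hsp] at hN
  have hT : F t (e.symm u) - X₀ - normalPart (F t) (e.symm u) (F t (e.symm u) - X₀) =
      ∑ k, posCoord (coordFlow F e) spaceDir X₀ k (t, u) •
        derivFrame (coordFlow F e) spaceDir (t, u) k := sub_eq_of_eq_add hN
  rw [fluxVec, hH, hT, map_sum, Finset.smul_sum, Finset.smul_sum, ← Finset.sum_add_distrib,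
    Finset.smul_sum]
  refine Finset.sum_congr rfl fun k _ => ?_
  rw [map_smul, hct, smul_smul, smul_smul, ← add_smul, smul_smul]
  congr 1
  ring

end IsZeroMaslovLMCF
end Integrands

/-! ### Localization to a chart -/

section Patch

variable {n : ℕ} {S : Type*} [TopologicalSpace S] [ChartedSpace (EuclideanSpace ℝ (Fin n)) S]

/-- The test function `p · κ(F)` in the chart `e`, extended by zero. -/
def patchTest (F : ℝ → S → Cn n) (κ : Cn n → ℝ) (p : S → ℝ)
    (e : OpenPartialHomeomorph S (EuclideanSpace ℝ (Fin n)))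
    (q : ℝ × EuclideanSpace ℝ (Fin n)) : ℝ :=
  e.target.indicator (fun u => p (e.symm u) * κ (F q.1 (e.symm u))) q.2

variable [IsManifold (𝓡 n) ∞ S]
  {o : ∀ x : S, Orientation ℝ (TangentSpace (𝓡 n) x) (Fin n)}
  {T : ℝ} {F : ℝ → S → Cn n} {θ : ℝ → S → ℝ}
  {e : OpenPartialHomeomorph S (EuclideanSpace ℝ (Fin n))}

namespace IsZeroMaslovLMCF

lemma contDiffOn_comp_symm_real {p : S → ℝ} (hp : ContMDiff (𝓡 n) 𝓘(ℝ, ℝ) ∞ p)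
    (he : e ∈ atlas (EuclideanSpace ℝ (Fin n)) S) : ContDiffOn ℝ ∞ (p ∘ e.symm) e.target := by
  rw [← contMDiffOn_iff_contDiffOn]
  exact hp.comp_contMDiffOn (contMDiffOn_symm_of_mem_maximalAtlas (I := 𝓡 n) (n := ∞)
      (IsManifold.subset_maximalAtlas he))

lemma hasFDerivAt_patchTest (hF : IsZeroMaslovLMCF o T F θ) (hn : 1 ≤ n)
    (he : e ∈ atlas (EuclideanSpace ℝ (Fin n)) S) {κ : Cn n → ℝ} (hκ : ContDiff ℝ 1 κ)
    {p : S → ℝ} (hp : ContMDiff (𝓡 n) 𝓘(ℝ, ℝ) ∞ p) {q : ℝ × EuclideanSpace ℝ (Fin n)}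
    (hq : q ∈ Ioo 0 T ×ˢ e.target) :
    ContDiffAt ℝ 1 (patchTest F κ p e) q ∧
    fderiv ℝ (patchTest F κ p e) q timeDir =
      p (e.symm q.2) * fderiv ℝ κ (F q.1 (e.symm q.2)) (meanCurvature (F q.1) (e.symm q.2)) ∧
    ∀ k, fderiv ℝ (patchTest F κ p e) q (spaceDir k) =
      dirDeriv (fun y => p y * κ (F q.1 y)) (e.symm q.2) (chartBasis he hq.2 k) := by
  have hev : patchTest F κ p e =ᶠ[𝓝 q]
      fun r => (p ∘ e.symm) r.2 * κ (coordFlow F e r) := by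
    filter_upwards [(isOpen_Ioo.prod e.open_target).mem_nhds hq] with r hr
    rw [patchTest, indicator_of_mem hr.2]
    rfl
  have hfl := hF.isLocalFlowAt hn he hq
  have hF1 : ContDiffAt ℝ 1 (coordFlow F e) q :=
    hfl.contDiffAt.of_le (WithTop.coe_le_coe.2 le_top)
  have hp1 : ContDiffAt ℝ 1 (p ∘ e.symm) q.2 :=
    ((contDiffOn_comp_symm_real hp he).contDiffAt (e.open_target.mem_nhds hq.2)).of_le
      (WithTop.coe_le_coe.2 le_top)
  have h1 : ContDiffAt ℝ 1 (patchTest F κ p e) q :=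
    ((hp1.comp q contDiffAt_snd).mul (hκ.contDiffAt.comp q hF1)).congr_of_eventuallyEq hev
  have hpd := (hp1.differentiableAt (by norm_num)).hasFDerivAt.comp q
    (hasFDerivAt_snd (𝕜 := ℝ) (E := ℝ) (F := EuclideanSpace ℝ (Fin n)))
  have hκd := ((hκ.differentiable (by norm_num)) (coordFlow F e q)).hasFDerivAt.comp q
    (hF1.differentiableAt (by norm_num)).hasFDerivAt
  refine ⟨h1, ?_, fun k => ?_⟩
  · rw [hev.fderiv_eq]
    have h2 := (hpd.mul hκd).fderiv
    have h3 : fderiv ℝ (fun r => (p ∘ e.symm) r.2 * κ (coordFlow F e r)) q = _ := h2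
    rw [h3]
    simp only [_root_.add_apply, _root_.smul_apply,
      ContinuousLinearMap.comp_apply, hF.fderiv_coordFlow_timeDir he hq, Function.comp_apply]
    simp [timeDir, coordFlow]
  · have h2 : HasFDerivAt (fun u : EuclideanSpace ℝ (Fin n) => (q.1, u)) _ q.2 :=
      (hasFDerivAt_const (𝕜 := ℝ) q.1 q.2).prodMk (hasFDerivAt_id q.2)
    have h3 := ((h1.differentiableAt (by norm_num)).hasFDerivAt (x := q)).comp q.2 h2
    have h4 : (fun y => p y * κ (F q.1 y)) ∘ e.symm =ᶠ[𝓝 q.2]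
        patchTest F κ p e ∘ fun u => (q.1, u) := by
      filter_upwards [e.open_target.mem_nhds hq.2] with u hu
      simp [patchTest, hu]
    have hFt : ContMDiff (𝓡 n) 𝓘(ℝ, Cn n) 1 (F q.1) :=
      (hF.contMDiff_slice (Ioo_subset_Ico_self hq.1)).of_le (WithTop.coe_le_coe.2 le_top)
    have h5 : ContMDiff (𝓡 n) 𝓘(ℝ, ℝ) 1 (fun y => p y * κ (F q.1 y)) :=
      (hp.of_le (WithTop.coe_le_coe.2 le_top)).mul (hκ.contMDiff.comp hFt)
    rw [dirDeriv, ← fderiv_comp_chart_symm (h5.mdifferentiableAt (by norm_num)) he hq.2 k,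
      h4.fderiv_eq, h3.fderiv]
    simp [spaceDir]

/-- The coordinate expression `localIntegrand` is chart independent: it represents the function
`patchIntegrand` on `S`. -/
lemma localIntegrand_patchTest (hF : IsZeroMaslovLMCF o T F θ) (hn : 1 ≤ n)
    (he : e ∈ atlas (EuclideanSpace ℝ (Fin n)) S) {κ : Cn n → ℝ} (hκ : ContDiff ℝ 1 κ)
    {p : S → ℝ} (hp : ContMDiff (𝓡 n) 𝓘(ℝ, ℝ) ∞ p) {t : ℝ} (ht : t ∈ Ioo 0 T)
    {u : EuclideanSpace ℝ (Fin n)} (hu : u ∈ e.target) (f : ℝ → ℝ) (X₀ : Cn n) (t₀ : ℝ) :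
    localIntegrand (coordFlow F e) (coordAngle θ e) f X₀ t₀ (patchTest F κ p e) (t, u) =
      patchIntegrand F θ f X₀ t₀ κ p t (e.symm u) := by
  have hq : (t, u) ∈ Ioo 0 T ×ˢ e.target := ⟨ht, hu⟩
  have ht' := Ioo_subset_Ico_self ht
  obtain ⟨-, h1, h2⟩ := hF.hasFDerivAt_patchTest hn he hκ hp hq
  have hsp : (Submodule.span ℝ (range (derivFrame (coordFlow F e) spaceDir (t, u))))ᗮ.starProjection
      (coordFlow F e (t, u) - X₀) = normalPart (F t) (e.symm u) (F t (e.symm u) - X₀) := by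
    rw [hF.derivFrame_coordFlow he hq, normalPart_eq (hF.contMDiff_slice ht') he hu]
    rfl
  rw [localIntegrand, patchIntegrand, hsp, h1, hF.fderiv_coordFlow_timeDir he hq,
    hF.fluxTangent_eq_of ht' (hF.differential_sum_flux hn he ht hu f X₀ t₀)]
  have h3 : ∀ c : Fin n → ℝ, dirDeriv (fun y => p y * κ (F t y)) (e.symm u)
      (∑ k, c k • chartBasis he hu k) =
      ∑ k, dirDeriv (fun y => p y * κ (F t y)) (e.symm u) (chartBasis he hu k) * c k := by
    intro c
    set L : TangentSpace (𝓡 n) (e.symm u) →L[ℝ] ℝ :=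
      mfderiv (𝓡 n) 𝓘(ℝ, ℝ) (fun y => p y * κ (F t y)) (e.symm u)
    change L _ = ∑ k, L _ * _
    rw [map_sum]
    refine Finset.sum_congr rfl fun k _ => ?_
    rw [map_smul, smul_eq_mul, mul_comm]
  rw [h3]
  have h4 : patchTest F κ p e (t, u) = p (e.symm u) * κ (F t (e.symm u)) := by
    simp [patchTest, hu]
  rw [h4]
  simp only [h2]
  rfl

variable [MeasurableSpace S] [BorelSpace S] [SecondCountableTopology S]

/-- The monotonicity formula localized to a chart. -/
lemma hasDerivAt_integral_patch [T2Space S] (hF : IsZeroMaslovLMCF o T F θ) (hn : 1 ≤ n)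
    (he : e ∈ atlas (EuclideanSpace ℝ (Fin n)) S) {f : ℝ → ℝ} (hf : ContDiff ℝ 1 f)
    (hf'' : PiecewiseContinuousSecondDeriv f) (X₀ : Cn n) {t₀ b : ℝ} (hbT : b ≤ T) (hb : b ≤ t₀)
    {κ : Cn n → ℝ} (hκ : ContDiff ℝ 1 κ) {p : S → ℝ} (hp : ContMDiff (𝓡 n) 𝓘(ℝ, ℝ) ∞ p)
    (hpe : tsupport p ⊆ e.source) {K : Set S} (hK : IsCompact K)
    (hκ0 : ∀ s ∈ Ioo 0 b, ∀ x ∉ K, κ (F s x) = 0) {t : ℝ} (ht : t ∈ Ioo 0 b) :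
    Integrable (patchIntegrand F θ f X₀ t₀ κ p t) (areaMeasure (F t)) ∧
    (∀ s ∈ Ioo 0 b, Integrable (fun x => p x * κ (F s x) * (f (θ s x) * rho (F s x) X₀ s t₀))
      (areaMeasure (F s))) ∧
    HasDerivAt (fun s => ∫ x, p x * κ (F s x) * (f (θ s x) * rho (F s x) X₀ s t₀)
      ∂(areaMeasure (F s))) (∫ x, patchIntegrand F θ f X₀ t₀ κ p t x ∂(areaMeasure (F t))) t := by
  have hsub : Ioo 0 b ⊆ Ioo 0 T := Ioo_subset_Ioo_right hbT
  set K' : Set (EuclideanSpace ℝ (Fin n)) := e '' (K ∩ tsupport p) with hK'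
  have hK'c : IsCompact K' := (hK.inter_right (isClosed_tsupport p)).image_of_continuousOn
    (e.continuousOn.mono fun x hx => hpe hx.2)
  have hK'U : K' ⊆ e.target := by
    rintro _ ⟨x, hx, rfl⟩
    exact e.map_source (hpe hx.2)
  -- off `K'` the test function vanishes
  have hz : ∀ s ∈ Ioo 0 b, ∀ u ∈ e.target, u ∉ K' → p (e.symm u) * κ (F s (e.symm u)) = 0 := by
    intro s hs u hu hnu
    by_cases hxK : e.symm u ∈ K
    · by_cases hxp : e.symm u ∈ tsupport p
      · exact absurd ⟨e.symm u, ⟨hxK, hxp⟩, e.right_inv hu⟩ hnu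
      · rw [image_eq_zero_of_notMem_tsupport hxp, zero_mul]
    · rw [hκ0 s hs _ hxK, mul_zero]
  have hη0 : ∀ s ∈ Ioo 0 b, ∀ u ∉ K', patchTest F κ p e (s, u) = 0 := by
    intro s hs u hu
    by_cases hut : u ∈ e.target
    · simpa [patchTest, hut] using hz s hs u hut hu
    · simp [patchTest, hut]
  have hloc := hasDerivAt_integral_local (F := coordFlow F e) (θ := coordAngle θ e)
    e.open_target hK'c hK'U (a := 0) (b := b)
    (fun q hq => hF.isLocalFlowAt hn he ⟨hsub hq.1, hq.2⟩) hf hf'' X₀ hb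
    (η := patchTest F κ p e)
    (fun q hq => (hF.hasFDerivAt_patchTest hn he hκ hp ⟨hsub hq.1, hq.2⟩).1) hη0 ht
  have hvol : ∀ s ∈ Ioo 0 b, ∀ u ∈ e.target,
      ‖derivVol (coordFlow F e) spaceDir (s, u)‖ = areaDensity (F s) e u := fun s hs u hu =>
    hF.norm_derivVol_coordFlow he ⟨hsub hs, hu⟩
  have hmt := e.open_target.measurableSet
  -- the integral of the test function over a time slice, in the chart
  have hslice : ∀ s ∈ Ioo 0 b,
      Integrable (fun x => p x * κ (F s x) * (f (θ s x) * rho (F s x) X₀ s t₀))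
        (areaMeasure (F s)) ∧
      ∫ x, p x * κ (F s x) * (f (θ s x) * rho (F s x) X₀ s t₀) ∂(areaMeasure (F s)) =
      ∫ u in e.target, patchTest F κ p e (s, u) * (f (coordAngle θ e (s, u)) *
        rho (coordFlow F e (s, u)) X₀ s t₀ * ‖derivVol (coordFlow F e) spaceDir (s, u)‖) := by
    intro s hs
    have hs' := Ioo_subset_Ico_self (hsub hs)
    have hFs := hF.contMDiff_slice hs'
    have hρc : Continuous fun x => rho (F s x) X₀ s t₀ := by
      have := hFs.continuous
      unfold rho
      fun_prop
    have hcont : Continuous fun x => p x * κ (F s x) * (f (θ s x) * rho (F s x) X₀ s t₀) :=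
      (hp.continuous.mul (hκ.continuous.comp hFs.continuous)).mul
        ((hf.continuous.comp (hF.continuous_angle hs')).mul hρc)
    have hint : IntegrableOn (fun u => areaDensity (F s) e u * (p (e.symm u) * κ (F s (e.symm u)) *
        (f (θ s (e.symm u)) * rho (F s (e.symm u)) X₀ s t₀))) e.target := by
      refine IntegrableOn.of_forall_sdiff_eq_zero (s := K') ?_ hmt fun u hu => ?_
      · refine ContinuousOn.integrableOn_compact hK'c ?_
        refine ((_root_.LagrangianMCF.continuousOn_areaDensity hFs he).mul
          (hcont.comp_continuousOn e.continuousOn_symm)).mono hK'U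
      · rw [hz s hs u hu.1 hu.2]; ring
    have h1 := integral_areaMeasure_of_chart hFs he
      (h := fun x => p x * κ (F s x) * (f (θ s x) * rho (F s x) X₀ s t₀)) (fun x hx => by
        rw [image_eq_zero_of_notMem_tsupport fun h => hx (hpe h)]; ring) hint
    refine ⟨h1.1, h1.2.trans (setIntegral_congr_fun hmt fun u hu => ?_)⟩
    simp only [hvol s hs u hu, patchTest, indicator_of_mem hu, coordAngle, coordFlow]
    ring
  have hmain : ∀ u ∈ e.target, ‖derivVol (coordFlow F e) spaceDir (t, u)‖ *
      localIntegrand (coordFlow F e) (coordAngle θ e) f X₀ t₀ (patchTest F κ p e) (t, u) =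
      areaDensity (F t) e u * patchIntegrand F θ f X₀ t₀ κ p t (e.symm u) := fun u hu => by
    rw [hvol t ht u hu, hF.localIntegrand_patchTest hn he hκ hp (hsub ht) hu]
  have hp0 : ∀ x ∉ e.source, patchIntegrand F θ f X₀ t₀ κ p t x = 0 := by
    intro x hx
    have hxp : x ∉ tsupport p := fun h => hx (hpe h)
    have hev : (fun y => p y * κ (F t y)) =ᶠ[𝓝 x] fun _ => 0 := by
      filter_upwards [notMem_tsupport_iff_eventuallyEq.1 hxp] with y hy
      rw [hy]; simp
    have hd : dirDeriv (fun y => p y * κ (F t y)) x (fluxTangent F θ f X₀ t₀ t x) = 0 := by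
      rw [dirDeriv, hev.mfderiv_eq, mfderiv_const]
      rfl
    rw [patchIntegrand, image_eq_zero_of_notMem_tsupport hxp, hd]
    ring
  have hpatch := integral_areaMeasure_of_chart (hF.contMDiff_slice (Ioo_subset_Ico_self (hsub ht)))
    he hp0 (hloc.1.congr_fun hmain hmt)
  refine ⟨hpatch.1, fun s hs => (hslice s hs).1, ?_⟩
  rw [hpatch.2, ← setIntegral_congr_fun hmt hmain]
  refine hloc.2.congr_of_eventuallyEq ?_
  filter_upwards [Ioo_mem_nhds ht.1 ht.2] with s hs
  exact (hslice s hs).2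

end IsZeroMaslovLMCF
end Patch

/-! ### Localization by a cutoff function of `ℂⁿ` -/

section Cutoff

variable {n : ℕ} {S : Type*} [TopologicalSpace S] [ChartedSpace (EuclideanSpace ℝ (Fin n)) S]
  [IsManifold (𝓡 n) ∞ S]
  {o : ∀ x : S, Orientation ℝ (TangentSpace (𝓡 n) x) (Fin n)}
  {T : ℝ} {F : ℝ → S → Cn n} {θ : ℝ → S → ℝ}

namespace IsZeroMaslovLMCF

lemma differential_fluxTangent (hF : IsZeroMaslovLMCF o T F θ) (hn : 1 ≤ n) {t : ℝ}
    (ht : t ∈ Ioo 0 T) (f : ℝ → ℝ) (X₀ : Cn n) (t₀ : ℝ) (x : S) :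
    differential (F t) x (fluxTangent F θ f X₀ t₀ t x) = fluxVec F θ f X₀ t₀ t x := by
  have key : ∀ y : S, (∃ Y, differential (F t) y Y = fluxVec F θ f X₀ t₀ t y) →
      differential (F t) y (fluxTangent F θ f X₀ t₀ t y) = fluxVec F θ f X₀ t₀ t y := by
    rintro y ⟨Y, hY⟩
    rw [hF.fluxTangent_eq_of (Ioo_subset_Ico_self ht) hY, hY]
  set e := chartAt (EuclideanSpace ℝ (Fin n)) x with he
  have h := key (e.symm (e x)) ⟨_, hF.differential_sum_flux hn (chart_mem_atlas _ x) ht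
    (mem_chart_target _ x) f X₀ t₀⟩
  rwa [e.left_inv (mem_chart_source _ x)] at h

omit [IsManifold (𝓡 n) ∞ S] in
lemma hasDerivAt_flow (hF : IsZeroMaslovLMCF o T F θ) {t : ℝ} (ht : t ∈ Ioo 0 T) (x : S) :
    HasDerivAt (fun s => F s x) (meanCurvature (F t) x) t :=
  (hF.mean_curvature_flow t (Ioo_subset_Ico_self ht) x).hasDerivAt
    (mem_of_superset (Ioo_mem_nhds ht.1 ht.2) Ioo_subset_Ico_self)

/-- The localizations by the members of a partition of unity add up. The derivatives of the
partition functions cancel, as they sum to a constant where `κ` is not zero. -/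
lemma sum_patchIntegrand (hF : IsZeroMaslovLMCF o T F θ) (hn : 1 ≤ n) (f : ℝ → ℝ) (X₀ : Cn n)
    (t₀ : ℝ) {b : ℝ} (hbT : b ≤ T) {κ : Cn n → ℝ} (hκ : ContDiff ℝ 1 κ) {ι : Type} [Fintype ι]
    {p : ι → S → ℝ} (hp : ∀ i, ContMDiff (𝓡 n) 𝓘(ℝ, ℝ) ∞ (p i)) {K : Set S}
    (hp1 : ∀ x ∈ K, ∑ i, p i x = 1) (hκ0 : ∀ s ∈ Ioo 0 b, ∀ x ∉ K, κ (F s x) = 0)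
    {t : ℝ} (ht : t ∈ Ioo 0 b) (x : S) :
    ∑ i, patchIntegrand F θ f X₀ t₀ κ (p i) t x = cutoffIntegrand F θ f X₀ t₀ κ t x := by
  have htT : t ∈ Ioo 0 T := Ioo_subset_Ioo_right hbT ht
  have hFt : ContMDiff (𝓡 n) 𝓘(ℝ, Cn n) 1 (F t) :=
    (hF.contMDiff_slice (Ioo_subset_Ico_self htT)).of_le (WithTop.coe_le_coe.2 le_top)
  have hA : ∀ y, ∑ i, p i y * κ (F t y) = κ (F t y) := fun y => by
    rw [← Finset.sum_mul]
    by_cases hy : y ∈ K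
    · rw [hp1 y hy, one_mul]
    · rw [hκ0 t ht y hy, mul_zero]
  -- off `K` the function `κ` vanishes along the flow, and so does its time derivative
  have hB : ∑ i, p i x * fderiv ℝ κ (F t x) (meanCurvature (F t) x) =
      fderiv ℝ κ (F t x) (meanCurvature (F t) x) := by
    rw [← Finset.sum_mul]
    by_cases hy : x ∈ K
    · rw [hp1 x hy, one_mul]
    · have h1 := ((hκ.differentiable (by norm_num)) (F t x)).hasFDerivAt.comp_hasDerivAt t
        (hF.hasDerivAt_flow htT x)
      have h2 : HasDerivAt (κ ∘ fun s => F s x) 0 t := by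
        refine (hasDerivAt_const t (0 : ℝ)).congr_of_eventuallyEq ?_
        filter_upwards [Ioo_mem_nhds ht.1 ht.2] with s hs
        exact hκ0 s hs x hy
      rw [h1.unique h2, mul_zero]
  have hC : ∑ i, dirDeriv (fun y => p i y * κ (F t y)) x (fluxTangent F θ f X₀ t₀ t x) =
      fderiv ℝ κ (F t x) (fluxVec F θ f X₀ t₀ t x) := by
    have h1 : ∀ i ∈ Finset.univ, HasMFDerivAt (𝓡 n) 𝓘(ℝ, ℝ) (fun y => p i y * κ (F t y)) x
        (mfderiv (𝓡 n) 𝓘(ℝ, ℝ) (fun y => p i y * κ (F t y)) x) := fun i _ =>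
      ((((hp i).of_le (WithTop.coe_le_coe.2 le_top)).mul
        (hκ.contMDiff.comp hFt)).mdifferentiableAt (n := 1) (by norm_num)).hasMFDerivAt
    have h2 := HasMFDerivAt.sum (t := Finset.univ) (f := fun i y => p i y * κ (F t y))
      (f' := fun i => mfderiv (𝓡 n) 𝓘(ℝ, ℝ) (fun y => p i y * κ (F t y)) x) h1
    have h3 : (∑ i, fun y => p i y * κ (F t y)) = κ ∘ F t := by
      funext y
      rw [Finset.sum_apply]
      exact hA y
    rw [h3] at h2
    have h4 := ((hκ.differentiable (by norm_num)) (F t x)).hasFDerivAt.hasMFDerivAt.comp x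
      (hFt.mdifferentiableAt (by norm_num)).hasMFDerivAt
    have h5 := hasMFDerivAt_unique h2 h4
    have h6 := DFunLike.congr_fun h5 (fluxTangent F θ f X₀ t₀ t x)
    have h7 : differential (F t) x (fluxTangent F θ f X₀ t₀ t x) = _ :=
      hF.differential_fluxTangent hn htT f X₀ t₀ x
    rw [← h7]
    refine Eq.trans ?_ h6
    set L : ι → TangentSpace (𝓡 n) x →L[ℝ] ℝ := fun i =>
      mfderiv (𝓡 n) 𝓘(ℝ, ℝ) (fun y => p i y * κ (F t y)) x
    change ∑ i, L i _ = (∑ i, L i) _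
    rw [_root_.sum_apply]
  simp only [patchIntegrand, cutoffIntegrand]
  rw [Finset.sum_sub_distrib, Finset.sum_add_distrib, hC, ← Finset.sum_mul, hA, ← Finset.sum_mul, hB]

variable [MeasurableSpace S] [BorelSpace S] [SecondCountableTopology S]

/-- The monotonicity formula localized by a cutoff function of `ℂⁿ`. -/
lemma hasDerivAt_integral_cutoff [T2Space S] (hF : IsZeroMaslovLMCF o T F θ) (hn : 1 ≤ n)
    {f : ℝ → ℝ} (hf : ContDiff ℝ 1 f)
    (hf'' : PiecewiseContinuousSecondDeriv f) (X₀ : Cn n) {t₀ b : ℝ} (hbT : b ≤ T) (hb : b ≤ t₀)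
    {κ : Cn n → ℝ} (hκ : ContDiff ℝ 1 κ) {K : Set S} (hK : IsCompact K)
    (hκ0 : ∀ s ∈ Ioo 0 b, ∀ x ∉ K, κ (F s x) = 0) {t : ℝ} (ht : t ∈ Ioo 0 b) :
    HasDerivAt (fun s => ∫ x, κ (F s x) * (f (θ s x) * rho (F s x) X₀ s t₀)
      ∂(areaMeasure (F s))) (∫ x, cutoffIntegrand F θ f X₀ t₀ κ t x ∂(areaMeasure (F t))) t := by
  obtain ⟨A, -, hA⟩ := hK.elim_nhds_subcover
    (fun x : S => (chartAt (EuclideanSpace ℝ (Fin n)) x).source)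
    (fun x _ => chart_source_mem_nhds _ x)
  have : LocallyCompactSpace S := ChartedSpace.locallyCompactSpace (EuclideanSpace ℝ (Fin n)) S
  set c : Fin A.card → S := fun i => (A.equivFin.symm i : S) with hc
  obtain ⟨p, hp⟩ := SmoothPartitionOfUnity.exists_isSubordinate (𝓡 n) hK.isClosed
    (fun i => (chartAt (EuclideanSpace ℝ (Fin n)) (c i)).source)
    (fun i => (chartAt _ _).open_source) (fun x hx => by
      obtain ⟨y, hyA, hy⟩ := mem_iUnion₂.1 (hA hx)
      exact mem_iUnion.2 ⟨A.equivFin ⟨y, hyA⟩, by simpa [hc] using hy⟩)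
  have hp1 : ∀ x ∈ K, ∑ i, p i x = 1 := fun x hx => by
    rw [← finsum_eq_sum_of_fintype]
    exact p.sum_eq_one hx
  have hloc := fun i => hF.hasDerivAt_integral_patch hn (chart_mem_atlas _ (c i)) hf hf'' X₀
    hbT hb hκ (p i).contMDiff (hp i) hK hκ0 ht
  have h1 := HasDerivAt.fun_sum (u := Finset.univ) fun i _ => (hloc i).2.2
  rw [← integral_finsetSum _ fun i _ => (hloc i).1] at h1
  simp only [hF.sum_patchIntegrand hn f X₀ t₀ hbT hκ (fun i => (p i).contMDiff) hp1 hκ0 ht] at h1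
  refine h1.congr_of_eventuallyEq ?_
  filter_upwards [Ioo_mem_nhds ht.1 ht.2] with s hs
  rw [← integral_finsetSum _ fun i _ => (hloc i).2.1 s hs]
  refine integral_congr_ae (Eventually.of_forall fun x => ?_)
  simp only
  rw [← Finset.sum_mul, ← Finset.sum_mul]
  by_cases hx : x ∈ K
  · rw [hp1 x hx, one_mul]
  · rw [hκ0 s hs x hx]; ring

end IsZeroMaslovLMCF
end Cutoff

/-! ### Gaussian domination -/

section GaussianBounds

variable {n : ℕ}

/-- The backward heat kernel, even with a quadratic weight, is dominated by a fixed Gaussian, as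
long as the base point moves a bounded distance. -/
lemma exists_rho_le (X₀ : Cn n) {b t₀ : ℝ} (hb0 : 0 ≤ b) (hb : b < t₀) (D : ℝ) :
    ∃ M c : ℝ, 0 ≤ M ∧ 0 < c ∧ ∀ s ∈ Icc 0 b, ∀ X Y : Cn n, ‖X - Y‖ ≤ D →
      (1 + ‖X - X₀‖ ^ 2) * rho X X₀ s t₀ ≤ M * Real.exp (-c * ‖Y‖ ^ 2) := by
  have ht₀ : 0 < t₀ := hb0.trans_lt hb
  set δ := t₀ - b with hδ
  have hδ0 : 0 < δ := sub_pos.2 hb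
  set E := D + ‖X₀‖ with hE
  refine ⟨1 / (4 * Real.pi * δ) ^ ((n : ℝ) / 2) * ((1 + 8 * t₀) * Real.exp (E ^ 2 / (8 * t₀))),
    1 / (16 * t₀), by positivity, by positivity, fun s hs X Y hXY => ?_⟩
  have hτ : δ ≤ t₀ - s := by rw [hδ]; linarith [hs.2]
  have hτ' : t₀ - s ≤ t₀ := by linarith [hs.1]
  have hτ0 : 0 < t₀ - s := hδ0.trans_le hτ
  set v := ‖X - X₀‖ with hv
  have hv0 : 0 ≤ v := norm_nonneg _
  have hY : ‖Y‖ ≤ v + E := by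
    have h1 : Y = (X - X₀) - (X - Y) + X₀ := by abel
    calc ‖Y‖ = ‖(X - X₀) - (X - Y) + X₀‖ := by rw [← h1]
      _ ≤ ‖(X - X₀) - (X - Y)‖ + ‖X₀‖ := norm_add_le _ _
      _ ≤ ‖X - X₀‖ + ‖X - Y‖ + ‖X₀‖ := by gcongr; exact norm_sub_le _ _
      _ ≤ v + E := by rw [hE]; linarith
  have hY2 : ‖Y‖ ^ 2 ≤ 2 * v ^ 2 + 2 * E ^ 2 := by
    have : ‖Y‖ ^ 2 ≤ (v + E) ^ 2 := by gcongr
    nlinarith [sq_nonneg (v - E)]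
  have h1 : 1 / (4 * Real.pi * (t₀ - s)) ^ ((n : ℝ) / 2) ≤ 1 / (4 * Real.pi * δ) ^ ((n : ℝ) / 2) := by
    refine one_div_le_one_div_of_le (by positivity) (Real.rpow_le_rpow (by positivity) ?_
      (by positivity))
    gcongr
  have h2 : Real.exp (-(v ^ 2 / (4 * (t₀ - s)))) ≤ Real.exp (-(v ^ 2 / (4 * t₀))) := by
    gcongr
  have h3 : 1 + v ^ 2 ≤ (1 + 8 * t₀) * Real.exp (v ^ 2 / (8 * t₀)) := by
    have h4 := Real.add_one_le_exp (v ^ 2 / (8 * t₀))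
    have h5 : v ^ 2 = 8 * t₀ * (v ^ 2 / (8 * t₀)) := by field_simp
    have h6 : 0 ≤ v ^ 2 / (8 * t₀) := by positivity
    calc 1 + v ^ 2 = 1 + 8 * t₀ * (v ^ 2 / (8 * t₀)) := by rw [← h5]
      _ ≤ (1 + 8 * t₀) * (v ^ 2 / (8 * t₀) + 1) := by linarith
      _ ≤ _ := by gcongr
  have h7 : (1 + v ^ 2) * Real.exp (-(v ^ 2 / (4 * t₀))) ≤
      (1 + 8 * t₀) * Real.exp (E ^ 2 / (8 * t₀)) * Real.exp (-(1 / (16 * t₀)) * ‖Y‖ ^ 2) := by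
    calc (1 + v ^ 2) * Real.exp (-(v ^ 2 / (4 * t₀)))
        ≤ (1 + 8 * t₀) * Real.exp (v ^ 2 / (8 * t₀)) * Real.exp (-(v ^ 2 / (4 * t₀))) := by gcongr
      _ = (1 + 8 * t₀) * Real.exp (-(v ^ 2 / (8 * t₀))) := by
          rw [mul_assoc, ← Real.exp_add]
          congr 2
          field_simp
          ring
      _ ≤ (1 + 8 * t₀) * Real.exp (E ^ 2 / (8 * t₀) + -(1 / (16 * t₀)) * ‖Y‖ ^ 2) := by
          gcongr
          have : E ^ 2 / (8 * t₀) + -(1 / (16 * t₀)) * ‖Y‖ ^ 2 + v ^ 2 / (8 * t₀) =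
            (2 * v ^ 2 + 2 * E ^ 2 - ‖Y‖ ^ 2) / (16 * t₀) := by field_simp; ring
          have h8 : 0 ≤ (2 * v ^ 2 + 2 * E ^ 2 - ‖Y‖ ^ 2) / (16 * t₀) :=
            div_nonneg (by linarith) (by positivity)
          linarith
      _ = _ := by rw [Real.exp_add, mul_assoc]
  calc (1 + v ^ 2) * rho X X₀ s t₀
      = 1 / (4 * Real.pi * (t₀ - s)) ^ ((n : ℝ) / 2) *
        ((1 + v ^ 2) * Real.exp (-(v ^ 2 / (4 * (t₀ - s))))) := by rw [rho]; ring
    _ ≤ 1 / (4 * Real.pi * δ) ^ ((n : ℝ) / 2) * ((1 + v ^ 2) * Real.exp (-(v ^ 2 / (4 * t₀)))) := by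
        gcongr
    _ ≤ 1 / (4 * Real.pi * δ) ^ ((n : ℝ) / 2) * ((1 + 8 * t₀) * Real.exp (E ^ 2 / (8 * t₀)) *
        Real.exp (-(1 / (16 * t₀)) * ‖Y‖ ^ 2)) := by gcongr
    _ = _ := by ring

lemma rho_nonneg (X X₀ : Cn n) {s t₀ : ℝ} (h : s ≤ t₀) : 0 ≤ rho X X₀ s t₀ := by
  have : 0 ≤ t₀ - s := sub_nonneg.2 h
  rw [rho]
  positivity

end GaussianBounds

section Domination

variable {n : ℕ} {S : Type*} [TopologicalSpace S] [ChartedSpace (EuclideanSpace ℝ (Fin n)) S]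
  {o : ∀ x : S, Orientation ℝ (TangentSpace (𝓡 n) x) (Fin n)}
  {T : ℝ} {F : ℝ → S → Cn n} {θ : ℝ → S → ℝ}

lemma norm_normalPart_le (F : S → Cn n) (x : S) (V : Cn n) : ‖normalPart F x V‖ ≤ ‖V‖ :=
  Submodule.norm_starProjection_apply_le _ V

/-- Pointwise bound of the localized integrand, with the kernel and a quadratic weight factored
out. The bound is linear in the size of the cutoff function and its derivative. -/
lemma abs_cutoffIntegrand_le {f : ℝ → ℝ} {X₀ : Cn n} {t₀ t : ℝ} (ht : t < t₀) {x : S}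
    {κ : Cn n → ℝ} {A C B₀ B₁ B₂ δ : ℝ} (hδ : 0 < δ) (hδt : δ ≤ t₀ - t) (hκ : |κ (F t x)| ≤ A)
    (hκ' : ‖fderiv ℝ κ (F t x)‖ ≤ A) (hH : ‖meanCurvature (F t) x‖ ≤ C)
    (h0 : |f (θ t x)| ≤ B₀) (h1 : |deriv f (θ t x)| ≤ B₁) (h2 : |deriv (deriv f) (θ t x)| ≤ B₂) :
    |cutoffIntegrand F θ f X₀ t₀ κ t x| ≤
      A * (B₀ * (2 * C ^ 2 + 1 / (2 * δ ^ 2)) + B₂ * C ^ 2 + C * B₀ + B₁ * C + B₀ / δ) *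
        ((1 + ‖F t x - X₀‖ ^ 2) * rho (F t x) X₀ t t₀) := by
  have hτ : 0 < t₀ - t := sub_pos.2 ht
  have hC0 : 0 ≤ C := (norm_nonneg _).trans hH
  have hA0 : 0 ≤ A := (norm_nonneg _).trans hκ'
  have hB0 : 0 ≤ B₀ := (abs_nonneg _).trans h0
  have hB1 : 0 ≤ B₁ := (abs_nonneg _).trans h1
  have hB2 : 0 ≤ B₂ := (abs_nonneg _).trans h2
  set ρ := rho (F t x) X₀ t t₀ with hρ
  have hρ0 : 0 ≤ ρ := rho_nonneg _ _ ht.le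
  set V := F t x - X₀ with hV
  set N := normalPart (F t) x V with hN
  set H := meanCurvature (F t) x with hHd
  have hNV : ‖N‖ ≤ ‖V‖ := norm_normalPart_le _ _ _
  have hV0 := norm_nonneg V
  set w := 1 + ‖V‖ ^ 2 with hw
  have hw1 : 1 ≤ w := by rw [hw]; nlinarith [sq_nonneg ‖V‖]
  have hVw : 2 * ‖V‖ ≤ w := by rw [hw]; nlinarith [sq_nonneg (‖V‖ - 1)]
  have hwρ : ρ ≤ w * ρ := le_mul_of_one_le_left hρ0 hw1
  have hwρ0 : 0 ≤ w * ρ := hρ0.trans hwρ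
  have hcδ : 1 / (2 * (t₀ - t)) ≤ 1 / (2 * δ) := by gcongr
  -- the square of the normal vector
  have e1 : ‖H + (1 / (2 * (t₀ - t))) • N‖ ^ 2 ≤ (2 * C ^ 2 + 1 / (2 * δ ^ 2)) * w := by
    have g1 : ‖H + (1 / (2 * (t₀ - t))) • N‖ ≤ C + 1 / (2 * δ) * ‖V‖ := by
      refine (norm_add_le _ _).trans (add_le_add hH ?_)
      rw [norm_smul, Real.norm_of_nonneg (by positivity)]
      gcongr
    have g2 : ‖H + (1 / (2 * (t₀ - t))) • N‖ ^ 2 ≤ (C + 1 / (2 * δ) * ‖V‖) ^ 2 := by gcongr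
    have g3 : (C + 1 / (2 * δ) * ‖V‖) ^ 2 ≤ 2 * C ^ 2 + 1 / (2 * δ ^ 2) * ‖V‖ ^ 2 := by
      have g4 : 1 / (2 * δ ^ 2) * ‖V‖ ^ 2 = 2 * (1 / (2 * δ) * ‖V‖) ^ 2 := by field_simp
      rw [g4]
      nlinarith [sq_nonneg (C - 1 / (2 * δ) * ‖V‖)]
    have g5 : 0 ≤ 1 / (2 * δ ^ 2) := by positivity
    have g6 : 0 ≤ C ^ 2 * ‖V‖ ^ 2 := by positivity
    rw [hw]
    nlinarith
  have e2 : |monotonicityIntegrand F θ f X₀ t₀ t x| ≤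
      (B₀ * (2 * C ^ 2 + 1 / (2 * δ ^ 2)) + B₂ * C ^ 2) * (w * ρ) := by
    rw [monotonicityIntegrand]
    refine (abs_sub _ _).trans ?_
    rw [abs_neg, abs_mul, abs_mul, abs_mul, abs_mul, abs_of_nonneg hρ0, abs_pow, abs_norm, abs_pow,
      abs_norm]
    calc _ ≤ B₀ * ρ * ((2 * C ^ 2 + 1 / (2 * δ ^ 2)) * w) + B₂ * C ^ 2 * (w * ρ) := by gcongr
      _ = _ := by ring
  have e3 : |fderiv ℝ κ (F t x) H * (f (θ t x) * ρ)| ≤ A * (C * B₀) * (w * ρ) := by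
    rw [abs_mul, abs_mul, abs_of_nonneg hρ0]
    calc _ ≤ (A * C) * (B₀ * (w * ρ)) := by
          gcongr
          exact ((fderiv ℝ κ (F t x)).le_opNorm H).trans (by gcongr)
      _ = _ := by ring
  have e4 : ‖fluxVec F θ f X₀ t₀ t x‖ ≤ (B₁ * C + B₀ / δ) * (w * ρ) := by
    rw [fluxVec, norm_smul, Real.norm_of_nonneg hρ0]
    have g1 : ‖deriv f (θ t x) • (-(Complex.I • H))‖ ≤ B₁ * C := by
      rw [norm_smul, norm_neg, norm_smul, Complex.norm_I, one_mul, Real.norm_eq_abs]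
      gcongr
    have g2 : ‖(f (θ t x) / (2 * (t₀ - t))) • (V - N)‖ ≤ B₀ / (2 * δ) * (2 * ‖V‖) := by
      rw [norm_smul, Real.norm_eq_abs, abs_div, abs_of_pos (show 0 < 2 * (t₀ - t) by positivity)]
      gcongr
      exact (norm_sub_le _ _).trans (by linarith)
    calc _ ≤ ρ * (B₁ * C * w + B₀ / (2 * δ) * w) := by
          gcongr
          refine (norm_add_le _ _).trans (add_le_add ?_ ?_)
          · exact g1.trans (le_mul_of_one_le_right (by positivity) hw1)
          · exact g2.trans (by gcongr)
      _ = (B₁ * C + B₀ / (2 * δ)) * (w * ρ) := by ring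
      _ ≤ _ := by gcongr; linarith
  rw [cutoffIntegrand]
  refine (abs_sub _ _).trans ?_
  have e5 : |fderiv ℝ κ (F t x) (fluxVec F θ f X₀ t₀ t x)| ≤ A * ((B₁ * C + B₀ / δ) * (w * ρ)) :=
    ((fderiv ℝ κ (F t x)).le_opNorm _).trans (by gcongr)
  have e6 := abs_add_le (κ (F t x) * monotonicityIntegrand F θ f X₀ t₀ t x)
    (fderiv ℝ κ (F t x) H * (f (θ t x) * ρ))
  have e7 : |κ (F t x) * monotonicityIntegrand F θ f X₀ t₀ t x| ≤
      A * ((B₀ * (2 * C ^ 2 + 1 / (2 * δ ^ 2)) + B₂ * C ^ 2) * (w * ρ)) := by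
    rw [abs_mul]; gcongr
  calc _ ≤ A * ((B₀ * (2 * C ^ 2 + 1 / (2 * δ ^ 2)) + B₂ * C ^ 2) * (w * ρ)) +
        A * (C * B₀) * (w * ρ) + A * ((B₁ * C + B₀ / δ) * (w * ρ)) := by linarith
    _ = _ := by ring

namespace IsZeroMaslovLMCF

/-- A flow with bounded velocity `H` moves points by a bounded distance. -/
lemma norm_flow_sub_le (hF : IsZeroMaslovLMCF o T F θ) {b C : ℝ} (hb : b ∈ Ico 0 T)
    (hC : ∀ s ∈ Icc 0 b, ∀ x, ‖meanCurvature (F s) x‖ ≤ C) {s : ℝ} (hs : s ∈ Icc 0 b) (x : S) :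
    ‖F s x - F 0 x‖ ≤ C * b := by
  have hsub : Icc 0 b ⊆ Ico 0 T := fun r hr => ⟨hr.1, hr.2.trans_lt hb.2⟩
  have h0 : (0 : ℝ) ∈ Icc 0 b := ⟨le_rfl, hb.1⟩
  have h1 := (convex_Icc 0 b).norm_image_sub_le_of_norm_hasDerivWithin_le
    (f := fun s => F s x) (fun r hr => (hF.mean_curvature_flow r (hsub hr) x).mono hsub)
    (fun r hr => hC r hr x) h0 hs
  have hC0 : 0 ≤ C := (norm_nonneg _).trans (hC 0 h0 x)
  refine h1.trans ?_
  rw [sub_zero, Real.norm_of_nonneg hs.1]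
  exact mul_le_mul_of_nonneg_left hs.2 hC0

/-- On a compact time interval all integrands are dominated by one Gaussian of the initial
submanifold, uniformly for cutoff functions that are bounded together with their first
derivatives. -/
lemma exists_domination [MeasurableSpace S] (hF : IsZeroMaslovLMCF o T F θ)
    (hc : IsControlledAtInfinity T F θ)
    {f : ℝ → ℝ} (hf : ContDiff ℝ 1 f) (hf'' : PiecewiseContinuousSecondDeriv f) (X₀ : Cn n)
    {t₀ b : ℝ} (hb : b ∈ Ico 0 T) (hbt : b < t₀) (A : ℝ) :
    ∃ M c : ℝ, 0 ≤ M ∧ 0 < c ∧ ∀ s ∈ Icc 0 b, ∀ x, ∀ κ : Cn n → ℝ, |κ (F s x)| ≤ A →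
      ‖fderiv ℝ κ (F s x)‖ ≤ A →
      |cutoffIntegrand F θ f X₀ t₀ κ s x| ≤ M * Real.exp (-c * ‖F 0 x‖ ^ 2) ∧
      |κ (F s x) * (f (θ s x) * rho (F s x) X₀ s t₀)| ≤ M * Real.exp (-c * ‖F 0 x‖ ^ 2) ∧
      |deriv (deriv f) (θ s x) * ‖meanCurvature (F s) x‖ ^ 2 * rho (F s x) X₀ s t₀| ≤
        M * Real.exp (-c * ‖F 0 x‖ ^ 2) := by
  obtain ⟨C, hC⟩ := hc.bounded b hb
  obtain ⟨M, c, hM, hc0, hMc⟩ := exists_rho_le X₀ hb.1 hbt (C * b)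
  obtain ⟨B₀, hB₀⟩ := (isCompact_Icc (a := -C) (b := C)).exists_bound_of_continuousOn
    hf.continuous.continuousOn
  obtain ⟨B₁, hB₁⟩ := (isCompact_Icc (a := -C) (b := C)).exists_bound_of_continuousOn
    (hf.continuous_deriv le_rfl).continuousOn
  obtain ⟨B₂, hB₂0, hB₂⟩ := exists_abs_secondDeriv_le hf'' C
  set δ := t₀ - b with hδ
  have hδ0 : 0 < δ := sub_pos.2 hbt
  set Z := A * (B₀ * (2 * C ^ 2 + 1 / (2 * δ ^ 2)) + B₂ * C ^ 2 + C * B₀ + B₁ * C + B₀ / δ) with hZ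
  refine ⟨(|Z| + |A * B₀| + B₂ * C ^ 2) * M, c, by positivity, hc0, fun s hs x κ hκ hκ' => ?_⟩
  have hst : s < t₀ := hs.2.trans_lt hbt
  have hθ : θ s x ∈ Icc (-C) C := abs_le.1 (hC s hs x).1
  have hr := hMc s hs (F s x) (F 0 x) (hF.norm_flow_sub_le hb (fun r hr y => (hC r hr y).2) hs x)
  have hρ0 := rho_nonneg (F s x) X₀ hst.le
  have hwρ : rho (F s x) X₀ s t₀ ≤ (1 + ‖F s x - X₀‖ ^ 2) * rho (F s x) X₀ s t₀ :=
    le_mul_of_one_le_left hρ0 (by nlinarith [sq_nonneg ‖F s x - X₀‖])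
  have hwρ0 := hρ0.trans hwρ
  have hC2 : 0 ≤ B₂ * C ^ 2 := by positivity
  refine ⟨?_, ?_, ?_⟩
  · have h1 := abs_cutoffIntegrand_le (F := F) (θ := θ) (f := f) (X₀ := X₀) (κ := κ) (x := x) hst
      hδ0 (by rw [hδ]; linarith [hs.2]) hκ hκ' (hC s hs x).2 (hB₀ _ hθ) (hB₁ _ hθ) (hB₂ _ hθ)
    calc _ ≤ Z * ((1 + ‖F s x - X₀‖ ^ 2) * rho (F s x) X₀ s t₀) := h1
      _ ≤ (|Z| + |A * B₀| + B₂ * C ^ 2) * (M * Real.exp (-c * ‖F 0 x‖ ^ 2)) :=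
        mul_le_mul (by linarith [le_abs_self Z, abs_nonneg (A * B₀)]) hr hwρ0
          (by positivity)
      _ = _ := by ring
  · have hB := hB₀ _ hθ
    rw [Real.norm_eq_abs] at hB
    have hA0 : 0 ≤ A := (abs_nonneg _).trans hκ
    have hB00 : 0 ≤ B₀ := (abs_nonneg _).trans hB
    rw [abs_mul, abs_mul, abs_of_nonneg hρ0]
    calc _ ≤ A * (B₀ * ((1 + ‖F s x - X₀‖ ^ 2) * rho (F s x) X₀ s t₀)) := by gcongr
      _ = A * B₀ * ((1 + ‖F s x - X₀‖ ^ 2) * rho (F s x) X₀ s t₀) := by ring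
      _ ≤ (|Z| + |A * B₀| + B₂ * C ^ 2) * (M * Real.exp (-c * ‖F 0 x‖ ^ 2)) :=
        mul_le_mul (by linarith [le_abs_self (A * B₀), abs_nonneg Z]) hr hwρ0 (by positivity)
      _ = _ := by ring
  · rw [abs_mul, abs_mul, abs_pow, abs_norm, abs_of_nonneg hρ0]
    calc _ ≤ B₂ * C ^ 2 * ((1 + ‖F s x - X₀‖ ^ 2) * rho (F s x) X₀ s t₀) := by
          gcongr
          · exact hB₂ _ hθ
          · exact (hC s hs x).2
      _ ≤ (|Z| + |A * B₀| + B₂ * C ^ 2) * (M * Real.exp (-c * ‖F 0 x‖ ^ 2)) :=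
        mul_le_mul (by linarith [abs_nonneg (A * B₀), abs_nonneg Z]) hr hwρ0 (by positivity)
      _ = _ := by ring

end IsZeroMaslovLMCF
end Domination

/-! ### Continuity in time -/

section Continuity

variable {n : ℕ} {S : Type*} [TopologicalSpace S] [ChartedSpace (EuclideanSpace ℝ (Fin n)) S]
  [IsManifold (𝓡 n) ∞ S]
  {o : ∀ x : S, Orientation ℝ (TangentSpace (𝓡 n) x) (Fin n)}
  {T : ℝ} {F : ℝ → S → Cn n} {θ : ℝ → S → ℝ}

/-- The part of `cutoffIntegrand` that does not involve the second derivative of `f`. -/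
def cutoffRegularPart (F : ℝ → S → Cn n) (θ : ℝ → S → ℝ) (f : ℝ → ℝ) (X₀ : Cn n) (t₀ : ℝ)
    (κ : Cn n → ℝ) (t : ℝ) (x : S) : ℝ :=
  κ (F t x) * -(f (θ t x) * rho (F t x) X₀ t t₀ *
    ‖meanCurvature (F t) x + (1 / (2 * (t₀ - t))) • normalPart (F t) x (F t x - X₀)‖ ^ 2) +
    fderiv ℝ κ (F t x) (meanCurvature (F t) x) * (f (θ t x) * rho (F t x) X₀ t t₀) -
    fderiv ℝ κ (F t x) (fluxVec F θ f X₀ t₀ t x)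

omit [IsManifold (𝓡 n) ∞ S] in
lemma cutoffIntegrand_eq (F : ℝ → S → Cn n) (θ : ℝ → S → ℝ) (f : ℝ → ℝ) (X₀ : Cn n) (t₀ : ℝ)
    (κ : Cn n → ℝ) (t : ℝ) (x : S) :
    cutoffIntegrand F θ f X₀ t₀ κ t x = cutoffRegularPart F θ f X₀ t₀ κ t x -
      κ (F t x) * rho (F t x) X₀ t t₀ *
        (deriv (deriv f) (θ t x) * ‖meanCurvature (F t) x‖ ^ 2) := by
  simp only [cutoffIntegrand, cutoffRegularPart, monotonicityIntegrand]
  ring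

namespace IsZeroMaslovLMCF

omit [IsManifold (𝓡 n) ∞ S] in
lemma continuousOn_rho (hF : IsZeroMaslovLMCF o T F θ) (X₀ : Cn n) (t₀ : ℝ) :
    ContinuousOn (fun p : ℝ × S => rho (F p.1 p.2) X₀ p.1 t₀) ((Ico 0 T ∩ Iio t₀) ×ˢ univ) := by
  have h1 : ContinuousOn (fun p : ℝ × S => F p.1 p.2) ((Ico 0 T ∩ Iio t₀) ×ˢ univ) :=
    hF.continuousOn_flow.mono (prod_mono inter_subset_left subset_rfl)
  have h2 : ContinuousOn (fun p : ℝ × S => t₀ - p.1) ((Ico 0 T ∩ Iio t₀) ×ˢ univ) := by fun_prop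
  have h3 : ∀ p ∈ (Ico 0 T ∩ Iio t₀) ×ˢ (univ : Set S), 0 < t₀ - p.1 := fun p hp =>
    sub_pos.2 hp.1.2
  unfold rho
  refine ContinuousOn.mul (ContinuousOn.div continuousOn_const ?_ ?_) ?_
  · exact (continuousOn_const.mul h2).rpow_const fun p hp => Or.inr (by positivity)
  · intro p hp
    have := h3 p hp
    positivity
  · refine Real.continuous_exp.comp_continuousOn (ContinuousOn.neg (ContinuousOn.div ?_ ?_ ?_))
    · exact (h1.sub continuousOn_const).norm.pow 2
    · exact continuousOn_const.mul h2
    · intro p hp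
      have := h3 p hp
      positivity

lemma continuousOn_cutoffRegularPart (hF : IsZeroMaslovLMCF o T F θ) {f : ℝ → ℝ}
    (hf : ContDiff ℝ 1 f) (X₀ : Cn n) (t₀ : ℝ) {κ : Cn n → ℝ} (hκ : ContDiff ℝ 1 κ) :
    ContinuousOn (fun p : ℝ × S => cutoffRegularPart F θ f X₀ t₀ κ p.1 p.2)
      ((Ico 0 T ∩ Iio t₀) ×ˢ univ) := by
  have hsub : (Ico 0 T ∩ Iio t₀) ×ˢ (univ : Set S) ⊆ Ico 0 T ×ˢ univ :=
    prod_mono inter_subset_left subset_rfl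
  have hX := hF.continuousOn_flow.mono hsub
  have hθ := hF.angle_continuous.mono hsub
  have hH := hF.continuousOn_meanCurvature.mono hsub
  have hN := (hF.continuousOn_normalPart X₀).mono hsub
  have hρ := hF.continuousOn_rho X₀ t₀
  have hfθ : ContinuousOn (fun p : ℝ × S => f (θ p.1 p.2)) ((Ico 0 T ∩ Iio t₀) ×ˢ univ) :=
    hf.continuous.comp_continuousOn hθ
  have hf'θ : ContinuousOn (fun p : ℝ × S => deriv f (θ p.1 p.2)) ((Ico 0 T ∩ Iio t₀) ×ˢ univ) :=
    (hf.continuous_deriv le_rfl).comp_continuousOn hθ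
  have hκX : ContinuousOn (fun p : ℝ × S => κ (F p.1 p.2)) ((Ico 0 T ∩ Iio t₀) ×ˢ univ) :=
    hκ.continuous.comp_continuousOn hX
  have hκ'X : ContinuousOn (fun p : ℝ × S => fderiv ℝ κ (F p.1 p.2))
      ((Ico 0 T ∩ Iio t₀) ×ˢ univ) :=
    (hκ.continuous_fderiv (by norm_num)).comp_continuousOn hX
  have hτ : ContinuousOn (fun p : ℝ × S => 1 / (2 * (t₀ - p.1))) ((Ico 0 T ∩ Iio t₀) ×ˢ univ) := by
    refine ContinuousOn.div continuousOn_const (by fun_prop) fun p hp => ?_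
    have : 0 < t₀ - p.1 := sub_pos.2 hp.1.2
    positivity
  have hflux : ContinuousOn (fun p : ℝ × S => fluxVec F θ f X₀ t₀ p.1 p.2)
      ((Ico 0 T ∩ Iio t₀) ×ˢ univ) := by
    have g1 : ContinuousOn (fun p : ℝ × S => deriv f (θ p.1 p.2) •
        (-(Complex.I • meanCurvature (F p.1) p.2))) ((Ico 0 T ∩ Iio t₀) ×ˢ univ) :=
      hf'θ.smul (hH.const_smul Complex.I).neg
    have g2 : ContinuousOn (fun p : ℝ × S => (f (θ p.1 p.2) * (1 / (2 * (t₀ - p.1)))) •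
        (F p.1 p.2 - X₀ - normalPart (F p.1) p.2 (F p.1 p.2 - X₀)))
        ((Ico 0 T ∩ Iio t₀) ×ˢ univ) :=
      (hfθ.mul hτ).smul ((hX.sub continuousOn_const).sub hN)
    simp only [fluxVec, div_eq_mul_one_div (f _)]
    exact hρ.smul (g1.add g2)
  have hsq : ContinuousOn (fun p : ℝ × S => ‖meanCurvature (F p.1) p.2 +
      (1 / (2 * (t₀ - p.1))) • normalPart (F p.1) p.2 (F p.1 p.2 - X₀)‖ ^ 2)
      ((Ico 0 T ∩ Iio t₀) ×ˢ univ) := (hH.add (hτ.smul hN)).norm.pow 2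
  have hfρ : ContinuousOn (fun p : ℝ × S => f (θ p.1 p.2) * rho (F p.1 p.2) X₀ p.1 t₀)
      ((Ico 0 T ∩ Iio t₀) ×ˢ univ) := hfθ.mul hρ
  have h1 : ContinuousOn (fun p : ℝ × S => fderiv ℝ κ (F p.1 p.2) (meanCurvature (F p.1) p.2))
      ((Ico 0 T ∩ Iio t₀) ×ˢ univ) := ContinuousOn.clm_apply hκ'X hH
  have h2 : ContinuousOn (fun p : ℝ × S => fderiv ℝ κ (F p.1 p.2) (fluxVec F θ f X₀ t₀ p.1 p.2))
      ((Ico 0 T ∩ Iio t₀) ×ˢ univ) := ContinuousOn.clm_apply hκ'X hflux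
  unfold cutoffRegularPart
  exact ((hκX.mul (hfρ.mul hsq).neg).add (h1.mul hfρ)).sub h2

variable [MeasurableSpace S] [BorelSpace S]

omit [IsManifold (𝓡 n) ∞ S] [BorelSpace S] [MeasurableSpace S] in
lemma _root_.LagrangianMCF.continuous_slice {Y : Type*} [TopologicalSpace Y] {Q : ℝ → S → Y}
    {I : Set ℝ} (h : ContinuousOn (fun p : ℝ × S => Q p.1 p.2) (I ×ˢ univ)) {t : ℝ} (ht : t ∈ I) :
    Continuous (Q t) :=
  h.comp_continuous (f := fun x : S => (t, x)) (by fun_prop) fun x => ⟨ht, mem_univ x⟩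

omit [IsManifold (𝓡 n) ∞ S] [BorelSpace S] [MeasurableSpace S] in
lemma _root_.LagrangianMCF.continuousOn_time {Y : Type*} [TopologicalSpace Y] {Q : ℝ → S → Y}
    {I : Set ℝ} (h : ContinuousOn (fun p : ℝ × S => Q p.1 p.2) (I ×ˢ univ)) (x : S) :
    ContinuousOn (fun s => Q s x) I :=
  h.comp (f := fun s : ℝ => (s, x)) (by fun_prop) fun s hs => ⟨hs, mem_univ x⟩

lemma measurable_cutoffIntegrand (hF : IsZeroMaslovLMCF o T F θ) {f : ℝ → ℝ}
    (hf : ContDiff ℝ 1 f) (X₀ : Cn n) {t₀ : ℝ} {κ : Cn n → ℝ} (hκ : ContDiff ℝ 1 κ) {t : ℝ}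
    (ht : t ∈ Ico 0 T) (htt : t < t₀) : Measurable (cutoffIntegrand F θ f X₀ t₀ κ t) := by
  have h1 := continuous_slice (hF.continuousOn_cutoffRegularPart hf X₀ t₀ hκ) (t := t) ⟨ht, htt⟩
  have h2 := continuous_slice (Q := fun t x => rho (F t x) X₀ t t₀) (hF.continuousOn_rho X₀ t₀)
    (t := t) ⟨ht, htt⟩
  have h3 := continuous_slice (Q := fun t x => meanCurvature (F t) x)
    hF.continuousOn_meanCurvature ht
  have h4 := continuous_slice hF.continuousOn_flow ht
  have : cutoffIntegrand F θ f X₀ t₀ κ t = _ := funext fun x => cutoffIntegrand_eq F θ f X₀ t₀ κ t x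
  rw [this]
  refine h1.measurable.sub (((hκ.continuous.comp h4).mul h2).measurable.mul ?_)
  exact ((measurable_deriv _).comp (hF.continuous_angle ht).measurable).mul (h3.norm.pow 2).measurable

variable [SecondCountableTopology S]

/-- For almost every point, `f'' ∘ θ` is well behaved there, or the mean curvature vanishes. -/
lemma ae_deriv_deriv_or_meanCurvature_eq_zero (hF : IsZeroMaslovLMCF o T F θ) (hn : 1 ≤ n)
    {f : ℝ → ℝ} (hf'' : PiecewiseContinuousSecondDeriv f) {t : ℝ} (ht : t ∈ Ico 0 T) :
    ∀ᵐ x ∂(areaMeasure (F t)), ContinuousAt (deriv (deriv f)) (θ t x) ∨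
      meanCurvature (F t) x = 0 := by
  have hFt := hF.contMDiff_slice ht
  have himm := hF.immersion t ht
  have hlag := hF.lagrangian t ht
  have hang := hF.angle t ht
  have hθ := hF.continuous_angle ht
  refine ae_areaMeasure_of_charts hFt fun e he => ?_
  have hθe : ContDiffOn ℝ 1 (θ t ∘ e.symm) e.target := fun u hu =>
    (fderiv_angle_eq_inner_meanCurvature hn hFt himm hlag hang hθ he hu).1.contDiffWithinAt
  filter_upwards [ae_differentiableAt_deriv_or_fderiv_eq_zero volume e.open_target hθe hf''] with u h hu
  rcases h hu with h | h
  · exact Or.inl h.2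
  · exact Or.inr (meanCurvature_eq_zero_of_fderiv_angle hn hFt himm hlag hang hθ he hu h)

/-- The localized integrand is continuous in time, at almost every point. -/
lemma ae_continuousWithinAt_cutoffIntegrand (hF : IsZeroMaslovLMCF o T F θ) (hn : 1 ≤ n)
    {f : ℝ → ℝ} (hf : ContDiff ℝ 1 f) (hf'' : PiecewiseContinuousSecondDeriv f) (X₀ : Cn n)
    {t₀ : ℝ} {κ : Cn n → ℝ} (hκ : ContDiff ℝ 1 κ) {t : ℝ} (ht : t ∈ Ico 0 T) (htt : t < t₀) :
    ∀ᵐ x ∂(areaMeasure (F 0)), ContinuousWithinAt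
      (fun s => cutoffIntegrand F θ f X₀ t₀ κ s x) (Ico 0 T ∩ Iio t₀) t := by
  have htI : t ∈ Ico 0 T ∩ Iio t₀ := ⟨ht, htt⟩
  filter_upwards [hF.ae_areaMeasure_iff hn ht (hF.ae_deriv_deriv_or_meanCurvature_eq_zero hn hf'' ht)]
    with x hx
  have h1 := continuousOn_time (hF.continuousOn_cutoffRegularPart hf X₀ t₀ hκ) x t htI
  have h2 := continuousOn_time (Q := fun t x => rho (F t x) X₀ t t₀) (hF.continuousOn_rho X₀ t₀)
    x t htI
  have h3 := (continuousOn_time (Q := fun t x => meanCurvature (F t) x)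
    hF.continuousOn_meanCurvature x t ht).mono inter_subset_left (s := Ico 0 T ∩ Iio t₀)
  have h4 := (continuousOn_time hF.continuousOn_flow x t ht).mono
    inter_subset_left (s := Ico 0 T ∩ Iio t₀)
  have h5 := (continuousOn_time hF.angle_continuous x t ht).mono
    inter_subset_left (s := Ico 0 T ∩ Iio t₀)
  simp only [cutoffIntegrand_eq]
  refine h1.sub (((hκ.continuous.continuousAt.comp_continuousWithinAt h4).mul h2).mul ?_)
  rcases hx with hx | hx
  · exact (ContinuousAt.comp_continuousWithinAt (f := fun s => θ s x) hx h5).mul (h3.norm.pow 2)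
  · -- `f''` is locally bounded, and `|H|²` tends to zero
    obtain ⟨C, hC⟩ := eventually_abs_secondDeriv_le hf'' (θ t x)
    rw [ContinuousWithinAt, hx, norm_zero, zero_pow two_ne_zero, mul_zero]
    have h6 : Tendsto (fun s => C * ‖meanCurvature (F s) x‖ ^ 2) (𝓝[Ico 0 T ∩ Iio t₀] t) (𝓝 0) := by
      have := (h3.norm.pow 2).const_mul C
      simpa [ContinuousWithinAt, hx] using this
    refine squeeze_zero_norm' ?_ h6
    filter_upwards [h5 hC] with s hs
    rw [norm_mul, Real.norm_eq_abs, Real.norm_of_nonneg (sq_nonneg _)]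
    exact mul_le_mul_of_nonneg_right hs (sq_nonneg _)

/-- Integrals against the moving area measure depend continuously on time, for integrands with a
time independent majorant. -/
lemma continuousOn_integral_of_dominated (hF : IsZeroMaslovLMCF o T F θ) (hn : 1 ≤ n)
    {I : Set ℝ} (hI : I ⊆ Ico 0 T) {W : ℝ → S → ℝ} {g : S → ℝ}
    (hg : Integrable g (areaMeasure (F 0)))
    (hm : ∀ s ∈ I, Measurable (W s)) (hbd : ∀ s ∈ I, ∀ x, |W s x| ≤ g x)
    (hcont : ∀ t ∈ I, ∀ᵐ x ∂(areaMeasure (F 0)), ContinuousWithinAt (fun s => W s x) I t) :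
    (∀ s ∈ I, Integrable (W s) (areaMeasure (F s))) ∧
    ContinuousOn (fun s => ∫ x, W s x ∂(areaMeasure (F s))) I := by
  have hm' : ∀ s ∈ I, AEStronglyMeasurable (fun x => areaFactor F s x * W s x) (areaMeasure (F 0)) :=
    fun s hs => ((hF.continuous_areaFactor hn (hI hs)).measurable.mul (hm s hs)).aestronglyMeasurable
  have hbd' : ∀ s ∈ I, ∀ x, ‖areaFactor F s x * W s x‖ ≤ g x := fun s hs x => by
    rw [norm_mul, Real.norm_of_nonneg (areaFactor_pos F s x).le]
    exact (mul_le_of_le_one_left (norm_nonneg _) (areaFactor_le_one F (hI hs).1 x)).trans (hbd s hs x)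
  constructor
  · intro s hs
    rw [hF.integrable_areaMeasure_iff hn (hI hs)]
    exact hg.mono' (hm' s hs) (Eventually.of_forall (hbd' s hs))
  · have h1 : ContinuousOn (fun s => ∫ x, areaFactor F s x * W s x ∂(areaMeasure (F 0))) I := by
      intro t ht
      refine continuousWithinAt_of_dominated (bound := g) ?_ ?_ hg ?_
      · filter_upwards [self_mem_nhdsWithin] with s hs using hm' s hs
      · filter_upwards [self_mem_nhdsWithin] with s hs using Eventually.of_forall (hbd' s hs)
      · filter_upwards [hcont t ht] with x hx
        exact ((continuousOn_time (hF.continuousOn_areaFactor hn) x t (hI ht)).mono hI).mul hx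
    exact h1.congr fun s hs => hF.integral_areaMeasure hn (hI hs) _

end IsZeroMaslovLMCF
end Continuity

/-! ### Removal of the cutoff -/

section Exhaustion

variable {n : ℕ}

/-- Cutoff functions of `ℂⁿ` that exhaust it, with bounded first derivatives. -/
lemma exists_cutoffs (n : ℕ) : ∃ (A : ℝ) (κ : ℕ → Cn n → ℝ), 1 ≤ A ∧ (∀ m, ContDiff ℝ 1 (κ m)) ∧
    (∀ m X, |κ m X| ≤ A) ∧ (∀ m X, ‖fderiv ℝ (κ m) X‖ ≤ A) ∧
    (∀ m, ∃ R : ℝ, ∀ X, R < ‖X‖ → κ m X = 0) ∧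
    ∀ X, ∀ᶠ m in atTop, κ m X = 1 ∧ fderiv ℝ (κ m) X = 0 := by
  set φ : ContDiffBump (0 : Cn n) := ⟨1, 2, one_pos, one_lt_two⟩ with hφ
  have hφ1 : ContDiff ℝ 1 φ := φ.contDiff
  obtain ⟨B, hB⟩ := (φ.hasCompactSupport.fderiv ℝ).exists_bound_of_continuous
    (hφ1.continuous_fderiv (by norm_num))
  set c : ℕ → ℝ := fun m => 1 / ((m : ℝ) + 1) with hc
  have hc0 : ∀ m, 0 < c m := fun m => by simp only [hc]; positivity
  have hc1 : ∀ m, c m ≤ 1 := fun m => by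
    simp only [hc]
    rw [div_le_one (by positivity)]
    linarith [Nat.cast_nonneg (α := ℝ) m]
  have hlin : ∀ m X, HasFDerivAt (fun X : Cn n => c m • X)
      (c m • ContinuousLinearMap.id ℝ (Cn n)) X := fun m X => (hasFDerivAt_id X).const_smul (c m)
  refine ⟨max 1 B, fun m X => φ (c m • X), le_max_left _ _, fun m => ?_, fun m X => ?_,
    fun m X => ?_, fun m => ⟨2 / c m, fun X hX => ?_⟩, fun X => ?_⟩
  · exact hφ1.comp (contDiff_const_smul _)
  · rw [abs_of_nonneg φ.nonneg]
    exact φ.le_one.trans (le_max_left _ _)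
  · have h1 : HasFDerivAt (fun X => φ (c m • X)) _ X :=
      ((hφ1.differentiable (by norm_num)) (c m • X)).hasFDerivAt.comp X (hlin m X)
    rw [h1.fderiv]
    refine (ContinuousLinearMap.opNorm_comp_le _ _).trans ?_
    have h2 : ‖c m • ContinuousLinearMap.id ℝ (Cn n)‖ ≤ 1 := by
      rw [norm_smul, Real.norm_of_nonneg (hc0 m).le]
      exact mul_le_one₀ (hc1 m) (norm_nonneg _) ContinuousLinearMap.norm_id_le
    calc _ ≤ ‖fderiv ℝ φ (c m • X)‖ * 1 := by gcongr
      _ ≤ max 1 B := by rw [mul_one]; exact (hB _).trans (le_max_right _ _)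
  · refine φ.zero_of_le_dist ?_
    rw [dist_zero_right, norm_smul, Real.norm_of_nonneg (hc0 m).le]
    change 2 ≤ _
    rw [div_lt_iff₀ (hc0 m)] at hX
    linarith
  · filter_upwards [eventually_gt_atTop ⌈‖X‖⌉₊] with m hm
    have hXm : ‖X‖ < (m : ℝ) + 1 := by
      have := (Nat.le_ceil ‖X‖).trans_lt (Nat.cast_lt.2 hm)
      linarith
    have hball : X ∈ Metric.ball (0 : Cn n) ((m : ℝ) + 1) := by simpa using hXm
    have hone : ∀ Y ∈ Metric.ball (0 : Cn n) ((m : ℝ) + 1), φ (c m • Y) = 1 := by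
      intro Y hY
      refine φ.one_of_mem_closedBall ?_
      rw [mem_closedBall_zero_iff, norm_smul, Real.norm_of_nonneg (hc0 m).le]
      change _ ≤ (1 : ℝ)
      simp only [hc]
      rw [one_div_mul_eq_div, div_le_one (by positivity)]
      exact (mem_ball_zero_iff.1 hY).le
    refine ⟨hone X hball, ?_⟩
    have h1 : (fun X => φ (c m • X)) =ᶠ[𝓝 X] fun _ => (1 : ℝ) := by
      filter_upwards [Metric.isOpen_ball.mem_nhds hball] with Y hY using hone Y hY
    rw [h1.fderiv_eq, fderiv_fun_const]
    rfl

end Exhaustion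

section Monotonicity

variable {n : ℕ} {S : Type*} [TopologicalSpace S] [ChartedSpace (EuclideanSpace ℝ (Fin n)) S]
  [IsManifold (𝓡 n) ∞ S]
  {o : ∀ x : S, Orientation ℝ (TangentSpace (𝓡 n) x) (Fin n)}
  {T : ℝ} {F : ℝ → S → Cn n} {θ : ℝ → S → ℝ}

omit [IsManifold (𝓡 n) ∞ S] in
lemma cutoffIntegrand_of_eq_one (F : ℝ → S → Cn n) (θ : ℝ → S → ℝ) (f : ℝ → ℝ) (X₀ : Cn n)
    (t₀ : ℝ) {κ : Cn n → ℝ} {t : ℝ} {x : S} (h : κ (F t x) = 1) (h' : fderiv ℝ κ (F t x) = 0) :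
    cutoffIntegrand F θ f X₀ t₀ κ t x = monotonicityIntegrand F θ f X₀ t₀ t x := by
  simp [cutoffIntegrand, h, h']

namespace IsZeroMaslovLMCF

variable [MeasurableSpace S] [BorelSpace S] [SecondCountableTopology S]

omit [IsManifold (𝓡 n) ∞ S] [BorelSpace S] [SecondCountableTopology S] in
/-- Outside a compact set, the flow stays outside a given ball during a compact time interval: `F₀` is
proper and the displacement is bounded. -/
lemma isCompact_small_flow [T2Space S] (hF : IsZeroMaslovLMCF o T F θ)
    (hc : IsControlledAtInfinity T F θ) {b : ℝ} (hb : b ∈ Ico 0 T) (R : ℝ) :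
    ∃ K : Set S, IsCompact K ∧ ∀ s ∈ Icc 0 b, ∀ x ∉ K, R < ‖F s x‖ := by
  obtain ⟨C, hC⟩ := hc.bounded b hb
  have hF0 : Continuous (F 0) := (hF.contMDiff_slice ⟨le_rfl, hb.1.trans_lt hb.2⟩).continuous
  refine ⟨F 0 ⁻¹' Metric.closedBall 0 (R + C * b), ?_, fun s hs x hx => ?_⟩
  · have h1 := hc.proper (isCompact_closedBall (0 : Cn n) (R + C * b)).compl_mem_cocompact
    obtain ⟨K, hK, hKs⟩ := mem_cocompact.1 h1
    refine hK.of_isClosed_subset (Metric.isClosed_closedBall.preimage hF0) fun x hx => ?_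
    by_contra hn
    exact hKs hn hx
  · have h1 : R + C * b < ‖F 0 x‖ := by simpa using hx
    have h2 := hF.norm_flow_sub_le hb (fun r hr y => (hC r hr y).2) hs x
    have h3 : ‖F 0 x‖ ≤ ‖F s x‖ + ‖F s x - F 0 x‖ := by
      have := norm_sub_le (F s x) (F s x - F 0 x)
      rwa [sub_sub_cancel] at this
    linarith

/-- The integrated form of the monotonicity formula, on a compact time interval. -/
lemma integral_monotonicity [T2Space S] (hF : IsZeroMaslovLMCF o T F θ) (hn : 1 ≤ n)
    (hc : IsControlledAtInfinity T F θ) {f : ℝ → ℝ} (hf : ContDiff ℝ 1 f)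
    (hf'' : PiecewiseContinuousSecondDeriv f) (X₀ : Cn n) {t₀ b : ℝ} (hb : b ∈ Ico 0 T)
    (hbt : b < t₀) :
    (∀ s ∈ Icc 0 b, Integrable (fun x => f (θ s x) * rho (F s x) X₀ s t₀) (areaMeasure (F s)) ∧
      Integrable (monotonicityIntegrand F θ f X₀ t₀ s) (areaMeasure (F s)) ∧
      Integrable (fun x => deriv (deriv f) (θ s x) * ‖meanCurvature (F s) x‖ ^ 2 *
        rho (F s x) X₀ s t₀) (areaMeasure (F s))) ∧
    ContinuousOn (fun s => ∫ x, monotonicityIntegrand F θ f X₀ t₀ s x ∂(areaMeasure (F s)))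
      (Icc 0 b) ∧
    ∀ s ∈ Icc 0 b, ∫ x, f (θ s x) * rho (F s x) X₀ s t₀ ∂(areaMeasure (F s)) =
      ∫ x, f (θ 0 x) * rho (F 0 x) X₀ 0 t₀ ∂(areaMeasure (F 0)) +
      ∫ r in (0 : ℝ)..s, ∫ x, monotonicityIntegrand F θ f X₀ t₀ r x ∂(areaMeasure (F r)) := by
  obtain ⟨A, κ, hA1, hκ, hκA, hκ'A, hκ0, hκlim⟩ := exists_cutoffs n
  obtain ⟨M, c, hM, hc0, hdom⟩ := hF.exists_domination hc hf hf'' X₀ hb hbt A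
  have hI : Icc 0 b ⊆ Ico 0 T ∩ Iio t₀ := fun s hs =>
    ⟨⟨hs.1, hs.2.trans_lt hb.2⟩, hs.2.trans_lt hbt⟩
  have hIT : Icc 0 b ⊆ Ico 0 T := hI.trans inter_subset_left
  have h0 : (0 : ℝ) ∈ Icc 0 b := ⟨le_rfl, hb.1⟩
  set g : S → ℝ := fun x => M * Real.exp (-c * ‖F 0 x‖ ^ 2) with hg
  have hgi : Integrable g (areaMeasure (F 0)) := (hc.gaussian_area c hc0).const_mul M
  have hg0 : ∀ x, 0 ≤ g x := fun x => by positivity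
  have hgm : Measurable g := by
    have := (hF.contMDiff_slice (hIT h0)).continuous
    simp only [hg]
    fun_prop
  have hgs := hF.continuousOn_integral_of_dominated hn hIT (W := fun _ => g) hgi (fun _ _ => hgm)
    (fun s hs x => (abs_of_nonneg (hg0 x)).le)
    fun t ht => Eventually.of_forall fun x => continuousWithinAt_const
  -- continuity of the localized integrals
  have hW : ∀ k : Cn n → ℝ, ContDiff ℝ 1 k → (∀ X, |k X| ≤ A) → (∀ X, ‖fderiv ℝ k X‖ ≤ A) →
      _ ∧ _ := fun k hk h1 h2 =>
    hF.continuousOn_integral_of_dominated hn hIT (W := cutoffIntegrand F θ f X₀ t₀ k) hgi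
      (fun s hs => hF.measurable_cutoffIntegrand hf X₀ hk (hI hs).1 (hI hs).2)
      (fun s hs x => (hdom s hs x k (h1 _) (h2 _)).1)
      fun t ht => (hF.ae_continuousWithinAt_cutoffIntegrand hn hf hf'' X₀ hk (hI ht).1 (hI ht).2).mono
        fun x hx => hx.mono hI
  have hJ : ∀ k : Cn n → ℝ, ContDiff ℝ 1 k → ContinuousOn (fun p : ℝ × S =>
      k (F p.1 p.2) * (f (θ p.1 p.2) * rho (F p.1 p.2) X₀ p.1 t₀)) (Icc 0 b ×ˢ univ) := by
    intro k hk
    have e1 : ContinuousOn (fun p : ℝ × S => k (F p.1 p.2)) (Icc 0 b ×ˢ univ) :=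
      hk.continuous.comp_continuousOn (hF.continuousOn_flow.mono (prod_mono hIT subset_rfl))
    have e2 : ContinuousOn (fun p : ℝ × S => f (θ p.1 p.2)) (Icc 0 b ×ˢ univ) :=
      hf.continuous.comp_continuousOn (hF.angle_continuous.mono (prod_mono hIT subset_rfl))
    exact e1.mul (e2.mul ((hF.continuousOn_rho X₀ t₀).mono (prod_mono hI subset_rfl)))
  have hV : ∀ k : Cn n → ℝ, ContDiff ℝ 1 k → (∀ X, |k X| ≤ A) → (∀ X, ‖fderiv ℝ k X‖ ≤ A) →
      _ ∧ _ := fun k hk h1 h2 =>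
    hF.continuousOn_integral_of_dominated hn hIT
      (W := fun s x => k (F s x) * (f (θ s x) * rho (F s x) X₀ s t₀)) hgi
      (fun s hs => (continuous_slice (Q := fun s x => k (F s x) * (f (θ s x) *
        rho (F s x) X₀ s t₀)) (hJ k hk) hs).measurable)
      (fun s hs x => (hdom s hs x k (h1 _) (h2 _)).2.1)
      fun t ht => Eventually.of_forall fun x => continuousOn_time (Q := fun s x => k (F s x) *
        (f (θ s x) * rho (F s x) X₀ s t₀)) (hJ k hk) x t ht
  have hone : ContDiff ℝ 1 (fun _ : Cn n => (1 : ℝ)) := contDiff_const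
  have hone1 : ∀ X : Cn n, |(fun _ : Cn n => (1 : ℝ)) X| ≤ A := fun X => by simpa using hA1
  have hone2 : ∀ X : Cn n, ‖fderiv ℝ (fun _ : Cn n => (1 : ℝ)) X‖ ≤ A := fun X => by
    simpa using zero_le_one.trans hA1
  have hW1 := hW _ hone hone1 hone2
  have hV1 := hV _ hone hone1 hone2
  have hcut1 : ∀ s x, cutoffIntegrand F θ f X₀ t₀ (fun _ => 1) s x =
      monotonicityIntegrand F θ f X₀ t₀ s x := fun s x =>
    cutoffIntegrand_of_eq_one F θ f X₀ t₀ rfl (by simp)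
  have hcut1' : ∀ s, cutoffIntegrand F θ f X₀ t₀ (fun _ => 1) s =
      monotonicityIntegrand F θ f X₀ t₀ s := fun s => funext (hcut1 s)
  simp only [hcut1, hcut1'] at hW1
  simp only [one_mul] at hV1
  refine ⟨fun s hs => ⟨hV1.1 s hs, hW1.1 s hs, ?_⟩, hW1.2, fun s hs => ?_⟩
  · refine (hgs.1 s hs).mono' ?_ (Eventually.of_forall fun x =>
      (hdom s hs x (fun _ => 1) (hone1 (F s x)) (hone2 (F s x))).2.2)
    have e1 := continuous_slice (Q := fun t x => meanCurvature (F t) x)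
      hF.continuousOn_meanCurvature (hIT hs)
    have e2 := continuous_slice (Q := fun t x => rho (F t x) X₀ t t₀) (hF.continuousOn_rho X₀ t₀)
      (hI hs)
    exact ((((measurable_deriv _).comp (hF.continuous_angle (hIT hs)).measurable).mul
      (e1.norm.pow 2).measurable).mul e2.measurable).aestronglyMeasurable
  · have hsI : Icc 0 s ⊆ Icc 0 b := Icc_subset_Icc_right hs.2
    -- the formula with cutoff, integrated in time
    have hm : ∀ m, ∫ r in (0 : ℝ)..s, ∫ x, cutoffIntegrand F θ f X₀ t₀ (κ m) r x ∂(areaMeasure (F r)) =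
        ∫ x, κ m (F s x) * (f (θ s x) * rho (F s x) X₀ s t₀) ∂(areaMeasure (F s)) -
        ∫ x, κ m (F 0 x) * (f (θ 0 x) * rho (F 0 x) X₀ 0 t₀) ∂(areaMeasure (F 0)) := by
      intro m
      obtain ⟨R, hR⟩ := hκ0 m
      obtain ⟨K, hK, hKR⟩ := hF.isCompact_small_flow hc hb R
      refine intervalIntegral.integral_eq_sub_of_hasDerivAt_of_le hs.1
        ((hV _ (hκ m) (hκA m) (hκ'A m)).2.mono hsI) (fun r hr => ?_) ?_
      · exact hF.hasDerivAt_integral_cutoff hn hf hf'' X₀ hb.2.le hbt.le (hκ m) hK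
          (fun q hq x hx => hR _ (hKR q (Ioo_subset_Icc_self hq) x hx)) ⟨hr.1, hr.2.trans_le hs.2⟩
      · refine ContinuousOn.intervalIntegrable ?_
        rw [uIcc_of_le hs.1]
        exact (hW _ (hκ m) (hκA m) (hκ'A m)).2.mono hsI
    have hlimV : ∀ r ∈ Icc 0 b, Tendsto (fun m => ∫ x, κ m (F r x) * (f (θ r x) *
        rho (F r x) X₀ r t₀) ∂(areaMeasure (F r))) atTop
        (𝓝 (∫ x, f (θ r x) * rho (F r x) X₀ r t₀ ∂(areaMeasure (F r)))) := by
      intro r hr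
      refine tendsto_integral_of_dominated_convergence g
        (fun m => ((hV _ (hκ m) (hκA m) (hκ'A m)).1 r hr).aestronglyMeasurable) (hgs.1 r hr)
        (fun m => Eventually.of_forall fun x => (hdom r hr x (κ m) (hκA m _) (hκ'A m _)).2.1)
        (Eventually.of_forall fun x => tendsto_const_nhds.congr' ?_)
      filter_upwards [hκlim (F r x)] with m hm
      rw [hm.1, one_mul]
    have hlimW : ∀ r ∈ Icc 0 b, Tendsto (fun m => ∫ x, cutoffIntegrand F θ f X₀ t₀ (κ m) r x
        ∂(areaMeasure (F r))) atTop
        (𝓝 (∫ x, monotonicityIntegrand F θ f X₀ t₀ r x ∂(areaMeasure (F r)))) := by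
      intro r hr
      refine tendsto_integral_of_dominated_convergence g
        (fun m => ((hW _ (hκ m) (hκA m) (hκ'A m)).1 r hr).aestronglyMeasurable) (hgs.1 r hr)
        (fun m => Eventually.of_forall fun x => (hdom r hr x (κ m) (hκA m _) (hκ'A m _)).1)
        (Eventually.of_forall fun x => tendsto_const_nhds.congr' ?_)
      filter_upwards [hκlim (F r x)] with m hm
      exact (cutoffIntegrand_of_eq_one F θ f X₀ t₀ hm.1 hm.2).symm
    have huI : uIoc 0 s ⊆ Icc 0 b := by
      rw [uIoc_of_le hs.1]
      exact Ioc_subset_Icc_self.trans hsI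
    have hlim : Tendsto (fun m => ∫ r in (0 : ℝ)..s, ∫ x, cutoffIntegrand F θ f X₀ t₀ (κ m) r x
        ∂(areaMeasure (F r))) atTop (𝓝 (∫ r in (0 : ℝ)..s,
          ∫ x, monotonicityIntegrand F θ f X₀ t₀ r x ∂(areaMeasure (F r)))) := by
      refine intervalIntegral.tendsto_integral_filter_of_dominated_convergence
        (fun r => ∫ x, g x ∂(areaMeasure (F r))) (Eventually.of_forall fun m => ?_)
        (Eventually.of_forall fun m => Eventually.of_forall fun r hr => ?_) ?_
        (Eventually.of_forall fun r hr => hlimW r (huI hr))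
      · exact ((hW _ (hκ m) (hκA m) (hκ'A m)).2.mono huI).aestronglyMeasurable measurableSet_uIoc
      · exact norm_integral_le_of_norm_le (hgs.1 r (huI hr)) (Eventually.of_forall fun x =>
          (hdom r (huI hr) x (κ m) (hκA m _) (hκ'A m _)).1)
      · refine ContinuousOn.intervalIntegrable ?_
        rw [uIcc_of_le hs.1]
        exact hgs.2.mono hsI
    simp only [hm] at hlim
    have := tendsto_nhds_unique ((hlimV s hs).sub (hlimV 0 h0)) hlim
    linarith

lemma integrable_of_tsupport_subset_source (hF : ContMDiff (𝓡 n) 𝓘(ℝ, Cn n) ∞ (F 0))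
    {e : OpenPartialHomeomorph S (EuclideanSpace ℝ (Fin n))}
    (he : e ∈ atlas (EuclideanSpace ℝ (Fin n)) S) {h : S → ℝ} (hh : Continuous h)
    (hK : IsCompact (tsupport h)) (hhe : tsupport h ⊆ e.source) :
    Integrable h (areaMeasure (F 0)) := by
  have hK' : IsCompact (e '' tsupport h) := hK.image_of_continuousOn (e.continuousOn.mono hhe)
  have hKU : e '' tsupport h ⊆ e.target := by
    rintro _ ⟨x, hx, rfl⟩
    exact e.map_source (hhe hx)
  refine (integral_areaMeasure_of_chart hF he
    (fun x hx => image_eq_zero_of_notMem_tsupport fun hx' => hx (hhe hx')) ?_).1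
  refine IntegrableOn.of_forall_sdiff_eq_zero (s := e '' tsupport h) ?_
    e.open_target.measurableSet fun u hu => ?_
  · exact ContinuousOn.integrableOn_compact hK' (((_root_.LagrangianMCF.continuousOn_areaDensity hF he).mul
      (hh.comp_continuousOn e.continuousOn_symm)).mono hKU)
  · rw [image_eq_zero_of_notMem_tsupport fun hx => hu.2 ⟨_, hx, e.right_inv hu.1⟩, mul_zero]

/-- The flow of a compact manifold is controlled at infinity. -/
lemma isControlledAtInfinity_of_compactSpace [T2Space S] [CompactSpace S]
    (hF : IsZeroMaslovLMCF o T F θ) (hT : 0 < T) : IsControlledAtInfinity T F θ := by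
  have hF0 : ContMDiff (𝓡 n) 𝓘(ℝ, Cn n) ∞ (F 0) := hF.contMDiff_slice ⟨le_rfl, hT⟩
  refine ⟨by simp, fun c _ => ?_, fun b hb => ?_⟩
  · obtain ⟨A, -, hA⟩ := (isCompact_univ (X := S)).elim_nhds_subcover
      (fun x : S => (chartAt (EuclideanSpace ℝ (Fin n)) x).source)
      (fun x _ => chart_source_mem_nhds _ x)
    obtain ⟨p, hp⟩ := SmoothPartitionOfUnity.exists_isSubordinate (𝓡 n) (isClosed_univ (X := S))
      (fun x : A => (chartAt (EuclideanSpace ℝ (Fin n)) (x : S)).source)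
      (fun x => (chartAt _ _).open_source) (fun x hx => by
        simpa only [mem_iUnion, Subtype.exists, exists_prop] using hA hx)
    have hcont : Continuous fun x => Real.exp (-c * ‖F 0 x‖ ^ 2) := by
      have := hF0.continuous
      fun_prop
    have hsum : ∀ x, ∑ i, p i x * Real.exp (-c * ‖F 0 x‖ ^ 2) = Real.exp (-c * ‖F 0 x‖ ^ 2) := by
      intro x
      rw [← Finset.sum_mul, ← finsum_eq_sum_of_fintype, p.sum_eq_one (mem_univ x), one_mul]
    refine (integrable_finsetSum Finset.univ fun i _ => ?_).congr (Eventually.of_forall hsum)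
    have hts : tsupport (fun x => p i x * Real.exp (-c * ‖F 0 x‖ ^ 2)) ⊆
        (chartAt (EuclideanSpace ℝ (Fin n)) (i : S)).source :=
      (closure_mono (Function.support_mul_subset_left _ _)).trans (hp i)
    exact integrable_of_tsupport_subset_source hF0 (chart_mem_atlas _ _)
      ((p i).contMDiff.continuous.mul hcont) (isClosed_tsupport _).isCompact hts
  · have hsub : Icc 0 b ⊆ Ico 0 T := fun s hs => ⟨hs.1, hs.2.trans_lt hb.2⟩
    have hK : IsCompact (Icc 0 b ×ˢ (univ : Set S)) := isCompact_Icc.prod isCompact_univ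
    obtain ⟨C₁, h₁⟩ := hK.exists_bound_of_continuousOn
      (hF.angle_continuous.mono (prod_mono hsub subset_rfl))
    obtain ⟨C₂, h₂⟩ := hK.exists_bound_of_continuousOn
      (hF.continuousOn_meanCurvature.mono (prod_mono hsub subset_rfl))
    exact ⟨max C₁ C₂, fun t ht x => ⟨(h₁ (t, x) ⟨ht, mem_univ x⟩).trans (le_max_left _ _),
      (h₂ (t, x) ⟨ht, mem_univ x⟩).trans (le_max_right _ _)⟩⟩

end IsZeroMaslovLMCF
end Monotonicity

/-- The fundamental theorem of calculus, as a derivative within a half-open interval: two-sided at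
positive times and from the right at time `0`. -/
lemma hasDerivWithinAt_of_integral {G I : ℝ → ℝ} {b T t : ℝ} (ht : t ∈ Ico 0 b)
    (hI : ContinuousOn I (Icc 0 b)) (hG : ∀ s ∈ Icc 0 b, G s = G 0 + ∫ r in (0 : ℝ)..s, I r) :
    HasDerivWithinAt G (I t) (Ico 0 T) t := by
  have hb : (0 : ℝ) ≤ b := ht.1.trans ht.2.le
  have htb : t ∈ Icc 0 b := Ico_subset_Icc_self ht
  have hc : Continuous (IccExtend hb ((Icc 0 b).domRestrict I)) :=
    (continuousOn_iff_continuous_domRestrict.1 hI).Icc_extend'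
  have h1 := (hc.integral_hasStrictDerivAt 0 t).hasDerivAt.const_add (G 0)
  rw [IccExtend_of_mem hb _ htb] at h1
  have h2 : HasDerivWithinAt G (I t) (Icc 0 b) t := by
    refine h1.hasDerivWithinAt.congr_of_mem (fun s hs => ?_) htb
    rw [hG s hs]
    congr 1
    refine intervalIntegral.integral_congr fun r hr => ?_
    rw [uIcc_of_le hs.1] at hr
    exact (IccExtend_of_mem hb ((Icc 0 b).domRestrict I) ⟨hr.1, hr.2.trans hs.2⟩).symm
  refine h2.mono_of_mem_nhdsWithin ?_
  filter_upwards [self_mem_nhdsWithin, mem_nhdsWithin_of_mem_nhds (Iio_mem_nhds ht.2)] with s hs hs'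
  exact ⟨hs.1, (mem_Iio.1 hs').le⟩

end LagrangianMCF

end

/-! ### The monotonicity formula -/

theorem corollary3p2 {n : ℕ} (hn : 1 ≤ n)
    {S : Type*} [TopologicalSpace S] [T2Space S] [SecondCountableTopology S]
    [MeasurableSpace S] [BorelSpace S]
    [ChartedSpace (EuclideanSpace ℝ (Fin n)) S] [IsManifold (𝓡 n) ∞ S]
    (o : ∀ x : S, Orientation ℝ (TangentSpace (𝓡 n) x) (Fin n))
    (T : ℝ) (F : ℝ → S → Cn n) (θ : ℝ → S → ℝ)
    (hF : IsZeroMaslovLMCF o T F θ)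
    (hS : CompactSpace S ∨ IsControlledAtInfinity T F θ)
    (f : ℝ → ℝ) (hf_nonneg : ∀ s, 0 ≤ f s) (hf : ContDiff ℝ 1 f)
    (hf'' : PiecewiseContinuousSecondDeriv f)
    (X₀ : Cn n) (t₀ t : ℝ) (ht : t ∈ Set.Ico 0 T) (htt₀ : t < t₀) :
    MeasureTheory.Integrable (fun x => f (θ t x) * rho (F t x) X₀ t t₀) (areaMeasure (F t)) ∧
    MeasureTheory.Integrable (fun x => f (θ t x) * rho (F t x) X₀ t t₀ *
      ‖meanCurvature (F t) x + (1 / (2 * (t₀ - t))) • normalPart (F t) x (F t x - X₀)‖ ^ 2)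
      (areaMeasure (F t)) ∧
    MeasureTheory.Integrable (fun x => deriv (deriv f) (θ t x) *
      ‖meanCurvature (F t) x‖ ^ 2 * rho (F t x) X₀ t t₀) (areaMeasure (F t)) ∧
    HasDerivWithinAt
      (fun s => ∫ x, f (θ s x) * rho (F s x) X₀ s t₀ ∂(areaMeasure (F s)))
      (-(∫ x, f (θ t x) * rho (F t x) X₀ t t₀ *
          ‖meanCurvature (F t) x + (1 / (2 * (t₀ - t))) • normalPart (F t) x (F t x - X₀)‖ ^ 2
          ∂(areaMeasure (F t)))
        - ∫ x, deriv (deriv f) (θ t x) * ‖meanCurvature (F t) x‖ ^ 2 * rho (F t x) X₀ t t₀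
          ∂(areaMeasure (F t)))
      (Set.Ico 0 T) t := by
  have hc : IsControlledAtInfinity T F θ := by
    rcases hS with h | h
    · exact hF.isControlledAtInfinity_of_compactSpace (ht.1.trans_lt ht.2)
    · exact h
  -- the integrated formula is used on `[0, b]`, with a time `b` between `t` and `min T t₀`
  obtain ⟨b, htb, hbT⟩ := exists_between (lt_min ht.2 htt₀)
  have hb : b ∈ Ico 0 T := ⟨ht.1.trans htb.le, hbT.trans_le (min_le_left _ _)⟩
  obtain ⟨hint, hcont, hG⟩ := hF.integral_monotonicity hn hc hf hf'' X₀ hb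
    (hbT.trans_le (min_le_right _ _))
  obtain ⟨h1, h2, h3⟩ := hint t ⟨ht.1, htb.le⟩
  have h4 : Integrable (fun x => f (θ t x) * rho (F t x) X₀ t t₀ *
      ‖meanCurvature (F t) x + (1 / (2 * (t₀ - t))) • normalPart (F t) x (F t x - X₀)‖ ^ 2)
      (areaMeasure (F t)) := by
    refine ((h2.add h3).neg).congr (Eventually.of_forall fun x => ?_)
    simp only [Pi.neg_apply, Pi.add_apply, monotonicityIntegrand]
    ring
  refine ⟨h1, h4, h3, ?_⟩
  have h5 := hasDerivWithinAt_of_integral (T := T) ⟨ht.1, htb⟩ hcont hG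
  have h6 : ∫ x, monotonicityIntegrand F θ f X₀ t₀ t x ∂(areaMeasure (F t)) =
      -(∫ x, f (θ t x) * rho (F t x) X₀ t t₀ *
          ‖meanCurvature (F t) x + (1 / (2 * (t₀ - t))) • normalPart (F t) x (F t x - X₀)‖ ^ 2
          ∂(areaMeasure (F t)))
        - ∫ x, deriv (deriv f) (θ t x) * ‖meanCurvature (F t) x‖ ^ 2 * rho (F t x) X₀ t t₀
          ∂(areaMeasure (F t)) := by
    simp only [monotonicityIntegrand]
    rw [← integral_neg]
    exact integral_sub h4.neg h3
  rwa [h6] at h5
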